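/- Let $\mathbb K$ be a field of characteristic zero, let $r\ge 2$, and let $\mathcal A^*=\bigoplus_{k=0}^n\mathcal A^k$ be an $(r-1)$-connected Poincaré DGCA of degree $n$ over $\mathbb K$: a differential graded commutative algebra with $H^0(\mathcal A)=\mathbb K$ and $H^k(\mathcal A)=0$ for $1\le k\le r-1$, with finite-dimensional cohomology, and with a linear form $\int\colon H^n(\mathcal A)\to\mathbb K$ such that the pairing on $H^*(\mathcal A)$ given on homogeneous classes by $\langle\alpha,\beta\rangle=\int\alpha\cdot\beta$ if $\deg\alpha+\deg\beta=n$, and by $0$ otherwise, is non-degenerate. On $\mathcal A^*$ put $\langle a,b\rangle=\int[a\cdot b]$ if $\deg a+\deg b=n$, and $0$ otherwise. Let $d^-\colon\mathcal A^*\to\mathcal A^{*-1}$ be a Hodge homotopy, that is, $d^-d^-=0$, $d^-dd^-=d^-$, $dd^-d=d$, $\langle\operatorname{Im}d^-,\operatorname{Im}d^-\rangle=0$ and $\langle\operatorname{Im}\pi_{\mathcal H},\operatorname{Im}d^-\rangle=0$, where $\pi_{\mathcal H}=\mathrm{id}-(dd^-+d^-d)$, and let $\mathcal H^*=\operatorname{Im}\pi_{\mathcal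 H}$ be its harmonic subspace. Assume $b_r=\dim_{\mathbb K}H^r(\mathcal A)=1$. Then $\mathcal H^*$ carries a minimal unital $C_\infty$-algebra structure $(m_k)_{k\ge2}$, with unit $1\in\mathcal H^0$, such that the following hold. 1. There is a unital $C_\infty$-quasi-isomorphism $\mathcal H^*\to\mathcal A^*$ whose linear part is the inclusion. 2. $m_2(\alpha,\beta)=\pi_{\mathcal H}(\alpha\cdot\beta)$ for all $\alpha,\beta\in\mathcal H^*$. More generally, the structure is the one obtained by homotopy transfer along $d^-$: $m_k=\pi_{\mathcal H}\circ\widehat m_k$ for all $k\ge2$, where, for homogeneous $\alpha_i\in\mathcal H^*$, $\widehat m_2(\alpha_1,\alpha_2)=\alpha_1\cdot\alpha_2$ and, for $k\ge3$, $$\begin{aligned}\widehat m_k(\alpha_1,\dots,\alpha_k)={}&(-1)^{k-1}d^-\widehat m_{k-1}(\alpha_1,\dots,\alpha_{k-1})\cdot\alpha_k-(-1)^{k\deg\alpha_1}\alpha_1\cdot d^-\widehat m_{k-1}(\alpha_2,\dots,\alpha_k)\\&-\sum_{i=2}^{k-2}(-1)^{i+(k-i-1)(\deg\alpha_1+\dots+\deg\alpha_i)}\,d^-\widehat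 m_i(\alpha_1,\dots,\alpha_i)\cdot d^-\widehat m_{k-i}(\alpha_{i+1},\dots,\alpha_k).\end{aligned}$$ 3. For every integer $\ell\ge4$ with $n\le\ell(r-1)+4$, one has $m_k=0$ for all $k\ge\ell-1$. In particular, $m_k=0$ for all $k\ge5$ if $n\le6r-2$; $m_k=0$ for all $k\ge4$ if $n\le5r-1$; and $m_k=0$ for all $k\ge3$ if $n\le4r$. 4. If $n\le4r$, then $\mathcal A^*$ is formal, that is, connected to $(H^*(\mathcal A),0)$ by a finite zig-zag of quasi-isomorphisms of differential graded commutative algebras. -/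

import Mathlib

open DirectSum

universe u

noncomputable section

/-- The map induced by `f` on cohomology, `ker dV / im dV → ker dW / im dW`, is bijective
(injectivity and surjectivity are written out on representatives).  It is used only for maps `f`
with `f ∘ dV = dW ∘ f`. -/
def InducesCohomologyIso {K V W : Type*} [Field K] [AddCommGroup V] [Module K V]
    [AddCommGroup W] [Module K W] (dV : V →ₗ[K] V) (dW : W →ₗ[K] W) (f : V →ₗ[K] W) : Prop :=
  (∀ x, dV x = 0 → (∃ y, dW y = f x) → ∃ z, dV z = x) ∧
    ∀ y, dW y = 0 → ∃ x, dV x = 0 ∧ ∃ z, y = f x + dW z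

/-! ### Differential graded commutative algebras -/

/-- A differential graded commutative algebra (DGCA) `A = ⨁_{k ≥ 0} A^k` over `K`, with a
differential of degree `+1`. The grading is indexed by `ℤ` and vanishes in negative degrees. -/
structure DGCA (K : Type u) [Field K] where
  carrier : Type u
  [ring : Ring carrier]
  [algebra : Algebra K carrier]
  gr : ℤ → Submodule K carrier
  [graded : GradedAlgebra gr]
  gr_neg : ∀ k, k < 0 → gr k = ⊥
  d : carrier →ₗ[K] carrier
  d_mem : ∀ {k a}, a ∈ gr k → d a ∈ gr (k + 1)
  d_d : ∀ a, d (d a) = 0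
  leibniz : ∀ {i a} (b), a ∈ gr i → d (a * b) = d a * b + i.negOnePow • (a * d b)
  graded_comm : ∀ {i j a b}, a ∈ gr i → b ∈ gr j → a * b = (i * j).negOnePow • (b * a)

attribute [instance] DGCA.ring DGCA.algebra DGCA.graded

namespace DGCA

variable {K : Type u} [Field K] (A : DGCA K)

/-- The projection of `A` onto its component of degree `k`, as an endomorphism of `A`. -/
def proj (k : ℤ) : A.carrier →ₗ[K] A.carrier := GradedAlgebra.proj A.gr k

lemma proj_mem (k : ℤ) (a : A.carrier) : A.proj k a ∈ A.gr k := by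
  simp [proj, GradedAlgebra.proj_apply]

lemma proj_same {k : ℤ} {a : A.carrier} (h : a ∈ A.gr k) : A.proj k a = a := by
  simp [proj, GradedAlgebra.proj_apply, DirectSum.decompose_of_mem_same A.gr h]

lemma proj_ne {k j : ℤ} {a : A.carrier} (h : a ∈ A.gr k) (hj : k ≠ j) : A.proj j a = 0 := by
  simp [proj, GradedAlgebra.proj_apply, DirectSum.decompose_of_mem_ne A.gr h hj]

lemma homogeneous_induction {P : A.carrier → Prop} (h0 : P 0)
    (hh : ∀ k a, a ∈ A.gr k → P a) (hadd : ∀ a b, P a → P b → P (a + b)) (a : A.carrier) : P a :=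
  DirectSum.Decomposition.inductionOn A.gr h0 (fun {i} m => hh i m m.2) hadd a

lemma proj_d (k : ℤ) (a : A.carrier) : A.proj (k + 1) (A.d a) = A.d (A.proj k a) := by
  induction a using A.homogeneous_induction with
  | h0 => simp
  | hadd a b ha hb => simp [ha, hb]
  | hh j a ha =>
    by_cases h : j = k
    · subst h
      rw [A.proj_same ha, A.proj_same (A.d_mem ha)]
    · rw [A.proj_ne ha h, A.proj_ne (A.d_mem ha) (by omega), map_zero]

lemma d_mul_of_closed (a : A.carrier) {b : A.carrier} (hb : A.d b = 0) :
    A.d (a * b) = A.d a * b := by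
  induction a using A.homogeneous_induction with
  | h0 => simp
  | hadd a c ha hc => simp [add_mul, ha, hc]
  | hh j a ha => simp [A.leibniz b ha, hb]

lemma d_one : A.d 1 = 0 := by
  have h := A.leibniz (i := 0) (a := 1) 1 SetLike.GradedOne.one_mem
  simpa using h

/-- The subalgebra `ker d` of cocycles. -/
def cocycles : Subalgebra K A.carrier where
  carrier := {a | A.d a = 0}
  mul_mem' {a b} ha hb := by
    simp only [Set.mem_ofPred_eq] at ha hb ⊢
    rw [A.d_mul_of_closed a hb, ha, zero_mul]
  add_mem' {a b} ha hb := by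
    simp only [Set.mem_ofPred_eq] at ha hb ⊢
    rw [map_add, ha, hb, add_zero]
  algebraMap_mem' c := by
    simp only [Set.mem_ofPred_eq, Algebra.algebraMap_eq_smul_one, map_smul, A.d_one, smul_zero]

lemma mem_cocycles {a : A.carrier} : a ∈ A.cocycles ↔ A.d a = 0 := Iff.rfl

lemma exists_d_eq_mul (z b : A.carrier) (hz : A.d z = 0) : ∃ c, A.d c = z * A.d b := by
  classical
  have hzi : ∀ i, A.d (A.proj i z) = 0 := fun i => by rw [← A.proj_d, hz, map_zero]
  refine ⟨∑ i ∈ (decompose A.gr z).support, i.negOnePow • (A.proj i z * b), ?_⟩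
  conv_rhs => rw [← DirectSum.sum_support_decompose A.gr z]
  rw [map_sum, Finset.sum_mul]
  refine Finset.sum_congr rfl fun i _ => ?_
  have h1 : A.d (i.negOnePow • (A.proj i z * b)) = i.negOnePow • A.d (A.proj i z * b) := by
    rcases Int.even_or_odd i with h | h
    · simp [Int.negOnePow_even i h]
    · simp [Int.negOnePow_odd i h]
  rw [h1, A.leibniz b (A.proj_mem i z), hzi i, zero_mul, zero_add, smul_smul,
    Int.units_mul_self, one_smul]
  rfl

/-- The ideal `im d` of coboundaries in `ker d`. -/
def boundaries : Ideal A.cocycles where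
  carrier := {z | ∃ b, A.d b = z}
  add_mem' := by
    rintro a b ⟨x, hx⟩ ⟨y, hy⟩
    exact ⟨x + y, by simp [hx, hy]⟩
  zero_mem' := ⟨0, by simp⟩
  smul_mem' := by
    rintro z a ⟨x, hx⟩
    obtain ⟨c, hc⟩ := A.exists_d_eq_mul z x z.2
    exact ⟨c, by simp [hc, hx]⟩

lemma mem_boundaries {z : A.cocycles} : z ∈ A.boundaries ↔ ∃ b, A.d b = z := Iff.rfl

instance : A.boundaries.IsTwoSided where
  mul_mem_of_left := by
    rintro a b ⟨x, hx⟩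
    exact ⟨x * b, by rw [A.d_mul_of_closed x b.2, hx]; rfl⟩

/-- The cohomology algebra `H(A) = ker d / im d`. -/
abbrev Coh : Type u := A.cocycles ⧸ A.boundaries

/-- The cohomology class of a cocycle, as a linear map. -/
def cls : A.cocycles →ₗ[K] A.Coh := (Ideal.Quotient.mkₐ K A.boundaries).toLinearMap

lemma cls_eq_zero {z : A.cocycles} : A.cls z = 0 ↔ ∃ b, A.d b = z :=
  Ideal.Quotient.eq_zero_iff_mem

lemma cls_mul (a b : A.cocycles) : A.cls (a * b) = A.cls a * A.cls b := rfl

/-- The degree `k` part `H^k(A)` of the cohomology: the classes of the cocycles of degree `k`. -/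
def cohGr (k : ℤ) : Submodule K A.Coh :=
  ((A.gr k).comap A.cocycles.val.toLinearMap).map A.cls

lemma mem_cohGr {k : ℤ} {x : A.Coh} :
    x ∈ A.cohGr k ↔ ∃ z : A.cocycles, (z : A.carrier) ∈ A.gr k ∧ A.cls z = x := Iff.rfl

lemma cls_mem {k : ℤ} {z : A.cocycles} (h : (z : A.carrier) ∈ A.gr k) : A.cls z ∈ A.cohGr k :=
  ⟨z, h, rfl⟩

/-- The projection of a cocycle to its component of degree `k`. -/
def projZ (k : ℤ) (z : A.cocycles) : A.cocycles :=
  ⟨A.proj k z, by rw [A.mem_cocycles, ← A.proj_d, A.mem_cocycles.1 z.2, map_zero]⟩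

instance cohGradedMonoid : SetLike.GradedMonoid A.cohGr where
  one_mem := ⟨1, SetLike.GradedOne.one_mem (A := A.gr), rfl⟩
  mul_mem := by
    rintro i j _ _ ⟨x, hx, rfl⟩ ⟨y, hy, rfl⟩
    exact ⟨x * y, SetLike.GradedMul.mul_mem (A := A.gr) hx hy, rfl⟩

lemma coh_isInternal : DirectSum.IsInternal A.cohGr := by
  classical
  constructor
  · rw [injective_iff_map_eq_zero]
    intro x hx
    have hrep : ∀ k, ∃ z : A.cocycles, (z : A.carrier) ∈ A.gr k ∧ A.cls z = x k :=
      fun k => (x k).2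
    choose z hz hzx using hrep
    have hsum : A.cls (∑ k ∈ DFinsupp.support x, z k) = 0 := by
      rw [map_sum, ← hx, DirectSum.coeAddMonoidHom_eq_dfinsuppSum, DFinsupp.sum]
      exact Finset.sum_congr rfl fun k _ => hzx k
    obtain ⟨b, hb⟩ := A.cls_eq_zero.1 hsum
    have key : ∀ j ∈ DFinsupp.support x, A.d (A.proj (j - 1) b) = z j := by
      intro j hj
      rw [← A.proj_d, sub_add_cancel, hb]
      rw [AddSubmonoidClass.coe_finsetSum, map_sum, Finset.sum_eq_single j]
      · exact A.proj_same (hz j)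
      · intro i _ hij
        exact A.proj_ne (hz i) hij
      · exact fun h => absurd hj h
    ext j
    by_cases hj : j ∈ DFinsupp.support x
    · rw [← hzx j, A.cls_eq_zero.2 ⟨_, key j hj⟩]
      rfl
    · rw [DFinsupp.notMem_support_iff.1 hj]
      rfl
  · intro y
    obtain ⟨z, rfl⟩ : ∃ z, A.cls z = y := Ideal.Quotient.mk_surjective y
    refine ⟨∑ k ∈ (decompose A.gr (z : A.carrier)).support,
      DirectSum.of (fun k => A.cohGr k) k ⟨A.cls (A.projZ k z), A.cls_mem (A.proj_mem k z)⟩, ?_⟩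
    rw [map_sum]
    simp only [DirectSum.coeAddMonoidHom_of]
    rw [← map_sum]
    congr 1
    ext
    rw [AddSubmonoidClass.coe_finsetSum]
    exact DirectSum.sum_support_decompose A.gr (z : A.carrier)

instance cohGraded : GradedAlgebra A.cohGr where
  toGradedMonoid := A.cohGradedMonoid
  toDecomposition := A.coh_isInternal.chooseDecomposition

/-- The projection of the cohomology onto `H^k(A)`. -/
def cohComponent (k : ℤ) : A.Coh →ₗ[K] A.cohGr k :=
  DirectSum.component K ℤ (fun i => A.cohGr i) k ∘ₗ
    (DirectSum.decomposeLinearEquiv A.cohGr).toLinearMap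

/-- The pairing on `H(A)` defined by a linear form `∫` on `H^n(A)`: it is `∫ α · β` for homogeneous
classes with `deg α + deg β = n` and zero for other homogeneous classes; on arbitrary classes it is
`∫` of the component of degree `n` of `α · β`. -/
def cohPairing (n : ℤ) (I : Module.Dual K (A.cohGr n)) (α β : A.Coh) : K :=
  I (A.cohComponent n (α * β))

/-- The cohomology algebra of `A`, as a DGCA with zero differential. -/
def cohomology : DGCA K where
  carrier := A.Coh
  gr := A.cohGr
  gr_neg k hk := by
    rw [eq_bot_iff]
    rintro _ ⟨z, hz, rfl⟩
    have hz' : (z : A.carrier) ∈ A.gr k := hz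
    rw [A.gr_neg k hk, Submodule.mem_bot] at hz'
    exact A.cls_eq_zero.2 ⟨0, by rw [hz', map_zero]⟩
  d := 0
  d_mem _ := Submodule.zero_mem _
  d_d _ := rfl
  leibniz _ _ := by simp
  graded_comm := by
    rintro i j _ _ ⟨x, hx, rfl⟩ ⟨y, hy, rfl⟩
    have h : x * y = (i * j).negOnePow • (y * x) := by
      ext
      have := A.graded_comm hx hy
      rcases Int.even_or_odd (i * j) with h | h
      · simpa [Int.negOnePow_even _ h] using this
      · simpa [Int.negOnePow_odd _ h] using this
    rw [← A.cls_mul, h]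
    rcases Int.even_or_odd (i * j) with h | h
    · simp [Int.negOnePow_even _ h, A.cls_mul]
    · simp [Int.negOnePow_odd _ h, A.cls_mul]

/-- There is a quasi-isomorphism of DGCAs from `A` to `B`. -/
def QuasiIsoTo (A B : DGCA K) : Prop :=
  ∃ φ : A.carrier →ₐ[K] B.carrier,
    (∀ k, ∀ a ∈ A.gr k, φ a ∈ B.gr k) ∧ (∀ a, φ (A.d a) = B.d (φ a)) ∧
      InducesCohomologyIso A.d B.d φ.toLinearMap

/-- Weak equivalence of DGCAs: connected by a finite zig-zag of quasi-isomorphisms of DGCAs. -/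
def WeaklyEquivalent : DGCA K → DGCA K → Prop := Relation.EqvGen QuasiIsoTo

/-- `A` is formal: it is weakly equivalent to its cohomology algebra with zero differential. -/
def IsFormal : Prop := WeaklyEquivalent A A.cohomology

/-- `A` is `(r-1)`-connected: `H^0(A) = K` and `H^k(A) = 0` for `1 ≤ k ≤ r - 1`. -/
def IsConnectedUpTo (r : ℕ) : Prop :=
  Function.Injective (Algebra.linearMap K A.Coh) ∧
    A.cohGr 0 = LinearMap.range (Algebra.linearMap K A.Coh) ∧
      ∀ k : ℤ, 1 ≤ k → k ≤ (r : ℤ) - 1 → A.cohGr k = ⊥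

/-- The Betti number `b_k = dim H^k(A)`. -/
def betti (k : ℤ) : ℕ := Module.finrank K (A.cohGr k)

end DGCA

/-! ### Poincaré DGCAs and Hodge homotopies -/

/-- A Poincaré DGCA of degree `n`: `A = ⨁_{k = 0}^n A^k` has finite dimensional cohomology and a
fundamental class `∫ ∈ (H^n(A))^∨` whose pairing on `H(A)` is non-degenerate. -/
structure PoincareDGCA (K : Type u) [Field K] (n : ℕ) extends DGCA K where
  gr_top : ∀ k : ℤ, (n : ℤ) < k → gr k = ⊥
  finite_coh : Module.Finite K toDGCA.Coh
  integral : Module.Dual K (toDGCA.cohGr n)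
  nondegenerate : ∀ α : toDGCA.Coh,
    (∀ β : toDGCA.Coh, toDGCA.cohPairing n integral α β = 0) → α = 0

namespace PoincareDGCA

variable {K : Type u} [Field K] {n : ℕ} (A : PoincareDGCA K n)

/-- The component of degree `n` of an element, which is a cocycle since `A^(n+1) = 0`. -/
def topCocycle : A.carrier →ₗ[K] A.cocycles :=
  (A.proj n).codRestrict (Subalgebra.toSubmodule A.cocycles) fun a => by
    have h := A.d_mem (A.proj_mem n a)
    rw [A.gr_top _ (by omega), Submodule.mem_bot] at h
    exact h

/-- `a ↦ ∫ [aⁿ]`, where `aⁿ` is the component of degree `n` of `a ∈ A`. -/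
def integralA : A.carrier →ₗ[K] K :=
  A.integral ∘ₗ (A.cls ∘ₗ A.topCocycle).codRestrict (A.cohGr n)
    fun a => A.cls_mem (A.proj_mem n a)

/-- The pairing on `A` induced by the one on cohomology: `⟨a, b⟩ = ∫ [a b]` for homogeneous
`a`, `b` with `deg a + deg b = n`, and zero for other homogeneous `a`, `b`. -/
def pairing (a b : A.carrier) : K := A.integralA (a * b)

/-- A Hodge homotopy `d⁻` on a Poincaré DGCA; `id - (d d⁻ + d⁻ d)` is the map
`π = id - [d, d⁻]`. -/
structure HodgeHomotopy where
  dm : A.carrier →ₗ[K] A.carrier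
  dm_mem : ∀ {k a}, a ∈ A.gr k → dm a ∈ A.gr (k - 1)
  dm_dm : ∀ a, dm (dm a) = 0
  dm_d_dm : ∀ a, dm (A.d (dm a)) = dm a
  d_dm_d : ∀ a, A.d (dm (A.d a)) = A.d a
  pairing_dm_dm : ∀ a b, A.pairing (dm a) (dm b) = 0
  pairing_harmonic_dm : ∀ a b, A.pairing (a - (A.d (dm a) + dm (A.d a))) (dm b) = 0

namespace HodgeHomotopy

variable {A} (h : A.HodgeHomotopy)

/-- `π = id - [d, d⁻] = id - (d d⁻ + d⁻ d)`. -/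
def piH : A.carrier →ₗ[K] A.carrier := LinearMap.id - (A.d ∘ₗ h.dm + h.dm ∘ₗ A.d)

/-- The harmonic subspace `𝓗 = Im π`. -/
def harmonic : Submodule K A.carrier := LinearMap.range h.piH

/-- The projection `π` as a map onto the harmonic subspace. -/
def toHarmonic : A.carrier →ₗ[K] h.harmonic := h.piH.rangeRestrict

/-- The grading of the harmonic subspace, `𝓗^k = 𝓗 ∩ A^k`. -/
def harmonicGr (k : ℤ) : Submodule K h.harmonic := (A.gr k).comap h.harmonic.subtype

lemma one_mem_harmonic : (1 : A.carrier) ∈ h.harmonic := by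
  refine ⟨1, ?_⟩
  have h1 := h.dm_mem (SetLike.GradedOne.one_mem (A := A.gr))
  rw [A.gr_neg _ (by norm_num), Submodule.mem_bot] at h1
  simp [piH, h1, A.d_one]

/-- The unit of `A`, as a harmonic element. -/
def one : h.harmonic := ⟨1, h.one_mem_harmonic⟩

/-- The recursion for `m̂_k(a_0, …, a_{k-1})`, with `deg a_j = p j`:
`m̂_2(a_0, a_1) = a_0 a_1` and, for `k ≥ 3`,
`m̂_k(a_0, …, a_{k-1}) = (-1)^{k-1} d⁻m̂_{k-1}(a_0, …, a_{k-2}) · a_{k-1}`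
`  - (-1)^{k p_0} a_0 · d⁻m̂_{k-1}(a_1, …, a_{k-1})`
`  - ∑_{i=2}^{k-2} (-1)^ν d⁻m̂_i(a_0, …, a_{i-1}) · d⁻m̂_{k-i}(a_i, …, a_{k-1})`,
with `ν = i + (k-i-1)(p_0 + ⋯ + p_{i-1})`.  In the code `k` is written `k + 3`, and `i` is
written `i + 2`. -/
def mhat : ℕ → (ℕ → ℤ) → (ℕ → A.carrier) → A.carrier
  | 0, _, _ => 0
  | 1, _, _ => 0
  | 2, _, a => a 0 * a 1
  | k + 3, p, a =>
      ((k : ℤ) + 2).negOnePow • (h.dm (mhat (k + 2) p a) * a (k + 2))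
      - (((k : ℤ) + 3) * p 0).negOnePow •
          (a 0 * h.dm (mhat (k + 2) (fun j => p (j + 1)) (fun j => a (j + 1))))
      - ∑ i : Fin k,
          (((i : ℕ) : ℤ) + 2 + ((k : ℤ) - (i : ℕ)) *
              ∑ j ∈ Finset.range (i + 2), p j).negOnePow •
            (h.dm (mhat (i + 2) p a) *
              h.dm (mhat (k + 1 - i) (fun j => p (j + (i + 2))) (fun j => a (j + (i + 2)))))
  termination_by k => k
  decreasing_by all_goals omega

end HodgeHomotopy

end PoincareDGCA

/-! ### `C∞`-algebras -/

/-- The word `(v_0, …, v_{r-1}, x, v_{r+s}, v_{r+s+1}, …)`. -/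
def insertWord {V : Type*} (v : ℕ → V) (r s : ℕ) (x : V) : ℕ → V := fun j =>
  if j < r then v j else if j = r then x else v (j + s - 1)

/-- `σ` is a `(p, q)`-shuffle: it is increasing on the first `p` and on the last `q` places. -/
def IsShuffle (p q : ℕ) (σ : Equiv.Perm (Fin (p + q))) : Prop :=
  (∀ i j : Fin (p + q), i < j → (j : ℕ) < p → σ i < σ j) ∧
    ∀ i j : Fin (p + q), i < j → p ≤ (i : ℕ) → σ i < σ j

/-- The Koszul sign of a permutation of elements of degrees `deg i`: the product of
`(-1)^{deg i · deg j}` over the pairs `i < j` whose order is reversed by `σ`. -/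
def koszulSign {k : ℕ} (σ : Equiv.Perm (Fin k)) (deg : Fin k → ℤ) : ℤˣ :=
  ∏ i : Fin k, ∏ j : Fin k, if i < j ∧ σ j < σ i then (deg i * deg j).negOnePow else 1

open Classical in
/-- `f` vanishes on all (signed) shuffle products of two non-empty words of homogeneous
elements. -/
def VanishesOnShuffles {K V W : Type*} [Field K] [AddCommGroup V] [Module K V]
    [AddCommGroup W] [Module K W] (gr : ℤ → Submodule K V)
    (f : ∀ k : ℕ, MultilinearMap K (fun _ : Fin k => V) W) : Prop :=
  ∀ p q : ℕ, 1 ≤ p → 1 ≤ q → ∀ (deg : Fin (p + q) → ℤ) (v : Fin (p + q) → V),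
    (∀ i, v i ∈ gr (deg i)) →
      ∑ σ : Equiv.Perm (Fin (p + q)) with IsShuffle p q σ,
        (Equiv.Perm.sign σ * koszulSign σ deg) • f (p + q) (fun i => v (σ.symm i)) = 0

/-- The expression
`∑_{r+s+t=n} (-1)^{r+st} g_{r+1+t}(id^{⊗r} ⊗ m_s ⊗ id^{⊗t})(v_0, …, v_{n-1})` (with `s ≥ 1`)
for operations `m_s` of degree `2 - s` and elements `v_j` of degrees `p_j`, with its Koszul sign
`(-1)^{s (p_0 + ⋯ + p_{r-1})}`. -/
def insertionSum {K V W : Type*} [Field K] [AddCommGroup V] [Module K V]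
    [AddCommGroup W] [Module K W] (g : ∀ k : ℕ, MultilinearMap K (fun _ : Fin k => V) W)
    (m : ∀ k : ℕ, MultilinearMap K (fun _ : Fin k => V) V) (n : ℕ) (p : ℕ → ℤ) (v : ℕ → V) : W :=
  ∑ s ∈ Finset.Icc 1 n, ∑ r ∈ Finset.range (n - s + 1),
    ((r : ℤ) + s * ((n : ℤ) - r - s) + s * ∑ j ∈ Finset.range r, p j).negOnePow •
      g (n - s + 1) (fun j => insertWord v r s (m s (fun i => v (r + i))) j)

/-- A `C∞`-algebra structure on the graded vector space `V = ⨁_k gr k`: operations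
`m_k : V^{⊗k} → V` of degree `2 - k` (`k ≥ 1`) which satisfy the `A∞`-relations
`∑_{r+s+t=n} (-1)^{r+st} m_{r+1+t}(id^{⊗r} ⊗ m_s ⊗ id^{⊗t}) = 0` and vanish on shuffles. -/
structure CInftyStructure {K V : Type*} [Field K] [AddCommGroup V] [Module K V]
    (gr : ℤ → Submodule K V) where
  isInternal : DirectSum.IsInternal gr
  m : ∀ k : ℕ, MultilinearMap K (fun _ : Fin k => V) V
  m_zero : m 0 = 0
  m_mem : ∀ (k : ℕ) (deg : Fin k → ℤ) (v : Fin k → V), (∀ i, v i ∈ gr (deg i)) →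
    m k v ∈ gr (∑ i, deg i + 2 - k)
  relation : ∀ n : ℕ, 1 ≤ n → ∀ (p : ℕ → ℤ) (v : ℕ → V), (∀ j, v j ∈ gr (p j)) →
    insertionSum m m n p v = 0
  shuffle : VanishesOnShuffles gr m

namespace CInftyStructure

variable {K V W : Type*} [Field K] [AddCommGroup V] [Module K V] [AddCommGroup W] [Module K W]
  {gr : ℤ → Submodule K V} {gr' : ℤ → Submodule K W}

/-- A `C∞`-algebra is minimal if `m_1 = 0`. -/
def IsMinimal (S : CInftyStructure gr) : Prop := S.m 1 = 0

/-- `e` is a (strict) unit of the `C∞`-algebra. -/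
def IsUnital (S : CInftyStructure gr) (e : V) : Prop :=
  e ∈ gr 0 ∧ S.m 1 ![e] = 0 ∧ (∀ a, S.m 2 ![e, a] = a ∧ S.m 2 ![a, e] = a) ∧
    ∀ k : ℕ, 3 ≤ k → ∀ (v : Fin k → V) (i : Fin k), v i = e → S.m k v = 0

/-- A `1`-ary multilinear map, as a linear map. -/
def linearPart (f : MultilinearMap K (fun _ : Fin 1 => V) W) : V →ₗ[K] W :=
  f.toLinearMap 0 0

lemma linearPart_apply (f : MultilinearMap K (fun _ : Fin 1 => V) W) (x : V) :
    linearPart f x = f ![x] := by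
  rw [linearPart, MultilinearMap.toLinearMap_apply]
  congr 1
  ext i
  fin_cases i
  simp

/-- A `C∞`-morphism `S → S'`: maps `f_k : V^{⊗k} → W` of degree `1 - k` (`k ≥ 1`) which satisfy
`∑_{r+s+t=n} (-1)^{r+st} f_{r+1+t}(id^{⊗r} ⊗ m_s ⊗ id^{⊗t})`
`  = ∑_{i_1+⋯+i_l=n} (-1)^{(l-1)(i_1-1) + (l-2)(i_2-1) + ⋯ + (i_{l-1}-1)} m'_l(f_{i_1} ⊗ ⋯ ⊗ f_{i_l})`
and vanish on shuffles. On elements, `f_{i_j}` moreover contributes the Koszul sign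
`(-1)^{(1-i_j) P}`, where `P` is the sum of the degrees of the elements on its left. -/
structure Morphism (S : CInftyStructure gr) (S' : CInftyStructure gr') where
  f : ∀ k : ℕ, MultilinearMap K (fun _ : Fin k => V) W
  f_zero : f 0 = 0
  f_mem : ∀ (k : ℕ) (deg : Fin k → ℤ) (v : Fin k → V), (∀ i, v i ∈ gr (deg i)) →
    f k v ∈ gr' (∑ i, deg i + 1 - k)
  relation : ∀ n : ℕ, 1 ≤ n → ∀ (p : ℕ → ℤ) (v : ℕ → V), (∀ j, v j ∈ gr (p j)) →
    insertionSum f S.m n p v =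
      ∑ c : Composition n,
        (∑ j : Fin c.length,
          (((c.length : ℤ) - 1 - (j : ℕ)) * ((c.blocksFun j : ℤ) - 1) +
            (1 - (c.blocksFun j : ℤ)) * ∑ i ∈ Finset.range (c.sizeUpTo j), p i)).negOnePow •
          S'.m c.length
            (fun j => f (c.blocksFun j) (fun i => v (c.sizeUpTo j + i)))
  shuffle : VanishesOnShuffles gr f

/-- A `C∞`-quasi-isomorphism: the linear part `f_1` induces an isomorphism on cohomology. -/
def Morphism.IsQuasiIso {S : CInftyStructure gr} {S' : CInftyStructure gr'}
    (F : Morphism S S') : Prop :=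
  InducesCohomologyIso (linearPart (S.m 1)) (linearPart (S'.m 1)) (linearPart (F.f 1))

/-- A `C∞`-morphism is unital for the units `e`, `e'`. -/
def Morphism.IsUnital {S : CInftyStructure gr} {S' : CInftyStructure gr'}
    (F : Morphism S S') (e : V) (e' : W) : Prop :=
  F.f 1 ![e] = e' ∧
    ∀ k : ℕ, 2 ≤ k → ∀ (v : Fin k → V) (i : Fin k), v i = e → F.f k v = 0

end CInftyStructure
/-! ### A DGCA as a `C∞`-algebra -/

namespace DGCA

variable {K : Type u} [Field K] (A : DGCA K)

/-- The operations of a DGCA: `m_1 = d`, `m_2` is the product and `m_k = 0` for `k ≠ 1, 2`. -/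
def ops : ∀ k : ℕ, MultilinearMap K (fun _ : Fin k => A.carrier) A.carrier
  | 0 => 0
  | 1 => MultilinearMap.ofSubsingleton K A.carrier A.carrier (0 : Fin 1) A.d
  | 2 => MultilinearMap.mkPiAlgebraFin K 2 A.carrier
  | _ + 3 => 0

lemma ops_one (v : Fin 1 → A.carrier) : A.ops 1 v = A.d (v 0) := rfl

lemma ops_two (v : Fin 2 → A.carrier) : A.ops 2 v = v 0 * v 1 := by
  simp [ops]

lemma ops_ge {k : ℕ} (hk : 3 ≤ k) : A.ops k = 0 := by
  obtain ⟨j, rfl⟩ := Nat.exists_eq_add_of_le' hk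
  rfl

lemma ops_relation (n : ℕ) (hn : 1 ≤ n) (p : ℕ → ℤ) (v : ℕ → A.carrier)
    (hv : ∀ j, v j ∈ A.gr (p j)) : insertionSum A.ops A.ops n p v = 0 := by
  have hI2 : Finset.Icc 1 2 = {1, 2} := rfl
  have hI3 : Finset.Icc 1 3 = {1, 2, 3} := rfl
  rcases (by omega : n = 1 ∨ n = 2 ∨ n = 3 ∨ 4 ≤ n) with rfl | rfl | rfl | h4
  · simp [insertionSum, ops_one, insertWord, A.d_d]
  · have hl := A.leibniz (v 1) (hv 0)
    simp [insertionSum, ops_one, ops_two, insertWord, hI2, Finset.sum_range_succ, hl,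
      Int.negOnePow_add, Int.negOnePow_one]
    abel
  · have h0 := A.ops_ge (le_refl 3)
    simp [insertionSum, ops_one, ops_two, insertWord, hI3, Finset.sum_range_succ, h0, mul_assoc,
      Int.negOnePow_add, Int.negOnePow_one]
  · refine Finset.sum_eq_zero fun s hs => Finset.sum_eq_zero fun r hr => ?_
    rw [Finset.mem_Icc] at hs
    by_cases h : 3 ≤ n - s + 1
    · simp [A.ops_ge h]
    · have h3 : 3 ≤ s := by omega
      rw [A.ops_ge h3]
      rw [(A.ops (n - s + 1)).map_coord_zero (⟨r, Finset.mem_range.1 hr⟩ : Fin (n - s + 1))]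
      · simp
      · simp [insertWord]

/-- A DGCA, as a `C∞`-algebra. -/
def toCInfty : CInftyStructure A.gr where
  isInternal := DirectSum.Decomposition.isInternal A.gr
  m := A.ops
  m_zero := rfl
  m_mem k deg v hv := by
    rcases (by omega : k = 0 ∨ k = 1 ∨ k = 2 ∨ 3 ≤ k) with rfl | rfl | rfl | h
    · exact Submodule.zero_mem _
    · rw [ops_one]
      convert A.d_mem (hv 0) using 2
      simp
      ring
    · rw [ops_two]
      convert SetLike.GradedMul.mul_mem (A := A.gr) (hv 0) (hv 1) using 2
      simp
    · rw [A.ops_ge h]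
      exact Submodule.zero_mem _
  relation := A.ops_relation
  shuffle p q hp hq deg v hv := by
    by_cases h : 3 ≤ p + q
    · simp [A.ops_ge h]
    · obtain ⟨rfl, rfl⟩ : p = 1 ∧ q = 1 := by omega
      have hS : ∀ σ : Equiv.Perm (Fin (1 + 1)), IsShuffle 1 1 σ := by
        intro σ
        constructor
        · intro i j hij hj
          omega
        · intro i j hij hi
          omega
      have hu : (Finset.univ : Finset (Equiv.Perm (Fin (1 + 1)))) =
        {1, Equiv.swap (0 : Fin 2) 1} := by decide
      have hne : (1 : Equiv.Perm (Fin (1 + 1))) ≠ Equiv.swap (0 : Fin 2) 1 := by decide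
      have hc := A.graded_comm (hv 0) (hv 1)
      simp only [hS, Finset.filter_true]
      rw [hu, Finset.sum_pair hne]
      have h1 : koszulSign (1 : Equiv.Perm (Fin (1 + 1))) deg = 1 := by
        simp [koszulSign, Fin.prod_univ_two]
      have h2 : koszulSign (Equiv.swap (0 : Fin 2) 1) deg = (deg 0 * deg 1).negOnePow := by
        simp [koszulSign, Fin.prod_univ_two]
      rw [h1]
      erw [h2, A.ops_two, A.ops_two]
      have hs : Equiv.Perm.sign (Equiv.swap (0 : Fin 2) 1) = -1 := by decide
      erw [hs]
      change (1 * 1 : ℤˣ) • (v 0 * v 1) + (-1 * (deg 0 * deg 1).negOnePow) • (v 1 * v 0) = 0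
      rw [hc]
      simp

end DGCA

end

/-!
The `C∞`-structure on the harmonic subspace is obtained by homotopy transfer along `d⁻`. After a
suspension, which removes almost all signs, the transfer is a single recursion: with the grading
involution `ε`, put `φ_1 = id`, `M_k = ∑_i ε φ_i · φ_{k-i}`, `φ_k = - d⁻ M_k` for `k ≥ 2`, and
`μ_k = π M_k`. The Hodge decomposition `id = π + d d⁻ + d⁻ d` and the associativity of the product
give `d φ = φ ∘ μ - M` on words of harmonic elements (`d_phi`), from which the `A∞`-relations follow
by applying `π` to `d M` (`compMu_mu`). Deconcatenation is multiplicative for the shuffle product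
(`shuffleSum_wordConv`), so that by graded commutativity `φ` and `M` vanish on shuffles. Undoing the
suspension (`twist`, `mhat_eq`, `sign_mul_koszulSign`) yields `transferStructure` and
`transferMorphism`.

The vanishing of `m_k` is a degree count. By `integralA_prodPhi_cyclic` the form
`∫ M_k(α_1, …, α_k) · α_{k+1}` is cyclic up to sign, and it vanishes if one letter is the unit. For
`k ≥ 3` all letters may hence be taken of degree at least `r`, and their total degree is `n + k - 2`.
If `n ≤ (k + 1) (r - 1) + 4`, then all letters but at most one have degree `r`; after a rotation the
first `k` letters are multiples of a generator `x` of the one-dimensional space of degree `r`, and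
`M_k(x, …, x) = 0` for `k ≥ 3` (`prodPhi_const`, `mu_eq_zero`).

For `n ≤ 4 r` the operation `m_3` vanishes, and formality is deduced from this alone. The elements
`a` for which `d⁻ a` and `d⁻ d a` are a multiple of `d⁻ (x²)` up to terms of degree at least `2 r`
form a subalgebra, quasi-isomorphic to `A`, which is harmonic in degrees below `2 r - 1`
(`smallModel`). On it, the class `P a` of the harmonic part and the homotopy
`c(a, b) = P (d⁻ a · b + ε(π a) · d⁻ b)` form a `C∞`-morphism to the cohomology with only two
components: commutativity and associativity of `c` are tested by integration against harmonic
elements, where they reduce by degree reasons to isotropy of `im d⁻`, to `m_3 = 0`, and to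
`d⁻ (x²) · d⁻ (x²) = 0` (`productHomotopy_comm`, `piH_assocDefect`). As `c` has values in an ideal of
square zero, such a morphism is made strict by an explicit differential graded algebra of triples
`(h, a, e)` with `d (h, a, e) = (0, d a, P a - h)`, which projects to `A` and to the cohomology by
quasi-isomorphisms (`TwoStepMorphism.strictification`, `FormalRange.isFormal`).
-/

noncomputable section

/-! ### Signs and the grading involution -/

/-- The sign `(-1)^k` as a scalar. -/
def sgn (K : Type*) [Field K] (k : ℤ) : K := ((k.negOnePow : ℤ) : K)

section sgn

variable {K : Type*} [Field K]

lemma sgn_add (a b : ℤ) : sgn K (a + b) = sgn K a * sgn K b := by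
  simp [sgn, Int.negOnePow_add]

@[simp] lemma sgn_zero : sgn K 0 = 1 := by simp [sgn]

@[simp] lemma sgn_one : sgn K 1 = -1 := by simp [sgn]

lemma sgn_sub (a b : ℤ) : sgn K (a - b) = sgn K a * sgn K b := by
  simp [sgn, Int.negOnePow_sub]

@[simp] lemma sgn_mul_self (a : ℤ) : sgn K a * sgn K a = 1 := by
  rw [sgn, ← Int.cast_mul, ← Units.val_mul, Int.units_mul_self]
  simp

lemma sgn_even {a : ℤ} (h : Even a) : sgn K a = 1 := by simp [sgn, Int.negOnePow_even a h]

lemma sgn_odd {a : ℤ} (h : Odd a) : sgn K a = -1 := by simp [sgn, Int.negOnePow_odd a h]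

lemma sgn_ne_zero (a : ℤ) : sgn K a ≠ 0 := by
  intro h
  have := sgn_mul_self (K := K) a
  simp [h] at this

/-- Signs only depend on the parity of the exponent. -/
lemma sgn_congr {a b : ℤ} (c : ℤ) (h : a = b + 2 * c) : sgn K a = sgn K b := by
  rw [h, sgn_add, sgn_even (even_two_mul c), mul_one]

lemma sgn_sum {ι : Type*} (s : Finset ι) (f : ι → ℤ) :
    sgn K (∑ i ∈ s, f i) = ∏ i ∈ s, sgn K (f i) := by
  classical
  induction s using Finset.induction_on with
  | empty => simp
  | insert a s ha ih => rw [Finset.sum_insert ha, Finset.prod_insert ha, sgn_add, ih]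

lemma negOnePow_smul_eq {V : Type*} [AddCommGroup V] [Module K V] (k : ℤ) (x : V) :
    k.negOnePow • x = sgn K k • x := by
  rw [sgn, Int.cast_smul_eq_zsmul, Units.smul_def]

end sgn

lemma eq_zero_of_eq_neg {K V : Type*} [Field K] [CharZero K] [AddCommGroup V] [Module K V] {x : V}
    (hx : x = -x) : x = 0 := by
  have h2 : (2 : K) • x = 0 := by rw [two_smul]; nth_rewrite 2 [hx]; exact add_neg_cancel x
  exact (smul_eq_zero.1 h2).resolve_left two_ne_zero

/-- A family of projections onto the members of a family of submodules, with finitely many nonzero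
components for every element, shows that the sum is direct. -/
lemma isInternal_of_proj {K V : Type*} [Field K] [AddCommGroup V] [Module K V]
    (gr : ℤ → Submodule K V) (p : ℤ → V →ₗ[K] V) (hmem : ∀ k v, p k v ∈ gr k)
    (hsame : ∀ k, ∀ v ∈ gr k, p k v = v) (hne : ∀ j k, j ≠ k → ∀ v ∈ gr k, p j v = 0)
    (hsum : ∀ v, ∃ s : Finset ℤ, v = ∑ k ∈ s, p k v) : DirectSum.IsInternal gr := by
  classical
  constructor
  · have key : ∀ (j : ℤ) (x : DirectSum ℤ fun k => gr k),
        p j (DirectSum.coeAddMonoidHom gr x) = (x j : V) := by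
      intro j x
      induction x using DirectSum.induction_on with
      | zero => simp
      | of i y =>
        rw [DirectSum.coeAddMonoidHom_of]
        by_cases hij : j = i
        · subst hij
          rw [hsame _ _ y.2, DirectSum.of_eq_same]
        · rw [hne _ _ hij _ y.2, DirectSum.of_eq_of_ne _ _ _ hij]
          rfl
      | add x y hx hy => rw [map_add, map_add, hx, hy]; rfl
    intro x y hxy
    ext j
    rw [← key, ← key, hxy]
  · intro v
    obtain ⟨s, hs⟩ := hsum v
    refine ⟨∑ k ∈ s, DirectSum.of (fun k => gr k) k ⟨p k v, hmem k v⟩, ?_⟩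
    rw [map_sum]
    simp only [DirectSum.coeAddMonoidHom_of]
    exact hs.symm

namespace DGCA

variable {K : Type u} [Field K] (A : DGCA K)

/-- The grading involution `a ↦ (-1)^{deg a} a`. -/
def eps : A.carrier →ₗ[K] A.carrier :=
  (DirectSum.toModule K ℤ A.carrier fun k => sgn K k • (A.gr k).subtype) ∘ₗ
    (DirectSum.decomposeLinearEquiv A.gr).toLinearMap

lemma eps_of_mem {k : ℤ} {a : A.carrier} (ha : a ∈ A.gr k) : A.eps a = sgn K k • a := by
  lift a to A.gr k using ha
  simp [eps]

@[simp] lemma eps_eps (a : A.carrier) : A.eps (A.eps a) = a := by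
  induction a using A.homogeneous_induction with
  | h0 => simp
  | hadd a b ha hb => simp [ha, hb]
  | hh k a ha => simp [A.eps_of_mem ha, smul_smul]

lemma eps_mem {k : ℤ} {a : A.carrier} (ha : a ∈ A.gr k) : A.eps a ∈ A.gr k := by
  rw [A.eps_of_mem ha]
  exact Submodule.smul_mem _ _ ha

lemma mul_mem {i j : ℤ} {a b : A.carrier} (ha : a ∈ A.gr i) (hb : b ∈ A.gr j) :
    a * b ∈ A.gr (i + j) := SetLike.GradedMul.mul_mem ha hb

lemma one_mem : (1 : A.carrier) ∈ A.gr 0 := SetLike.GradedOne.one_mem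

@[simp] lemma eps_one : A.eps 1 = 1 := by simp [A.eps_of_mem A.one_mem]

lemma eps_mul (a b : A.carrier) : A.eps (a * b) = A.eps a * A.eps b := by
  induction a using A.homogeneous_induction with
  | h0 => simp
  | hadd a c ha hc => simp [add_mul, ha, hc]
  | hh i a ha =>
    induction b using A.homogeneous_induction with
    | h0 => simp
    | hadd a c ha hc => simp [mul_add, ha, hc]
    | hh j b hb =>
      rw [A.eps_of_mem ha, A.eps_of_mem hb, A.eps_of_mem (A.mul_mem ha hb), sgn_add,
        smul_mul_smul_comm]

lemma d_eps (a : A.carrier) : A.d (A.eps a) = - A.eps (A.d a) := by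
  induction a using A.homogeneous_induction with
  | h0 => simp
  | hadd a b ha hb => simp [ha, hb]; abel
  | hh k a ha => simp [A.eps_of_mem ha, A.eps_of_mem (A.d_mem ha), sgn_add]

lemma d_mul (a b : A.carrier) : A.d (a * b) = A.d a * b + A.eps a * A.d b := by
  induction a using A.homogeneous_induction with
  | h0 => simp
  | hadd a c ha hc => simp [add_mul, ha, hc]; abel
  | hh i a ha => rw [A.leibniz b ha, A.eps_of_mem ha, negOnePow_smul_eq (K := K), smul_mul_assoc]

lemma mul_comm_of_mem {i j : ℤ} {a b : A.carrier} (ha : a ∈ A.gr i) (hb : b ∈ A.gr j) :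
    a * b = sgn K (i * j) • (b * a) := by
  rw [A.graded_comm ha hb, negOnePow_smul_eq (K := K)]

lemma sum_proj (a : A.carrier) : ∃ s : Finset ℤ, a = ∑ k ∈ s, A.proj k a := by
  classical
  exact ⟨_, (DirectSum.sum_support_decompose A.gr a).symm⟩

end DGCA

namespace PoincareDGCA

variable {K : Type u} [Field K] {n : ℕ} (A : PoincareDGCA K n)

/-! ### The integral -/

lemma integralA_of_ne {k : ℤ} {a : A.carrier} (ha : a ∈ A.gr k) (hk : k ≠ n) :
    A.integralA a = 0 := by
  have h : A.topCocycle a = 0 := Subtype.ext (A.proj_ne ha hk)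
  have h2 : (A.cls ∘ₗ A.topCocycle).codRestrict (A.cohGr n)
    (fun a => A.cls_mem (A.proj_mem n a)) a = 0 := Subtype.ext (by simp [h])
  simp only [integralA, LinearMap.comp_apply] at h2 ⊢
  rw [h2, map_zero]

lemma integralA_d (a : A.carrier) : A.integralA (A.d a) = 0 := by
  have h : A.cls (A.topCocycle (A.d a)) = 0 := by
    rw [A.cls_eq_zero]
    refine ⟨A.proj (n - 1) a, ?_⟩
    rw [← A.proj_d, sub_add_cancel]
    rfl
  have h2 : (A.cls ∘ₗ A.topCocycle).codRestrict (A.cohGr n)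
    (fun a => A.cls_mem (A.proj_mem n a)) (A.d a) = 0 := Subtype.ext (by simpa using h)
  simp only [integralA, LinearMap.comp_apply] at h2 ⊢
  rw [h2, map_zero]

lemma integralA_mul_comm {i j : ℤ} {a b : A.carrier} (ha : a ∈ A.gr i) (hb : b ∈ A.gr j) :
    A.integralA (a * b) = sgn K (i * j) * A.integralA (b * a) := by
  rw [A.mul_comm_of_mem ha hb, map_smul, smul_eq_mul]

namespace HodgeHomotopy

variable {A} (h : A.HodgeHomotopy)

/-! ### The Hodge decomposition -/

lemma dm_eps (a : A.carrier) : h.dm (A.eps a) = - A.eps (h.dm a) := by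
  induction a using A.homogeneous_induction with
  | h0 => simp
  | hadd a b ha hb => simp [ha, hb]; abel
  | hh k a ha => simp [A.eps_of_mem ha, A.eps_of_mem (h.dm_mem ha), sgn_sub]

lemma piH_apply (a : A.carrier) : h.piH a = a - (A.d (h.dm a) + h.dm (A.d a)) := by
  simp [piH]

lemma hodge (a : A.carrier) : a = h.piH a + A.d (h.dm a) + h.dm (A.d a) := by
  rw [piH_apply]; abel

@[simp] lemma piH_d (a : A.carrier) : h.piH (A.d a) = 0 := by
  simp [piH_apply, h.d_dm_d, A.d_d]

@[simp] lemma d_piH (a : A.carrier) : A.d (h.piH a) = 0 := by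
  simp [piH_apply, h.d_dm_d, A.d_d]

@[simp] lemma piH_dm (a : A.carrier) : h.piH (h.dm a) = 0 := by
  simp [piH_apply, h.dm_dm, h.dm_d_dm]

@[simp] lemma dm_piH (a : A.carrier) : h.dm (h.piH a) = 0 := by
  simp [piH_apply, h.dm_dm, h.dm_d_dm]

@[simp] lemma piH_piH (a : A.carrier) : h.piH (h.piH a) = h.piH a := by
  conv_lhs => rw [piH_apply]
  simp

lemma piH_mem {k : ℤ} {a : A.carrier} (ha : a ∈ A.gr k) : h.piH a ∈ A.gr k := by
  rw [piH_apply]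
  refine Submodule.sub_mem _ ha (Submodule.add_mem _ ?_ ?_)
  · have := A.d_mem (h.dm_mem ha)
    rwa [sub_add_cancel] at this
  · have := h.dm_mem (A.d_mem ha)
    rwa [add_sub_cancel_right] at this

lemma piH_eps (a : A.carrier) : h.piH (A.eps a) = A.eps (h.piH a) := by
  simp [piH_apply, A.d_eps, h.dm_eps]

lemma proj_piH (k : ℤ) (a : A.carrier) : A.proj k (h.piH a) = h.piH (A.proj k a) := by
  induction a using A.homogeneous_induction with
  | h0 => simp
  | hadd a b ha hb => simp [ha, hb]
  | hh j a ha =>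
    by_cases hj : j = k
    · subst hj
      rw [A.proj_same ha, A.proj_same (h.piH_mem ha)]
    · rw [A.proj_ne ha hj, A.proj_ne (h.piH_mem ha) hj, map_zero]

lemma proj_dm (k : ℤ) (a : A.carrier) : A.proj k (h.dm a) = h.dm (A.proj (k + 1) a) := by
  induction a using A.homogeneous_induction with
  | h0 => simp
  | hadd a b ha hb => simp [ha, hb]
  | hh j a ha =>
    by_cases hj : j = k + 1
    · subst hj
      have := h.dm_mem ha
      rw [add_sub_cancel_right] at this
      rw [A.proj_same ha, A.proj_same this]
    · rw [A.proj_ne ha hj, A.proj_ne (h.dm_mem ha) (by omega), map_zero]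

lemma mem_harmonic_iff {a : A.carrier} : a ∈ h.harmonic ↔ h.piH a = a := by
  constructor
  · rintro ⟨b, rfl⟩
    exact h.piH_piH b
  · intro ha
    exact ⟨a, ha⟩

lemma piH_coe (a : h.harmonic) : h.piH a = a := h.mem_harmonic_iff.1 a.2

lemma piH_mem_harmonic (a : A.carrier) : h.piH a ∈ h.harmonic := ⟨a, rfl⟩

lemma coe_toHarmonic (a : A.carrier) : (h.toHarmonic a : A.carrier) = h.piH a := rfl

lemma d_of_mem {a : A.carrier} (ha : a ∈ h.harmonic) : A.d a = 0 := by
  rw [← h.mem_harmonic_iff.1 ha, d_piH]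

lemma dm_of_mem {a : A.carrier} (ha : a ∈ h.harmonic) : h.dm a = 0 := by
  rw [← h.mem_harmonic_iff.1 ha, dm_piH]

lemma piH_one : h.piH 1 = 1 := h.mem_harmonic_iff.1 h.one_mem_harmonic

lemma proj_mem_harmonic (k : ℤ) {a : A.carrier} (ha : a ∈ h.harmonic) :
    A.proj k a ∈ h.harmonic := by
  rw [h.mem_harmonic_iff] at ha ⊢
  rw [← proj_piH, ha]

lemma harmonicGr_isInternal : DirectSum.IsInternal h.harmonicGr := by
  refine isInternal_of_proj h.harmonicGr
    (fun k => (A.proj k).restrict fun _ ha => h.proj_mem_harmonic k ha) ?_ ?_ ?_ ?_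
  · exact fun k a => A.proj_mem k a
  · exact fun k a ha => Subtype.ext (A.proj_same ha)
  · exact fun j k hjk a ha => Subtype.ext (A.proj_ne ha hjk.symm)
  · intro a
    obtain ⟨s, hs⟩ := A.sum_proj (a : A.carrier)
    refine ⟨s, Subtype.ext ?_⟩
    rw [AddSubmonoidClass.coe_finsetSum]
    exact hs

/-! ### Orthogonality and adjointness -/

lemma integralA_dm_mul_dm (a b : A.carrier) : A.integralA (h.dm a * h.dm b) = 0 :=
  h.pairing_dm_dm a b

lemma integralA_harmonic_mul_dm {a : A.carrier} (ha : a ∈ h.harmonic) (b : A.carrier) :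
    A.integralA (a * h.dm b) = 0 := by
  have := h.pairing_harmonic_dm a b
  rw [← piH_apply, h.mem_harmonic_iff.1 ha] at this
  exact this

lemma integralA_dm_mul_harmonic {a : A.carrier} (ha : a ∈ h.harmonic) (b : A.carrier) :
    A.integralA (h.dm b * a) = 0 := by
  obtain ⟨s, hs⟩ := A.sum_proj a
  rw [hs, Finset.mul_sum, map_sum]
  refine Finset.sum_eq_zero fun k _ => ?_
  have hk : A.proj k a ∈ h.harmonic := h.proj_mem_harmonic k ha
  induction b using A.homogeneous_induction with
  | h0 => simp
  | hadd b c hb hc => simp [add_mul, hb, hc]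
  | hh j b hb =>
    rw [A.integralA_mul_comm (h.dm_mem hb) (A.proj_mem k a), h.integralA_harmonic_mul_dm hk,
      mul_zero]

/-- Integration against a harmonic element only sees the harmonic part. -/
lemma integralA_piH_mul {b : A.carrier} (hb : b ∈ h.harmonic) (a : A.carrier) :
    A.integralA (h.piH a * b) = A.integralA (a * b) := by
  conv_rhs => rw [h.hodge a]
  have h1 : A.d (h.dm a) * b = A.d (h.dm a * b) := by
    rw [A.d_mul, h.d_of_mem hb]; simp
  rw [add_mul, add_mul, map_add, map_add, h.integralA_dm_mul_harmonic hb, h1, A.integralA_d]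
  simp

lemma integralA_mul_piH {a : A.carrier} (ha : a ∈ h.harmonic) (b : A.carrier) :
    A.integralA (a * h.piH b) = A.integralA (a * b) := by
  conv_rhs => rw [h.hodge b]
  have h1 : a * A.d (h.dm b) = A.d (A.eps a * h.dm b) := by
    rw [A.d_mul, A.d_eps, h.d_of_mem ha]; simp
  rw [mul_add, mul_add, map_add, map_add, h.integralA_harmonic_mul_dm ha, h1, A.integralA_d]
  simp

/-- The Hodge homotopy is self-adjoint up to sign. -/
lemma integralA_dm_mul (a b : A.carrier) :
    A.integralA (h.dm a * b) = A.integralA (A.eps a * h.dm b) := by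
  have e1 : A.integralA (h.dm a * b) = A.integralA (h.dm a * A.d (h.dm b)) := by
    conv_lhs => rw [h.hodge b]
    rw [mul_add, mul_add, map_add, map_add, h.integralA_dm_mul_dm,
      h.integralA_dm_mul_harmonic (h.piH_mem_harmonic b)]
    simp
  have e2 : A.integralA (A.eps a * h.dm b) = A.integralA (A.d (h.dm (A.eps a)) * h.dm b) := by
    conv_lhs => rw [h.hodge (A.eps a)]
    rw [add_mul, add_mul, map_add, map_add, h.integralA_dm_mul_dm,
      h.integralA_harmonic_mul_dm (h.piH_mem_harmonic _)]
    simp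
  have e3 := A.integralA_d (h.dm (A.eps a) * h.dm b)
  rw [A.d_mul, map_add] at e3
  rw [e1, e2, eq_neg_of_add_eq_zero_left e3, h.dm_eps]
  simp

end HodgeHomotopy

end PoincareDGCA

/-! ### The transferred operations on words -/

/-- The word `v` with its first `i` letters removed. -/
def shiftWord {V : Type*} (i : ℕ) (v : ℕ → V) : ℕ → V := fun j => v (j + i)

lemma shiftWord_apply {V : Type*} (i : ℕ) (v : ℕ → V) (j : ℕ) : shiftWord i v j = v (j + i) := rfl

@[simp] lemma shiftWord_zero {V : Type*} (v : ℕ → V) : shiftWord 0 v = v := rfl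

lemma shiftWord_shiftWord {V : Type*} (i j : ℕ) (v : ℕ → V) :
    shiftWord i (shiftWord j v) = shiftWord (i + j) v := by
  funext k; simp [shiftWord, add_assoc]

lemma shiftWord_update_of_lt {V : Type*} {i j : ℕ} (hij : j < i) (v : ℕ → V) (x : V) :
    shiftWord i (Function.update v j x) = shiftWord i v := by
  funext k
  rw [shiftWord_apply, Function.update_of_ne (by omega)]; rfl

lemma shiftWord_update_of_le {V : Type*} {i j : ℕ} (hij : i ≤ j) (v : ℕ → V) (x : V) :
    shiftWord i (Function.update v j x) = Function.update (shiftWord i v) (j - i) x := by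
  funext k
  by_cases hk : k + i = j
  · have : k = j - i := by omega
    subst this
    rw [shiftWord_apply, hk]; simp
  · rw [shiftWord_apply, Function.update_of_ne hk, Function.update_of_ne (by omega)]; rfl

/-- A sum over `i ≤ N` with vanishing extremal terms. -/
lemma sum_range_succ_eq_sum_fin {M : Type*} [AddCommMonoid M] (k : ℕ) (F : ℕ → M) (h0 : F 0 = 0)
    (h1 : F (k + 2) = 0) :
    ∑ i ∈ Finset.range (k + 2 + 1), F i = ∑ i : Fin (k + 1), F (i + 1) := by
  rw [Finset.sum_range_succ, h1, add_zero, Finset.sum_range_succ', h0, add_zero,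
    Finset.sum_range]

/-- A triangular double sum, summed in two ways. -/
lemma sum_range_range_comm {M : Type*} [AddCommMonoid M] (n : ℕ) (F : ℕ → ℕ → M) :
    ∑ i ∈ Finset.range (n + 1), ∑ j ∈ Finset.range (i + 1), F j (i - j) =
      ∑ j ∈ Finset.range (n + 1), ∑ i ∈ Finset.range (n - j + 1), F j i := by
  rw [Finset.sum_sigma', Finset.sum_sigma']
  refine Finset.sum_nbij' (fun x => ⟨x.2, x.1 - x.2⟩) (fun x => ⟨x.1 + x.2, x.1⟩) ?_ ?_ ?_ ?_ ?_
  · rintro ⟨i, j⟩ h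
    simp only [Finset.mem_sigma, Finset.mem_range] at h ⊢
    omega
  · rintro ⟨i, j⟩ h
    simp only [Finset.mem_sigma, Finset.mem_range] at h ⊢
    omega
  · rintro ⟨i, j⟩ h
    simp only [Finset.mem_sigma, Finset.mem_range] at h
    have : j + (i - j) = i := by omega
    simp [this]
  · rintro ⟨i, j⟩ h
    simp
  · rintro ⟨i, j⟩ h
    rfl

namespace PoincareDGCA

variable {K : Type u} [Field K] {n : ℕ} {A : PoincareDGCA K n}

namespace HodgeHomotopy

variable (h : A.HodgeHomotopy)

/-- The components of the transferred morphism, in the suspended sign convention: they satisfy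
`φ_1 = id` and `φ_k = - d⁻ ∑_i ε φ_i · φ_{k-i}` for `k ≥ 2`, where `ε` is the grading
involution. -/
def phi : ℕ → (ℕ → A.carrier) → A.carrier
  | 0, _ => 0
  | 1, v => v 0
  | k + 2, v => - h.dm (∑ i : Fin (k + 1),
      A.eps (phi (i + 1) v) * phi (k + 1 - i) (shiftWord (i + 1) v))
  termination_by k => k
  decreasing_by all_goals omega

/-- The product `∑_i ε φ_i · φ_{k-i}`: up to sign, this is `m̂_k`. -/
def prodPhi (k : ℕ) (v : ℕ → A.carrier) : A.carrier :=
  ∑ i ∈ Finset.range (k + 1), A.eps (h.phi i v) * h.phi (k - i) (shiftWord i v)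

@[simp] lemma phi_zero (v : ℕ → A.carrier) : h.phi 0 v = 0 := by rw [phi]

@[simp] lemma phi_one (v : ℕ → A.carrier) : h.phi 1 v = v 0 := by rw [phi]

@[simp] lemma prodPhi_zero (v : ℕ → A.carrier) : h.prodPhi 0 v = 0 := by simp [prodPhi]

@[simp] lemma prodPhi_one (v : ℕ → A.carrier) : h.prodPhi 1 v = 0 := by
  simp [prodPhi, Finset.sum_range_succ]

lemma prodPhi_two (v : ℕ → A.carrier) : h.prodPhi 2 v = A.eps (v 0) * v 1 := by
  simp [prodPhi, Finset.sum_range_succ, shiftWord]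

lemma prodPhi_eq_sum_fin (k : ℕ) (v : ℕ → A.carrier) :
    h.prodPhi (k + 2) v = ∑ i : Fin (k + 1),
      A.eps (h.phi (i + 1) v) * h.phi (k + 1 - i) (shiftWord (i + 1) v) := by
  rw [prodPhi, sum_range_succ_eq_sum_fin _ _ (by simp) (by simp)]
  refine Finset.sum_congr rfl fun i _ => ?_
  have : k + 2 - (↑i + 1) = k + 1 - i := by omega
  rw [this]

lemma phi_of_two_le {k : ℕ} (hk : 2 ≤ k) (v : ℕ → A.carrier) :
    h.phi k v = - h.dm (h.prodPhi k v) := by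
  obtain ⟨k, rfl⟩ := Nat.exists_eq_add_of_le' hk
  rw [prodPhi_eq_sum_fin, phi]

/-- A property of words of length `1` which passes from `φ_i`, `i < k`, to `φ_k` through the
recursion holds for all `φ_k`. -/
lemma phi_induction {P : ℕ → Prop} (h0 : P 0) (h1 : P 1)
    (hs : ∀ k, 2 ≤ k → (∀ i < k, P i) → P k) (k : ℕ) : P k := by
  induction k using Nat.strong_induction_on with
  | _ k ih =>
    rcases (by omega : k = 0 ∨ k = 1 ∨ 2 ≤ k) with rfl | rfl | hk
    · exact h0
    · exact h1
    · exact hs k hk ih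

/-- The terms of `prodPhi` with an empty factor vanish, so that the remaining ones may be compared
under an induction hypothesis on shorter words. -/
lemma prodPhi_congr_of {k : ℕ} {v w : ℕ → A.carrier}
    (hF : ∀ i, 1 ≤ i → i < k → A.eps (h.phi i v) * h.phi (k - i) (shiftWord i v) =
      A.eps (h.phi i w) * h.phi (k - i) (shiftWord i w)) : h.prodPhi k v = h.prodPhi k w := by
  refine Finset.sum_congr rfl fun i hi => ?_
  rw [Finset.mem_range] at hi
  rcases (by omega : i = 0 ∨ i = k ∨ (1 ≤ i ∧ i < k)) with rfl | rfl | hi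
  · simp
  · simp
  · exact hF i hi.1 hi.2

lemma phi_congr (k : ℕ) : ∀ {v w : ℕ → A.carrier}, (∀ j < k, v j = w j) →
    h.phi k v = h.phi k w := by
  induction k using phi_induction with
  | h0 => simp
  | h1 => intro v w hvw; simpa using hvw 0 (by omega)
  | hs k hk ih =>
    intro v w hvw
    rw [h.phi_of_two_le hk, h.phi_of_two_le hk, h.prodPhi_congr_of (w := w)]
    intro i h1 h2
    rw [ih i h2 (fun j hj => hvw j (by omega)),
      ih (k - i) (by omega) (v := shiftWord i v) (w := shiftWord i w)
        (fun j hj => hvw (j + i) (by omega))]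

lemma prodPhi_congr (k : ℕ) {v w : ℕ → A.carrier} (hvw : ∀ j < k, v j = w j) :
    h.prodPhi k v = h.prodPhi k w :=
  h.prodPhi_congr_of fun i h1 h2 => by
    rw [h.phi_congr i (fun j hj => hvw j (by omega)),
      h.phi_congr (k - i) (v := shiftWord i v) (w := shiftWord i w)
        (fun j hj => hvw (j + i) (by omega))]

lemma sum_range_sub (p : ℕ → ℤ) {i k : ℕ} (hik : i ≤ k) :
    ∑ j ∈ Finset.range i, p j + ∑ j ∈ Finset.range (k - i), p (j + i) =
      ∑ j ∈ Finset.range k, p j := by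
  obtain ⟨l, rfl⟩ := Nat.exists_eq_add_of_le hik
  rw [Finset.sum_range_add, Nat.add_sub_cancel_left]
  simp [add_comm]

lemma phi_mem (k : ℕ) : ∀ {p : ℕ → ℤ} {v : ℕ → A.carrier}, (∀ j < k, v j ∈ A.gr (p j)) →
    h.phi k v ∈ A.gr (∑ j ∈ Finset.range k, p j + 1 - k) := by
  induction k using phi_induction with
  | h0 => simp
  | h1 => intro p v hv; simpa using hv 0 (by omega)
  | hs k hk ih =>
    intro p v hv
    rw [h.phi_of_two_le hk]
    refine Submodule.neg_mem _ ?_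
    rw [prodPhi, map_sum]
    refine Submodule.sum_mem _ fun i hi => ?_
    rw [Finset.mem_range] at hi
    rcases (by omega : i = 0 ∨ i = k ∨ (1 ≤ i ∧ i < k)) with rfl | rfl | hi
    · simp
    · simp
    · have e1 := A.eps_mem (ih i hi.2 (fun j hj => hv j (by omega)))
      have e2 := ih (k - i) (by omega) (p := fun j => p (j + i)) (v := shiftWord i v)
        (fun j hj => hv (j + i) (by omega))
      have := h.dm_mem (A.mul_mem e1 e2)
      convert this using 2
      rw [← sum_range_sub p hi.2.le]
      push_cast [hi.2.le]
      ring

lemma prodPhi_mem (k : ℕ) {p : ℕ → ℤ} {v : ℕ → A.carrier} (hv : ∀ j < k, v j ∈ A.gr (p j)) :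
    h.prodPhi k v ∈ A.gr (∑ j ∈ Finset.range k, p j + 2 - k) := by
  refine Submodule.sum_mem _ fun i hi => ?_
  rw [Finset.mem_range] at hi
  have e1 := A.eps_mem (h.phi_mem i (fun j hj => hv j (by omega)))
  have e2 := h.phi_mem (k - i) (p := fun j => p (j + i)) (v := shiftWord i v)
        (fun j hj => hv (j + i) (by omega))
  convert A.mul_mem e1 e2 using 2
  rw [← sum_range_sub p (by omega : i ≤ k)]
  push_cast [(by omega : i ≤ k)]
  ring

/-- The word obtained by applying the suspended sign `- ε` to the first `r` letters. -/
def signWord (A : PoincareDGCA K n) (r : ℕ) (v : ℕ → A.carrier) : ℕ → A.carrier :=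
  fun j => if j < r then - A.eps (v j) else v j

/-- `φ` is odd for the suspended grading. -/
lemma phi_signWord (k : ℕ) : ∀ {r : ℕ} (v : ℕ → A.carrier), k ≤ r →
    h.phi k (signWord A r v) = - A.eps (h.phi k v) := by
  induction k using phi_induction with
  | h0 => simp
  | h1 => intro r v hr; simp [signWord, (by omega : 0 < r)]
  | hs k hk ih =>
    intro r v hr
    rw [h.phi_of_two_le hk, h.phi_of_two_le hk, map_neg, neg_neg]
    have : h.prodPhi k (signWord A r v) = A.eps (h.prodPhi k v) := by
      rw [prodPhi, prodPhi, map_sum]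
      refine Finset.sum_congr rfl fun i hi => ?_
      rw [Finset.mem_range] at hi
      rcases (by omega : i = 0 ∨ i = k ∨ (1 ≤ i ∧ i < k)) with rfl | rfl | hi
      · simp
      · simp
      · have e : shiftWord i (signWord A r v) = signWord A (r - i) (shiftWord i v) := by
          funext j
          simp only [shiftWord, signWord]
          congr 1
          simp only [eq_iff_iff]; omega
        rw [e, ih i hi.2 v (by omega), ih (k - i) (by omega) _ (by omega), A.eps_mul]
        simp
    rw [this, h.dm_eps, neg_neg]

/-! ### Multilinearity -/

lemma phi_update (k : ℕ) : ∀ (v : ℕ → A.carrier) (j : ℕ) (_ : j < k) (a b : K)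
    (x y : A.carrier), h.phi k (Function.update v j (a • x + b • y)) =
      a • h.phi k (Function.update v j x) + b • h.phi k (Function.update v j y) := by
  induction k using phi_induction with
  | h0 => intro v j hj; omega
  | h1 => intro v j hj a b x y; obtain rfl : j = 0 := by omega
          simp
  | hs k hk ih =>
    intro v j hj a b x y
    simp only [h.phi_of_two_le hk, prodPhi, map_sum, ← Finset.sum_neg_distrib, Finset.smul_sum,
      ← Finset.sum_add_distrib]
    refine Finset.sum_congr rfl fun i hi => ?_
    rw [Finset.mem_range] at hi
    rcases (by omega : i = 0 ∨ i = k ∨ (1 ≤ i ∧ i < k)) with rfl | rfl | hi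
    · simp
    · simp
    · by_cases hij : j < i
      · simp only [shiftWord_update_of_lt hij, ih i hi.2 v j hij, map_add, map_smul, add_mul,
          smul_mul_assoc]
        simp only [smul_neg]; abel
      · have hc : ∀ z, h.phi i (Function.update v j z) = h.phi i v := fun z =>
          h.phi_congr i fun l hl => Function.update_of_ne (by omega) _ _
        simp only [shiftWord_update_of_le (not_lt.1 hij), hc,
          ih (k - i) (by omega) (shiftWord i v) (j - i) (by omega), map_add, map_smul, mul_add,
          mul_smul_comm]
        simp only [smul_neg]; abel

lemma prodPhi_update (k : ℕ) (v : ℕ → A.carrier) (j : ℕ) (hj : j < k) (a b : K)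
    (x y : A.carrier) : h.prodPhi k (Function.update v j (a • x + b • y)) =
      a • h.prodPhi k (Function.update v j x) + b • h.prodPhi k (Function.update v j y) := by
  simp only [prodPhi, Finset.smul_sum, ← Finset.sum_add_distrib]
  refine Finset.sum_congr rfl fun i hi => ?_
  rw [Finset.mem_range] at hi
  by_cases hij : j < i
  · simp only [shiftWord_update_of_lt hij, h.phi_update i v j hij, map_add, map_smul, add_mul,
      smul_mul_assoc]
  · have hc : ∀ z, h.phi i (Function.update v j z) = h.phi i v := fun z =>
      h.phi_congr i fun l hl => Function.update_of_ne (by omega) _ _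
    simp only [shiftWord_update_of_le (not_lt.1 hij), hc,
      h.phi_update (k - i) (shiftWord i v) (j - i) (by omega), mul_add, mul_smul_comm]

/-- The word with letters `w 0, …, w (k-1), 0, 0, …`. -/
def extendWord {V : Type*} [Zero V] {k : ℕ} (w : Fin k → V) : ℕ → V :=
  fun j => if hj : j < k then w ⟨j, hj⟩ else 0

lemma extendWord_apply {V : Type*} [Zero V] {k : ℕ} (w : Fin k → V) (i : Fin k) :
    extendWord w i = w i := by simp [extendWord]

lemma extendWord_update {V : Type*} [Zero V] {k : ℕ} [DecidableEq (Fin k)] (w : Fin k → V)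
    (i : Fin k) (x : V) :
    extendWord (Function.update w i x) = Function.update (extendWord w) i x := by
  funext j
  by_cases hj : j = i
  · subst hj; rw [extendWord_apply]; simp
  · rw [Function.update_of_ne hj]
    unfold extendWord
    split_ifs with hk
    · rw [Function.update_of_ne]
      exact fun e => hj (by rw [← e])
    · rfl

/-- A function of words which is linear in its first `k` letters, as a multilinear map. -/
def multilinearOfWord {V W : Type*} [AddCommGroup V] [Module K V] [AddCommGroup W] [Module K W]
    (k : ℕ) (F : (ℕ → V) → W)
    (hF : ∀ (v : ℕ → V) (j : ℕ) (_ : j < k) (a b : K) (x y : V),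
      F (Function.update v j (a • x + b • y)) =
        a • F (Function.update v j x) + b • F (Function.update v j y)) :
    MultilinearMap K (fun _ : Fin k => V) W where
  toFun w := F (extendWord w)
  map_update_add' w i x y := by
    have := hF (extendWord w) i i.2 1 1 x y
    simpa [extendWord_update] using this
  map_update_smul' w i c x := by
    have := hF (extendWord w) i i.2 c 0 x 0
    simpa [extendWord_update] using this

/-- `φ_k` as a multilinear map. -/
def phiMulti (k : ℕ) : MultilinearMap K (fun _ : Fin k => A.carrier) A.carrier :=
  multilinearOfWord k (h.phi k) (h.phi_update k)

lemma phiMulti_apply (k : ℕ) (v : ℕ → A.carrier) : h.phiMulti k (fun i => v i) = h.phi k v :=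
  h.phi_congr k fun j hj => by simp [extendWord, hj]

/-- `∑_i ε φ_i · φ_{k-i}` as a multilinear map. -/
def prodPhiMulti (k : ℕ) : MultilinearMap K (fun _ : Fin k => A.carrier) A.carrier :=
  multilinearOfWord k (h.prodPhi k) (h.prodPhi_update k)

lemma prodPhiMulti_apply (k : ℕ) (v : ℕ → A.carrier) :
    h.prodPhiMulti k (fun i => v i) = h.prodPhi k v :=
  h.prodPhi_congr k fun j hj => by simp [extendWord, hj]

lemma phi_smul (k : ℕ) (c : ℕ → K) (v : ℕ → A.carrier) :
    h.phi k (fun j => c j • v j) = (∏ j ∈ Finset.range k, c j) • h.phi k v := by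
  rw [← phiMulti_apply, ← phiMulti_apply, Finset.prod_range]
  exact (h.phiMulti k).map_smul_univ (fun i => c i) (fun i => v i)

lemma prodPhi_smul (k : ℕ) (c : ℕ → K) (v : ℕ → A.carrier) :
    h.prodPhi k (fun j => c j • v j) = (∏ j ∈ Finset.range k, c j) • h.prodPhi k v := by
  rw [← prodPhiMulti_apply, ← prodPhiMulti_apply, Finset.prod_range]
  exact (h.prodPhiMulti k).map_smul_univ (fun i => c i) (fun i => v i)

end HodgeHomotopy

end PoincareDGCA

/-! ### The transfer equations -/

/-- Reindexing of the cuts of words with an inserted letter: a cut is either to the left or to the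
right of the inserted letter. -/
lemma sum_insert_cut {M : Type*} [AddCommMonoid M] (k : ℕ) (T X Y : ℕ → ℕ → ℕ → M)
    (hX : ∀ s r i, 2 ≤ s → r + s ≤ k → i ≤ r → T s r i = X i (r - i) s)
    (hY : ∀ s r i, 2 ≤ s → r + s ≤ k → r < i → i + s ≤ k + 1 → T s r i = Y (i + s - 1) r s) :
    ∑ s ∈ Finset.Icc 2 k, ∑ r ∈ Finset.range (k - s + 1),
        ∑ i ∈ Finset.range (k - s + 1 + 1), T s r i =
      ∑ i ∈ Finset.range (k + 1), ∑ s ∈ Finset.Icc 2 (k - i),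
          ∑ r ∈ Finset.range (k - i - s + 1), X i r s +
        ∑ i ∈ Finset.range (k + 1), ∑ s ∈ Finset.Icc 2 i, ∑ r ∈ Finset.range (i - s + 1),
          Y i r s := by
  have e1 : ∀ s ∈ Finset.Icc 2 k, ∀ r ∈ Finset.range (k - s + 1),
      ∑ i ∈ Finset.range (k - s + 1 + 1), T s r i =
        ∑ i ∈ Finset.range (r + 1), X i (r - i) s +
          ∑ i ∈ Finset.range (k - s + 1 - r), Y (r + s + i) r s := by
    intro s hs r hr
    rw [Finset.mem_Icc] at hs
    rw [Finset.mem_range] at hr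
    have : k - s + 1 + 1 = (r + 1) + (k - s + 1 - r) := by omega
    rw [this, Finset.sum_range_add]
    refine congrArg₂ _ (Finset.sum_congr rfl fun i hi => ?_) (Finset.sum_congr rfl fun i hi => ?_)
    · rw [Finset.mem_range] at hi
      exact hX s r i hs.1 (by omega) (by omega)
    · rw [Finset.mem_range] at hi
      rw [hY s r _ hs.1 (by omega) (by omega) (by omega)]
      congr 1
      omega
  rw [Finset.sum_congr rfl fun s hs => Finset.sum_congr rfl (e1 s hs)]
  simp only [Finset.sum_add_distrib]
  simp only [Finset.sum_sigma']
  congr 1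
  · refine Finset.sum_nbij' (fun x => ⟨x.2.2, x.1, x.2.1 - x.2.2⟩)
      (fun x => ⟨x.2.1, x.1 + x.2.2, x.1⟩) ?_ ?_ ?_ ?_ ?_
    · rintro ⟨s, r, i⟩ hx
      simp only [Finset.mem_sigma, Finset.mem_range, Finset.mem_Icc] at hx ⊢
      omega
    · rintro ⟨i, s, r⟩ hx
      simp only [Finset.mem_sigma, Finset.mem_range, Finset.mem_Icc] at hx ⊢
      omega
    · rintro ⟨s, r, i⟩ hx
      simp only [Finset.mem_sigma, Finset.mem_range, Finset.mem_Icc] at hx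
      have : i + (r - i) = r := by omega
      simp [this]
    · rintro ⟨i, s, r⟩ hx
      simp
    · rintro ⟨s, r, i⟩ hx
      rfl
  · refine Finset.sum_nbij' (fun x => ⟨x.2.1 + x.1 + x.2.2, x.1, x.2.1⟩)
      (fun x => ⟨x.2.1, x.2.2, x.1 - x.2.2 - x.2.1⟩) ?_ ?_ ?_ ?_ ?_
    · rintro ⟨s, r, i⟩ hx
      simp only [Finset.mem_sigma, Finset.mem_range, Finset.mem_Icc] at hx ⊢
      omega
    · rintro ⟨i, s, r⟩ hx
      simp only [Finset.mem_sigma, Finset.mem_range, Finset.mem_Icc] at hx ⊢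
      omega
    · rintro ⟨s, r, i⟩ hx
      simp only [Finset.mem_sigma, Finset.mem_range, Finset.mem_Icc] at hx
      have : r + s + i - r - s = i := by omega
      simp [this]
    · rintro ⟨i, s, r⟩ hx
      simp only [Finset.mem_sigma, Finset.mem_range, Finset.mem_Icc] at hx
      have : r + s + (i - r - s) = i := by omega
      simp [this]
    · rintro ⟨s, r, i⟩ hx
      rfl

namespace PoincareDGCA

variable {K : Type u} [Field K] {n : ℕ} {A : PoincareDGCA K n}

namespace HodgeHomotopy

variable (h : A.HodgeHomotopy)

/-- The transferred operations `μ_k = π ∑_i ε φ_i · φ_{k-i}` in the suspended sign convention. -/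
def mu (k : ℕ) (v : ℕ → A.carrier) : A.carrier := h.piH (h.prodPhi k v)

/-- The word `(τ v_0, …, τ v_{r-1}, μ_s(v_r, …, v_{r+s-1}), v_{r+s}, …)`, with `τ = - ε`. -/
def muWord (r s : ℕ) (v : ℕ → A.carrier) : ℕ → A.carrier :=
  insertWord (signWord A r v) r s (h.mu s (shiftWord r v))

/-- The composition of `F` with the coderivation defined by the operations `μ_s`. -/
def compMu (F : ℕ → (ℕ → A.carrier) → A.carrier) (k : ℕ) (v : ℕ → A.carrier) : A.carrier :=
  ∑ s ∈ Finset.Icc 2 k, ∑ r ∈ Finset.range (k - s + 1), F (k - s + 1) (h.muWord r s v)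

lemma shiftWord_muWord_of_le {i r : ℕ} (hi : i ≤ r) (s : ℕ) (v : ℕ → A.carrier) :
    shiftWord i (h.muWord r s v) = h.muWord (r - i) s (shiftWord i v) := by
  funext j
  simp only [muWord, insertWord, signWord, shiftWord_shiftWord, Nat.sub_add_cancel hi,
    shiftWord_apply]
  have e1 : (j + i < r) = (j < r - i) := by simp only [eq_iff_iff]; omega
  have e2 : (j + i = r) = (j = r - i) := by simp only [eq_iff_iff]; omega
  simp only [e1, e2]
  by_cases h1 : j < r - i
  · simp only [h1, if_true]
  by_cases h2 : j = r - i
  · simp only [h1, h2, if_true, if_false]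
  · have e3 : ¬ (j + i + s - 1 < r) := by omega
    have e4 : ¬ (j + s - 1 < r - i) := by omega
    have e5 : j + i + s - 1 = j + s - 1 + i := by omega
    simp only [h1, h2, if_false, e4, e5]
    rw [if_neg (by omega)]

lemma shiftWord_muWord_of_lt {i r s : ℕ} (hi : r < i) (v : ℕ → A.carrier) :
    shiftWord i (h.muWord r s v) = shiftWord (i + s - 1) v := by
  funext j
  have e1 : ¬ (j + i < r) := by omega
  have e2 : ¬ (j + i = r) := by omega
  have e3 : ¬ (j + i + s - 1 < r) := by omega
  have e4 : j + i + s - 1 = j + (i + s - 1) := by omega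
  simp only [shiftWord, muWord, insertWord, signWord, e1, e2, e3, if_false]
  rw [e4]

lemma phi_muWord_of_le {i r s : ℕ} (hi : i ≤ r) (v : ℕ → A.carrier) :
    h.phi i (h.muWord r s v) = - A.eps (h.phi i v) := by
  rw [← h.phi_signWord i v hi]
  refine h.phi_congr i fun j hj => ?_
  simp [muWord, insertWord, (by omega : j < r)]

/-- The coderivation rule for the product of `ε φ` and `φ`. -/
lemma compMu_prodPhi (k : ℕ) (v : ℕ → A.carrier) :
    h.compMu h.prodPhi k v = ∑ i ∈ Finset.range (k + 1),
      (A.eps (h.compMu h.phi i v) * h.phi (k - i) (shiftWord i v) -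
        h.phi i v * h.compMu h.phi (k - i) (shiftWord i v)) := by
  rw [compMu]
  simp only [prodPhi]
  rw [sum_insert_cut k _
    (fun i r s => - (h.phi i v * h.phi (k - i - s + 1) (h.muWord r s (shiftWord i v))))
    (fun i r s => A.eps (h.phi (i - s + 1) (h.muWord r s v)) * h.phi (k - i) (shiftWord i v))]
  · simp only [compMu, map_sum, Finset.sum_mul, Finset.mul_sum, Finset.sum_sub_distrib,
      Finset.sum_neg_distrib]
    abel
  · intro s r i hs hr hi
    rw [h.phi_muWord_of_le hi, h.shiftWord_muWord_of_le hi, map_neg, A.eps_eps, neg_mul]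
    have : k - s + 1 - i = k - i - s + 1 := by omega
    rw [this]
  · intro s r i hs hr hi hk
    rw [h.shiftWord_muWord_of_lt hi]
    have e1 : i + s - 1 - s + 1 = i := by omega
    have e2 : k - s + 1 - i = k - (i + s - 1) := by omega
    rw [e1, e2]

lemma compMu_zero (F : ℕ → (ℕ → A.carrier) → A.carrier) (v : ℕ → A.carrier) :
    h.compMu F 0 v = 0 := by simp [compMu]

lemma compMu_one (F : ℕ → (ℕ → A.carrier) → A.carrier) (v : ℕ → A.carrier) :
    h.compMu F 1 v = 0 := by simp [compMu]

/-- The first component of `φ` contributes `μ_k` to `φ ∘ μ`, and the other ones `- d⁻ (M ∘ μ)`,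
where `M` is the product of `ε φ` and `φ`. -/
lemma compMu_phi {k : ℕ} (hk : 2 ≤ k) (v : ℕ → A.carrier) :
    h.compMu h.phi k v = h.mu k v - h.dm (h.compMu h.prodPhi k v) := by
  have key : ∀ s ∈ Finset.Icc 2 k, ∀ r ∈ Finset.range (k - s + 1),
      h.phi (k - s + 1) (h.muWord r s v) =
        (if s = k then h.mu k v else 0) - h.dm (h.prodPhi (k - s + 1) (h.muWord r s v)) := by
    intro s hs r hr
    rw [Finset.mem_Icc] at hs
    rw [Finset.mem_range] at hr
    by_cases hsk : s = k
    · subst hsk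
      obtain rfl : r = 0 := by omega
      simp [muWord, insertWord]
    · rw [h.phi_of_two_le (by omega)]
      simp [hsk]
  rw [compMu, Finset.sum_congr rfl fun s hs => Finset.sum_congr rfl (key s hs)]
  simp only [compMu, Finset.sum_sub_distrib, map_sum]
  congr 1
  rw [Finset.sum_eq_single_of_mem k (by simp [hk])]
  · simp
  · intro s _ hs
    simp [hs]

/-- Associativity of the product of `A`, in terms of `φ`. -/
lemma sum_eps_prodPhi_mul_phi (k : ℕ) (v : ℕ → A.carrier) :
    ∑ i ∈ Finset.range (k + 1), A.eps (h.prodPhi i v) * h.phi (k - i) (shiftWord i v) =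
      ∑ i ∈ Finset.range (k + 1), h.phi i v * h.prodPhi (k - i) (shiftWord i v) := by
  have := sum_range_range_comm k fun j i =>
    h.phi j v * A.eps (h.phi i (shiftWord j v)) * h.phi (k - j - i) (shiftWord (i + j) v)
  simp only [prodPhi, map_sum, A.eps_mul, A.eps_eps, Finset.sum_mul, Finset.mul_sum,
    shiftWord_shiftWord]
  simp only [mul_assoc] at this ⊢
  rw [← this]
  refine Finset.sum_congr rfl fun i hi => Finset.sum_congr rfl fun j hj => ?_
  rw [Finset.mem_range] at hi hj
  have e1 : k - j - (i - j) = k - i := by omega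
  have e2 : i - j + j = i := by omega
  rw [e1, e2]

/-- The differential of the product of `ε φ` and `φ`, given the transfer equation for shorter
words. -/
lemma d_prodPhi_of {k : ℕ} (v : ℕ → A.carrier)
    (ih : ∀ i < k, ∀ j, i + j ≤ k → A.d (h.phi i (shiftWord j v)) =
      h.compMu h.phi i (shiftWord j v) - h.prodPhi i (shiftWord j v)) :
    A.d (h.prodPhi k v) = - h.compMu h.prodPhi k v := by
  have key : ∀ i ∈ Finset.range (k + 1),
      A.d (A.eps (h.phi i v) * h.phi (k - i) (shiftWord i v)) =
        - (A.eps (h.compMu h.phi i v) * h.phi (k - i) (shiftWord i v) -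
            h.phi i v * h.compMu h.phi (k - i) (shiftWord i v)) +
          (A.eps (h.prodPhi i v) * h.phi (k - i) (shiftWord i v) -
            h.phi i v * h.prodPhi (k - i) (shiftWord i v)) := by
    intro i hi
    rw [Finset.mem_range] at hi
    rcases (by omega : i = 0 ∨ i = k ∨ (1 ≤ i ∧ i < k)) with rfl | rfl | hi
    · simp [compMu_zero]
    · simp [compMu_zero]
    · have e1 := ih i hi.2 0 (by omega)
      rw [shiftWord_zero] at e1
      rw [A.d_mul, A.d_eps, A.eps_eps, e1, ih (k - i) (by omega) i (by omega)]
      simp only [map_sub, neg_mul, sub_mul, mul_sub]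
      abel
  rw [h.compMu_prodPhi, prodPhi, map_sum, Finset.sum_congr rfl key, Finset.sum_add_distrib,
    Finset.sum_neg_distrib, Finset.sum_sub_distrib (s := Finset.range (k + 1))
      (f := fun i => A.eps (h.prodPhi i v) * h.phi (k - i) (shiftWord i v)),
    h.sum_eps_prodPhi_mul_phi, sub_self, add_zero]

/-- The transfer equation: `φ` is a morphism from the operations `μ` to the algebra `A`, on words
of harmonic elements. -/
lemma d_phi (k : ℕ) : ∀ (v : ℕ → A.carrier), (∀ j, v j ∈ h.harmonic) →
    A.d (h.phi k v) = h.compMu h.phi k v - h.prodPhi k v := by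
  induction k using phi_induction with
  | h0 => simp [compMu_zero]
  | h1 => intro v hv; simp [compMu_one, h.d_of_mem (hv 0)]
  | hs k hk ih =>
    intro v hv
    have hd := h.d_prodPhi_of v (fun i hi j _ => ih i hi _ fun l => hv (l + j))
    rw [h.compMu_phi hk, h.phi_of_two_le hk, map_neg, mu]
    conv_rhs => rw [h.hodge (h.prodPhi k v), hd, map_add, map_add, h.piH_piH]
    simp
    abel

/-- The operations `μ` satisfy the `A∞`-relations. -/
lemma compMu_mu (k : ℕ) (v : ℕ → A.carrier) (hv : ∀ j, v j ∈ h.harmonic) :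
    h.compMu h.mu k v = 0 := by
  have hd := h.d_prodPhi_of v (k := k) (fun i _ j _ => h.d_phi i _ fun l => hv (l + j))
  have : h.compMu h.mu k v = h.piH (h.compMu h.prodPhi k v) := by simp [compMu, mu]
  rw [this, ← neg_neg (h.compMu h.prodPhi k v), ← hd, map_neg, piH_d, neg_zero]

/-! ### The unit -/

/-- `φ_k`, `k ≥ 2`, vanishes on words of harmonic elements which contain the unit. -/
lemma phi_of_eq_one (k : ℕ) : 2 ≤ k → ∀ (v : ℕ → A.carrier), (∀ j, v j ∈ h.harmonic) →
    ∀ i < k, v i = 1 → h.phi k v = 0 := by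
  induction k using phi_induction with
  | h0 => omega
  | h1 => omega
  | hs k hk ih =>
    intro _ v hv i hi h1
    rw [h.phi_of_two_le hk, prodPhi, map_sum, neg_eq_zero]
    refine Finset.sum_eq_zero fun j hj => ?_
    rw [Finset.mem_range] at hj
    rcases (by omega : j = 0 ∨ j = k ∨ (1 ≤ j ∧ j < k)) with rfl | rfl | hj
    · simp
    · simp
    · have hd : ∀ l (w : ℕ → A.carrier), (∀ j, w j ∈ h.harmonic) → 1 ≤ l →
          h.dm (h.phi l w) = 0 := by
        intro l w hw hl
        rcases (by omega : l = 1 ∨ 2 ≤ l) with rfl | hl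
        · rw [phi_one, h.dm_of_mem (hw 0)]
        · rw [h.phi_of_two_le hl, map_neg, h.dm_dm, neg_zero]
      by_cases hij : i < j
      · by_cases hj2 : 2 ≤ j
        · rw [ih j hj.2 hj2 v hv i hij h1]; simp
        · obtain rfl : j = 1 := by omega
          obtain rfl : i = 0 := by omega
          rw [phi_one, h1, A.eps_one, one_mul,
            hd _ (shiftWord 1 v) (fun l => hv (l + 1)) (by omega)]
      · have h1' : shiftWord j v (i - j) = 1 := by
          rw [shiftWord_apply, Nat.sub_add_cancel (by omega), h1]
        by_cases hj2 : 2 ≤ k - j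
        · rw [ih (k - j) (by omega) hj2 (shiftWord j v) (fun l => hv (l + j)) (i - j) (by omega)
            h1']
          simp
        · have e1 : k - j = 1 := by omega
          have e2 : i - j = 0 := by omega
          rw [e2] at h1'
          rw [e1, phi_one, h1', mul_one, h.dm_eps, hd _ _ hv hj.1]
          simp

/-- `μ_k`, `k ≥ 3`, vanishes on words of harmonic elements which contain the unit. -/
lemma mu_of_eq_one {k : ℕ} (hk : 3 ≤ k) (v : ℕ → A.carrier) (hv : ∀ j, v j ∈ h.harmonic) {i : ℕ}
    (hi : i < k) (h1 : v i = 1) : h.mu k v = 0 := by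
  have hp : ∀ l (w : ℕ → A.carrier), 2 ≤ l → h.piH (h.phi l w) = 0 := by
    intro l w hl
    rw [h.phi_of_two_le hl, map_neg, piH_dm, neg_zero]
  rw [mu, prodPhi, map_sum]
  refine Finset.sum_eq_zero fun j hj => ?_
  rw [Finset.mem_range] at hj
  rcases (by omega : j = 0 ∨ j = k ∨ (1 ≤ j ∧ j < k)) with rfl | rfl | hj
  · simp
  · simp
  · by_cases hij : i < j
    · by_cases hj2 : 2 ≤ j
      · rw [h.phi_of_eq_one j hj2 v hv i hij h1]; simp
      · obtain rfl : j = 1 := by omega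
        obtain rfl : i = 0 := by omega
        rw [phi_one, h1, A.eps_one, one_mul, hp _ _ (by omega)]
    · have h1' : shiftWord j v (i - j) = 1 := by
        rw [shiftWord_apply, Nat.sub_add_cancel (by omega), h1]
      by_cases hj2 : 2 ≤ k - j
      · rw [h.phi_of_eq_one (k - j) hj2 (shiftWord j v) (fun l => hv (l + j)) (i - j) (by omega)
          h1']
        simp
      · have e1 : k - j = 1 := by omega
        have e2 : i - j = 0 := by omega
        rw [e2] at h1'
        rw [e1, phi_one, h1', mul_one, h.piH_eps, hp _ _ (by omega), map_zero]

end HodgeHomotopy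

end PoincareDGCA

/-! ### Removing the suspension -/

/-- The exponent `∑_j (k - 1 - j) p_j` of the sign which relates the suspended operations to the
operations `m_k`. -/
def twist (k : ℕ) (p : ℕ → ℤ) : ℤ := ∑ j ∈ Finset.range k, ((k : ℤ) - 1 - j) * p j

lemma twist_congr {k : ℕ} {p q : ℕ → ℤ} (hpq : ∀ j < k, p j = q j) : twist k p = twist k q :=
  Finset.sum_congr rfl fun j hj => by rw [hpq j (Finset.mem_range.1 hj)]

lemma twist_add (i l : ℕ) (p : ℕ → ℤ) :
    twist (i + l) p = twist i p + l * ∑ j ∈ Finset.range i, p j + twist l (shiftWord i p) := by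
  simp only [twist, Finset.sum_range_add, Finset.mul_sum]
  rw [← Finset.sum_add_distrib]
  refine congrArg₂ _ (Finset.sum_congr rfl fun j _ => ?_) (Finset.sum_congr rfl fun j _ => ?_)
  · push_cast; ring
  · rw [shiftWord_apply, add_comm j i]; push_cast; ring

/-- The sign identity behind the comparison of the two conventions for the `A∞`-relations. -/
lemma twist_insertWord (r s t : ℕ) (p : ℕ → ℤ) :
    ((r : ℤ) + s * t + s * ∑ j ∈ Finset.range r, p j) +
      twist (r + 1 + t)
        (insertWord p r s (∑ j ∈ Finset.range s, p (r + j) + 2 - s)) +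
      (∑ j ∈ Finset.range r, (p j + 1) + twist s (shiftWord r p)) =
    twist (r + s + t) p + 2 * (r + t + ∑ j ∈ Finset.range r, p j) := by
  set q := ∑ j ∈ Finset.range s, p (r + j) + 2 - s with hq
  have e1 : twist r (insertWord p r s q) = twist r p :=
    twist_congr fun j hj => by simp [insertWord, hj]
  have e2 : ∑ j ∈ Finset.range r, insertWord p r s q j = ∑ j ∈ Finset.range r, p j :=
    Finset.sum_congr rfl fun j hj => by simp [insertWord, Finset.mem_range.1 hj]
  have e3 : twist t (shiftWord (r + 1) (insertWord p r s q)) = twist t (shiftWord (r + s) p) :=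
    twist_congr fun j _ => by
      rw [shiftWord_apply, shiftWord_apply, insertWord, if_neg (by omega), if_neg (by omega)]
      congr 1
      omega
  have e4 : ∀ x : ℕ → ℤ, twist 1 x = 0 := fun x => by simp [twist]
  have e5 : ∑ j ∈ Finset.range s, p (r + j) = q - 2 + s := by rw [hq]; ring
  rw [twist_add (r + 1) t, twist_add r 1, Finset.sum_range_add, e1, e2, e3, e4, twist_add (r + s),
    twist_add r s, Finset.sum_range_add, e5, Finset.sum_add_distrib]
  simp only [Finset.sum_range_one, insertWord, lt_self_iff_false, if_false, add_zero, if_true,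
    Finset.sum_const, Finset.card_range, nsmul_eq_mul]
  push_cast
  ring

namespace PoincareDGCA

variable {K : Type u} [Field K] {n : ℕ} {A : PoincareDGCA K n}

namespace HodgeHomotopy

variable (h : A.HodgeHomotopy)

/-- Insertion of the sign `(-1)^{∑_j (k - 1 - j) p_j}` into a multilinear map on `A`, restricted to
harmonic elements. -/
def unsuspend {k : ℕ} (G : MultilinearMap K (fun _ : Fin k => A.carrier) A.carrier) :
    MultilinearMap K (fun _ : Fin k => h.harmonic) A.carrier :=
  G.compLinearMap fun i => (A.eps ^ (k - 1 - (i : ℕ))) ∘ₗ h.harmonic.subtype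

lemma eps_pow_of_mem (m : ℕ) {k : ℤ} {a : A.carrier} (ha : a ∈ A.gr k) :
    (A.eps ^ m) a = sgn K (m * k) • a := by
  induction m with
  | zero => simp
  | succ m ih =>
    rw [pow_succ', Module.End.mul_apply, ih, map_smul, A.eps_of_mem ha, smul_smul, ← sgn_add]
    congr 2
    push_cast
    ring

lemma unsuspend_apply {k : ℕ} (G : MultilinearMap K (fun _ : Fin k => A.carrier) A.carrier)
    {p : ℕ → ℤ} {v : ℕ → h.harmonic} (hv : ∀ j < k, v j ∈ h.harmonicGr (p j)) :
    h.unsuspend G (fun i => v i) = sgn K (twist k p) • G (fun i => (v i : A.carrier)) := by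
  have : (fun i : Fin k => ((A.eps ^ (k - 1 - (i : ℕ))) ∘ₗ h.harmonic.subtype) (v i)) =
      fun i : Fin k => sgn K (((k : ℤ) - 1 - (i : ℕ)) * p i) • (v i : A.carrier) := by
    funext i
    have hi : (v i : A.carrier) ∈ A.gr (p i) := hv i i.2
    rw [LinearMap.comp_apply, Submodule.subtype_apply, eps_pow_of_mem _ hi]
    congr 3
    have := i.2
    omega
  rw [unsuspend, MultilinearMap.compLinearMap_apply, this, MultilinearMap.map_smul_univ, twist,
    sgn_sum, Finset.prod_range]

/-- The transferred operations `m_k`. -/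
def transferOp (k : ℕ) : MultilinearMap K (fun _ : Fin k => h.harmonic) h.harmonic :=
  h.toHarmonic.compMultilinearMap (h.unsuspend (h.prodPhiMulti k))

/-- The components `f_k` of the transferred morphism. -/
def transferMor (k : ℕ) : MultilinearMap K (fun _ : Fin k => h.harmonic) A.carrier :=
  h.unsuspend (h.phiMulti k)

lemma transferMor_apply {k : ℕ} {p : ℕ → ℤ} {v : ℕ → h.harmonic}
    (hv : ∀ j < k, v j ∈ h.harmonicGr (p j)) :
    h.transferMor k (fun i => v i) = sgn K (twist k p) • h.phi k (fun j => v j) := by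
  rw [transferMor, h.unsuspend_apply _ hv]
  exact congrArg _ (h.phiMulti_apply k fun j => (v j : A.carrier))

lemma coe_transferOp_apply {k : ℕ} {p : ℕ → ℤ} {v : ℕ → h.harmonic}
    (hv : ∀ j < k, v j ∈ h.harmonicGr (p j)) :
    (h.transferOp k (fun i => v i) : A.carrier) = sgn K (twist k p) • h.mu k (fun j => v j) := by
  rw [transferOp, LinearMap.compMultilinearMap_apply, h.unsuspend_apply _ hv, map_smul,
    Submodule.coe_smul, coe_toHarmonic]
  exact congrArg _ (congrArg _ (h.prodPhiMulti_apply k fun j => (v j : A.carrier)))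

lemma transferOp_eq_zero_of_prodPhi {k : ℕ} (hk : ∀ v, h.prodPhi k v = 0) :
    h.transferOp k = 0 := by
  ext w
  simp [transferOp, unsuspend, prodPhiMulti, multilinearOfWord, hk]

lemma transferOp_zero : h.transferOp 0 = 0 :=
  h.transferOp_eq_zero_of_prodPhi fun v => h.prodPhi_zero v

lemma transferOp_one : h.transferOp 1 = 0 :=
  h.transferOp_eq_zero_of_prodPhi fun v => h.prodPhi_one v

lemma mu_mem {k : ℕ} {p : ℕ → ℤ} {v : ℕ → A.carrier} (hv : ∀ j < k, v j ∈ A.gr (p j)) :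
    h.mu k v ∈ A.gr (∑ j ∈ Finset.range k, p j + 2 - k) :=
  h.piH_mem (h.prodPhi_mem k hv)

lemma transferOp_mem {k : ℕ} {p : ℕ → ℤ} {v : ℕ → h.harmonic}
    (hv : ∀ j < k, v j ∈ h.harmonicGr (p j)) :
    h.transferOp k (fun i => v i) ∈ h.harmonicGr (∑ j ∈ Finset.range k, p j + 2 - k) := by
  change (h.transferOp k (fun i => v i) : A.carrier) ∈ A.gr _
  rw [h.coe_transferOp_apply hv]
  exact Submodule.smul_mem _ _ (h.mu_mem hv)

/-- The insertion sums of unsuspended operations are the compositions with the suspended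
coderivation. -/
lemma insertionSum_transferOp
    (g : ∀ k : ℕ, MultilinearMap K (fun _ : Fin k => h.harmonic) A.carrier)
    (G : ℕ → (ℕ → A.carrier) → A.carrier)
    (hG : ∀ (k : ℕ) (c : ℕ → K) (v : ℕ → A.carrier),
      G k (fun j => c j • v j) = (∏ j ∈ Finset.range k, c j) • G k v)
    (hg : ∀ (k : ℕ) (p : ℕ → ℤ) (v : ℕ → h.harmonic), (∀ j < k, v j ∈ h.harmonicGr (p j)) →
      g k (fun i => v i) = sgn K (twist k p) • G k (fun j => v j))
    (N : ℕ) (p : ℕ → ℤ) (v : ℕ → h.harmonic) (hv : ∀ j, v j ∈ h.harmonicGr (p j)) :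
    insertionSum g h.transferOp N p v =
      sgn K (twist N p) • h.compMu G N (fun j => v j) := by
  rcases Nat.eq_zero_or_pos N with rfl | hN
  · simp [insertionSum, compMu]
  have h1 : Finset.Icc 1 N = insert 1 (Finset.Icc 2 N) := by
    ext s; simp only [Finset.mem_Icc, Finset.mem_insert]; omega
  rw [insertionSum, h1, Finset.sum_insert (by simp)]
  have hz : ∀ r ∈ Finset.range (N - 1 + 1),
      ((r : ℤ) + (1 : ℕ) * ((N : ℤ) - r - (1 : ℕ)) +
        (1 : ℕ) * ∑ j ∈ Finset.range r, p j).negOnePow •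
        g (N - 1 + 1) (fun j => insertWord v r 1 (h.transferOp 1 (fun i => v (r + i))) j) = 0 := by
    intro r hr
    rw [transferOp_one, (g (N - 1 + 1)).map_coord_zero (⟨r, Finset.mem_range.1 hr⟩)]
    · simp
    · simp [insertWord]
  rw [Finset.sum_eq_zero hz, zero_add, compMu, Finset.smul_sum]
  refine Finset.sum_congr rfl fun s hs => ?_
  rw [Finset.smul_sum]
  refine Finset.sum_congr rfl fun r hr => ?_
  rw [Finset.mem_Icc] at hs
  rw [Finset.mem_range] at hr
  obtain ⟨t, rfl⟩ : ∃ t, N = r + s + t := ⟨N - r - s, by omega⟩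
  have hN' : r + s + t - s + 1 = r + 1 + t := by omega
  set x : h.harmonic := h.transferOp s (fun i => v (r + i)) with hx
  set q : ℤ := ∑ j ∈ Finset.range s, p (r + j) + 2 - s with hq
  have hshift : ∀ j < s, shiftWord r v j ∈ h.harmonicGr (shiftWord r p j) := fun j _ => hv _
  have hx' : x = h.transferOp s (fun i => shiftWord r v i) := by
    simp only [hx, shiftWord, add_comm]
  have hxq : x ∈ h.harmonicGr q := by
    rw [hx', hq]
    have := h.transferOp_mem hshift
    simpa only [shiftWord, add_comm] using this
  have hw : ∀ j < r + 1 + t, insertWord v r s x j ∈ h.harmonicGr (insertWord p r s q j) := by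
    intro j _
    unfold insertWord
    split_ifs
    · exact hv j
    · exact hxq
    · exact hv _
  have hxmu : (x : A.carrier) =
      sgn K (twist s (shiftWord r p)) • h.mu s (shiftWord r fun j => (v j : A.carrier)) := by
    rw [hx', h.coe_transferOp_apply hshift]
    rfl
  have hword : (fun j => ((insertWord v r s x j : h.harmonic) : A.carrier)) = fun j =>
      (if j < r then sgn K (p j + 1) else if j = r then sgn K (twist s (shiftWord r p)) else 1) •
        h.muWord r s (fun j => (v j : A.carrier)) j := by
    funext j
    simp only [insertWord, muWord, signWord]
    by_cases h1 : j < r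
    · have : A.eps (v j) = sgn K (p j) • (v j : A.carrier) := A.eps_of_mem (hv j)
      simp [h1, this, sgn_add, smul_smul]
    · by_cases h2 : j = r
      · subst h2
        simpa using hxmu
      · have h3 : ¬ (j + s - 1 < r) := by omega
        simp [h1, h2, h3]
  have hprod : ∏ j ∈ Finset.range (r + 1 + t),
      (if j < r then sgn K (p j + 1) else if j = r then sgn K (twist s (shiftWord r p)) else 1) =
      sgn K (∑ j ∈ Finset.range r, (p j + 1) + twist s (shiftWord r p)) := by
    rw [Finset.prod_range_add, Finset.prod_range_add, sgn_add, sgn_sum,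
      Finset.prod_congr rfl (g := fun j => sgn K (p j + 1))
        (fun j hj => by rw [if_pos (Finset.mem_range.1 hj)]),
      Finset.prod_eq_one (s := Finset.range t) (fun j _ => by
        rw [if_neg (by omega), if_neg (by omega)])]
    simp
  rw [hN', hg _ _ _ hw, hword, hG, hprod, smul_smul, negOnePow_smul_eq (K := K), smul_smul,
    ← sgn_add, ← sgn_add]
  congr 1
  refine sgn_congr (r + t + ∑ j ∈ Finset.range r, p j) ?_
  rw [← twist_insertWord, ← hq]
  push_cast
  ring

lemma transferOp_relation (N : ℕ) (p : ℕ → ℤ) (v : ℕ → h.harmonic)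
    (hv : ∀ j, v j ∈ h.harmonicGr (p j)) :
    insertionSum h.transferOp h.transferOp N p v = 0 := by
  have e : ((insertionSum h.transferOp h.transferOp N p v : h.harmonic) : A.carrier) =
      insertionSum (fun k => h.harmonic.subtype.compMultilinearMap (h.transferOp k))
        h.transferOp N p v := by
    simp only [insertionSum, AddSubmonoidClass.coe_finsetSum, negOnePow_smul_eq (K := K),
      Submodule.coe_smul]
    rfl
  rw [← Submodule.coe_eq_zero, e, h.insertionSum_transferOp _ h.mu, h.compMu_mu, smul_zero]
  · exact fun j => (v j).2
  · intro k c v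
    simp [mu, prodPhi_smul]
  · intro k p v hv
    exact h.coe_transferOp_apply hv
  · exact hv

/-- `m̂_k` is the product of `ε φ` and `φ`, up to the sign of the suspension. -/
lemma mhat_eq (k : ℕ) : ∀ (p : ℕ → ℤ) (a : ℕ → A.carrier), (∀ j, a j ∈ A.gr (p j)) →
    h.mhat k p a = sgn K (twist k p) • h.prodPhi k a := by
  induction k using Nat.strong_induction_on with
  | _ k ih =>
    intro p a ha
    rcases (by omega : k = 0 ∨ k = 1 ∨ k = 2 ∨ 3 ≤ k) with rfl | rfl | rfl | hk
    · rw [mhat]; simp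
    · rw [mhat]; simp
    · rw [mhat, prodPhi_two, A.eps_of_mem (ha 0), smul_mul_assoc, smul_smul]
      simp [twist, Finset.sum_range_succ]
    obtain ⟨k, rfl⟩ := Nat.exists_eq_add_of_le' hk
    have hphi : ∀ i, i + 2 < k + 3 → ∀ (p : ℕ → ℤ) (a : ℕ → A.carrier), (∀ j, a j ∈ A.gr (p j)) →
        h.dm (h.mhat (i + 2) p a) = - sgn K (twist (i + 2) p) • h.phi (i + 2) a := by
      intro i hi p a ha
      rw [ih _ hi p a ha, map_smul, h.phi_of_two_le (by omega)]
      simp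
    have heps : ∀ i, A.eps (h.phi i a) =
        sgn K (∑ j ∈ Finset.range i, p j + 1 - i) • h.phi i a := fun i =>
      A.eps_of_mem (h.phi_mem i fun j _ => ha j)
    have hsh : ∀ i j, shiftWord i a j ∈ A.gr (shiftWord i p j) := fun i j => ha _
    rw [mhat, prodPhi, Finset.sum_range_succ, Finset.sum_range_succ, Finset.sum_range_succ',
      Finset.sum_range_succ']
    simp only [Nat.sub_self, phi_zero, mul_zero, add_zero, map_zero, zero_mul, zero_add]
    rw [hphi k (by omega) p a ha]
    erw [hphi k (by omega) (shiftWord 1 p) (shiftWord 1 a) (hsh 1)]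
    have e1 : h.phi (k + 3 - (k + 2)) (shiftWord (k + 2) a) = a (k + 2) := by
      rw [(by omega : k + 3 - (k + 2) = 1), phi_one]; simp [shiftWord]
    have e2 : k + 3 - 1 = k + 2 := by omega
    rw [e1, e2, heps (k + 2), heps 1, phi_one, smul_add, smul_add, Finset.smul_sum,
      Finset.sum_range]
    have t1 : twist (k + 3) p = twist (k + 2) p + ∑ j ∈ Finset.range (k + 2), p j := by
      have := twist_add (k + 2) 1 p
      rw [this]; simp [twist]
    have t2 : twist (k + 3) p = (k + 2) * p 0 + twist (k + 2) (shiftWord 1 p) := by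
      have := twist_add 1 (k + 2) p
      rw [add_comm 1] at this
      rw [this]; simp [twist]
    have f1 : sgn K ((k : ℤ) + 2) * sgn K (twist (k + 2) p) =
        - (sgn K (twist (k + 3) p) *
          sgn K (∑ j ∈ Finset.range (k + 2), p j + 1 - ((k + 2 : ℕ) : ℤ))) := by
      rw [← neg_one_mul, ← sgn_one, ← sgn_add, ← sgn_add, ← sgn_add, t1]
      refine sgn_congr (k + 1 - ∑ j ∈ Finset.range (k + 2), p j) ?_
      push_cast; ring
    have f2 : sgn K (((k : ℤ) + 3) * p 0) * sgn K (twist (k + 2) (shiftWord 1 p)) =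
        sgn K (twist (k + 3) p) *
          sgn K (∑ j ∈ Finset.range 1, p j + 1 - ((1 : ℕ) : ℤ)) := by
      rw [← sgn_add, ← sgn_add, t2]
      refine sgn_congr 0 ?_
      simp only [Finset.sum_range_one]
      push_cast; ring
    have f3 : ∀ i : Fin k,
        (((i : ℕ) : ℤ) + 2 + ((k : ℤ) - (i : ℕ)) *
              ∑ j ∈ Finset.range (i + 2), p j).negOnePow •
            (h.dm (h.mhat (i + 2) p a) *
              h.dm (h.mhat (k + 1 - i) (fun j => p (j + (i + 2))) (fun j => a (j + (i + 2))))) =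
          - sgn K (twist (k + 3) p) • (A.eps (h.phi (↑i + 1 + 1) a) *
              h.phi (k + 3 - (↑i + 1 + 1)) (shiftWord (↑i + 1 + 1) a)) := by
      intro i
      obtain ⟨i, hi⟩ := i
      obtain ⟨l, rfl⟩ : ∃ l, k = i + 1 + l := ⟨k - i - 1, by omega⟩
      simp only
      have g1 : i + 1 + l + 1 - i = l + 2 := by omega
      have g2 : i + 1 + l + 3 - (i + 1 + 1) = l + 2 := by omega
      rw [g1, g2, hphi i (by omega) p a ha]
      erw [hphi l (by omega) (shiftWord (i + 2) p) (shiftWord (i + 2) a) (hsh (i + 2))]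
      rw [heps, negOnePow_smul_eq (K := K), smul_mul_smul_comm, smul_smul, smul_mul_assoc,
        smul_smul]
      congr 1
      have t3 := twist_add (i + 2) (l + 2) p
      rw [(by omega : i + 1 + l + 3 = i + 2 + (l + 2)), t3, neg_mul_neg, neg_mul,
        ← neg_one_mul (sgn K _ * _), ← sgn_one, ← sgn_add, ← sgn_add, ← sgn_add, ← sgn_add]
      refine sgn_congr (i + 1 - (∑ j ∈ Finset.range (i + 2), p j)) ?_
      push_cast
      ring
    simp only [f3]
    simp only [smul_mul_assoc, negOnePow_smul_eq (K := K), mul_smul_comm, mul_neg, neg_mul,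
      neg_smul, smul_neg, Finset.sum_neg_distrib, smul_smul, f1, f2]
    abel

end HodgeHomotopy

end PoincareDGCA

/-! ### Shuffle sums of words -/

section Shuffle

variable {K V W : Type*} [Field K] [AddCommGroup W] [Module K W]

/-- The degree of a word of homogeneous letters `(p, x)`, for the suspended grading, in which a
letter `(p, x)` has degree `p - 1`. -/
def susDeg (l : List (ℤ × V)) : ℤ := (l.map fun x => x.1 - 1).sum

@[simp] lemma susDeg_nil : susDeg ([] : List (ℤ × V)) = 0 := rfl

@[simp] lemma susDeg_cons (x : ℤ × V) (l : List (ℤ × V)) :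
    susDeg (x :: l) = x.1 - 1 + susDeg l := by simp [susDeg]

lemma susDeg_take_add_drop (i : ℕ) (l : List (ℤ × V)) :
    susDeg (l.take i) + susDeg (l.drop i) = susDeg l := by
  rw [susDeg, susDeg, susDeg, ← List.sum_append, ← List.map_append, List.take_append_drop]

/-- The sum of the values of `F` on the shuffles of two words of homogeneous letters, with the
Koszul signs of the suspended grading. -/
def shuffleSum (K : Type*) {V W : Type*} [Field K] [AddCommGroup W] [Module K W]
    (F : List (ℤ × V) → W) : List (ℤ × V) → List (ℤ × V) → W
  | [], v => F v
  | x :: u, [] => F (x :: u)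
  | x :: u, y :: v =>
    shuffleSum K (fun w => F (x :: w)) u (y :: v) +
      sgn K ((y.1 - 1) * susDeg (x :: u)) • shuffleSum K (fun w => F (y :: w)) (x :: u) v
  termination_by u v => u.length + v.length

@[simp] lemma shuffleSum_nil_left (F : List (ℤ × V) → W) (v : List (ℤ × V)) :
    shuffleSum K F [] v = F v := by rw [shuffleSum]

@[simp] lemma shuffleSum_nil_right (F : List (ℤ × V) → W) (u : List (ℤ × V)) :
    shuffleSum K F u [] = F u := by cases u <;> rw [shuffleSum]

lemma shuffleSum_cons_cons (F : List (ℤ × V) → W) (x y : ℤ × V) (u v : List (ℤ × V)) :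
    shuffleSum K F (x :: u) (y :: v) = shuffleSum K (fun w => F (x :: w)) u (y :: v) +
      sgn K ((y.1 - 1) * susDeg (x :: u)) • shuffleSum K (fun w => F (y :: w)) (x :: u) v := by
  rw [shuffleSum]

/-- Induction on pairs of words. -/
lemma shuffle_induction {V W : Type*} {P : (List (ℤ × V) → W) → List (ℤ × V) → List (ℤ × V) → Prop}
    (hl : ∀ F v, P F [] v) (hr : ∀ F u, P F u [])
    (hs : ∀ F x u y v, P (fun w => F (x :: w)) u (y :: v) → P (fun w => F (y :: w)) (x :: u) v →
      P F (x :: u) (y :: v)) : ∀ F u v, P F u v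
  | F, [], v => hl F v
  | F, x :: u, [] => hr F (x :: u)
  | F, x :: u, y :: v => hs F x u y v (shuffle_induction hl hr hs _ u (y :: v))
      (shuffle_induction hl hr hs _ (x :: u) v)
  termination_by _ u v => u.length + v.length

lemma shuffleSum_congr (F : List (ℤ × V) → W) (u v : List (ℤ × V)) : ∀ (G : List (ℤ × V) → W),
    (∀ w, w.length = u.length + v.length → F w = G w) →
      shuffleSum K F u v = shuffleSum K G u v := by
  induction F, u, v using shuffle_induction with
  | hl F v => intro G hG; simpa using hG v
  | hr F u => intro G hG; simpa using hG u
  | hs F x u y v h1 h2 =>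
    intro G hG
    rw [shuffleSum_cons_cons, shuffleSum_cons_cons, h1 fun w => G (x :: w), h2 fun w => G (y :: w)]
    · intro w hw
      exact hG _ (by simp only [List.length_cons] at hw ⊢; omega)
    · intro w hw
      exact hG _ (by simp only [List.length_cons] at hw ⊢; omega)

lemma shuffleSum_map {W' : Type*} [AddCommGroup W'] [Module K W'] (T : W →ₗ[K] W')
    (F : List (ℤ × V) → W) (u v : List (ℤ × V)) :
    shuffleSum K (fun w => T (F w)) u v = T (shuffleSum K F u v) := by
  induction F, u, v using shuffle_induction with
  | hl F v => simp
  | hr F u => simp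
  | hs F x u y v h1 h2 => simp [shuffleSum_cons_cons, h1, h2]

lemma shuffleSum_add (F : List (ℤ × V) → W) (u v : List (ℤ × V)) : ∀ (G : List (ℤ × V) → W),
    shuffleSum K (fun w => F w + G w) u v = shuffleSum K F u v + shuffleSum K G u v := by
  induction F, u, v using shuffle_induction with
  | hl F v => simp
  | hr F u => simp
  | hs F x u y v h1 h2 =>
    intro G
    simp only [shuffleSum_cons_cons, h1, h2, smul_add]
    abel

/-- The convolution of two functions of words, by deconcatenation. -/
def wordConv {R : Type*} [Ring R] (G H : List (ℤ × V) → R) (w : List (ℤ × V)) : R :=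
  ∑ i ∈ Finset.range (w.length + 1), G (w.take i) * H (w.drop i)

lemma wordConv_cons {R : Type*} [Ring R] (G H : List (ℤ × V) → R) (x : ℤ × V)
    (w : List (ℤ × V)) :
    wordConv G H (x :: w) = G [] * H (x :: w) + wordConv (fun w => G (x :: w)) H w := by
  rw [wordConv, List.length_cons, Finset.sum_range_succ']
  simp [wordConv, add_comm]

/-- Deconcatenation is multiplicative for the shuffle product. -/
lemma shuffleSum_wordConv {R : Type*} [Ring R] [Algebra K R] (G : List (ℤ × V) → R)
    (u v : List (ℤ × V)) : ∀ (H : List (ℤ × V) → R), shuffleSum K (wordConv G H) u v =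
      ∑ i ∈ Finset.range (u.length + 1), ∑ j ∈ Finset.range (v.length + 1),
        sgn K (susDeg (u.drop i) * susDeg (v.take j)) •
          (shuffleSum K G (u.take i) (v.take j) * shuffleSum K H (u.drop i) (v.drop j)) := by
  induction G, u, v using shuffle_induction with
  | hl G v => intro H; simp [wordConv]
  | hr G u => intro H; simp [wordConv]
  | hs G x u y v h1 h2 =>
    intro H
    have e1 : ∀ z w, wordConv G H (z :: w) =
      LinearMap.mulLeft K (G []) (H (z :: w)) + wordConv (fun w => G (z :: w)) H w :=
      fun z w => wordConv_cons G H z w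
    rw [shuffleSum_cons_cons]
    simp only [e1]
    rw [shuffleSum_add, shuffleSum_add, shuffleSum_map, shuffleSum_map, h1, h2]
    have hR : ∀ i j, sgn K (susDeg ((x :: u).drop (i + 1)) * susDeg ((y :: v).take (j + 1))) •
        (shuffleSum K G ((x :: u).take (i + 1)) ((y :: v).take (j + 1)) *
          shuffleSum K H ((x :: u).drop (i + 1)) ((y :: v).drop (j + 1))) =
        sgn K (susDeg (u.drop i) * susDeg ((y :: v).take (j + 1))) •
          (shuffleSum K (fun w => G (x :: w)) (u.take i) ((y :: v).take (j + 1)) *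
            shuffleSum K H (u.drop i) ((y :: v).drop (j + 1))) +
        sgn K ((y.1 - 1) * susDeg (x :: u)) • sgn K (susDeg ((x :: u).drop (i + 1)) *
            susDeg (v.take j)) •
          (shuffleSum K (fun w => G (y :: w)) ((x :: u).take (i + 1)) (v.take j) *
            shuffleSum K H ((x :: u).drop (i + 1)) (v.drop j)) := by
      intro i j
      simp only [List.take_succ_cons, List.drop_succ_cons]
      rw [shuffleSum_cons_cons, add_mul, smul_add, smul_mul_assoc, smul_smul, smul_smul, ← sgn_add,
        ← sgn_add]
      congr 3
      simp only [susDeg_cons, ← susDeg_take_add_drop i u]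
      ring
    have hL : ∀ j, sgn K (susDeg ((x :: u).drop 0) * susDeg ((y :: v).take (j + 1))) •
        (shuffleSum K G ((x :: u).take 0) ((y :: v).take (j + 1)) *
          shuffleSum K H ((x :: u).drop 0) ((y :: v).drop (j + 1))) =
        sgn K ((y.1 - 1) * susDeg (x :: u)) • sgn K (susDeg ((x :: u).drop 0) *
            susDeg (v.take j)) •
          (shuffleSum K (fun w => G (y :: w)) ((x :: u).take 0) (v.take j) *
            shuffleSum K H ((x :: u).drop 0) (v.drop j)) := by
      intro j
      simp only [List.take_succ_cons, List.drop_succ_cons, List.take_zero, List.drop_zero,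
        shuffleSum_nil_left]
      rw [smul_smul, ← sgn_add]
      congr 2
      simp only [susDeg_cons]
      ring
    have hB : ∀ i, sgn K (susDeg ((x :: u).drop (i + 1)) * susDeg ((y :: v).take 0)) •
        (shuffleSum K G ((x :: u).take (i + 1)) ((y :: v).take 0) *
          shuffleSum K H ((x :: u).drop (i + 1)) ((y :: v).drop 0)) =
        sgn K (susDeg (u.drop i) * susDeg ((y :: v).take 0)) •
          (shuffleSum K (fun w => G (x :: w)) (u.take i) ((y :: v).take 0) *
            shuffleSum K H (u.drop i) ((y :: v).drop 0)) := by
      intro i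
      simp
    simp only [List.length_cons]
    have hsucc : ∀ (m : ℕ) (f : ℕ → R), ∑ j ∈ Finset.range (m + 1 + 1), f j =
        ∑ j ∈ Finset.range (m + 1), f (j + 1) + f 0 :=
      fun m f => Finset.sum_range_succ' f _
    simp only [hsucc, hR, hL, hB]
    have e0 : sgn K (susDeg ((x :: u).drop 0) * susDeg ((y :: v).take 0)) •
        (shuffleSum K G ((x :: u).take 0) ((y :: v).take 0) *
          shuffleSum K H ((x :: u).drop 0) ((y :: v).drop 0)) =
        G [] * shuffleSum K (fun w => H (x :: w)) u (y :: v) +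
          sgn K ((y.1 - 1) * susDeg (x :: u)) •
            (G [] * shuffleSum K (fun w => H (y :: w)) (x :: u) v) := by
      simp only [List.take_zero, List.drop_zero, susDeg_nil, mul_zero, sgn_zero, one_smul,
        shuffleSum_nil_left]
      rw [shuffleSum_cons_cons, mul_add, mul_smul_comm]
    rw [e0]
    simp only [Finset.sum_add_distrib, Finset.smul_sum, smul_add, LinearMap.mulLeft_apply]
    abel

end Shuffle

namespace PoincareDGCA

variable {K : Type u} [Field K] {n : ℕ} {A : PoincareDGCA K n}

namespace HodgeHomotopy

variable (h : A.HodgeHomotopy)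

/-- The infinite word with the letters of `l`, continued by zeros. -/
def wordOfList (l : List (ℤ × A.carrier)) : ℕ → A.carrier := fun j => (l.map Prod.snd).getD j 0

/-- `φ` as a function of lists of letters. -/
def phiList (l : List (ℤ × A.carrier)) : A.carrier := h.phi l.length (wordOfList l)

lemma prodPhi_wordOfList (l : List (ℤ × A.carrier)) :
    h.prodPhi l.length (wordOfList l) =
      wordConv (fun w => A.eps (h.phiList w)) h.phiList l := by
  refine Finset.sum_congr rfl fun i hi => ?_
  rw [Finset.mem_range] at hi
  have e1 : (l.take i).length = i := by rw [List.length_take]; omega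
  have e2 : shiftWord i (wordOfList l) = wordOfList (l.drop i) := by
    funext j
    simp [shiftWord, wordOfList, List.getD_eq_getElem?_getD, add_comm]
  have e3 : h.phi i (wordOfList l) = h.phi i (wordOfList (l.take i)) := by
    refine h.phi_congr i fun j hj => ?_
    simp [wordOfList, List.getD_eq_getElem?_getD, hj]
  change _ = A.eps (h.phi (l.take i).length _) * h.phi (l.drop i).length _
  rw [e1, List.length_drop, e2, e3]

lemma sum_range_wordOfList (l : List (ℤ × A.carrier)) :
    ∑ j ∈ Finset.range l.length, (l.map Prod.fst).getD j 0 - l.length = susDeg l := by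
  induction l with
  | nil => simp
  | cons x l ih =>
    rw [List.length_cons, Finset.sum_range_succ', susDeg_cons, ← ih]
    simp
    ring

lemma phiList_mem {l : List (ℤ × A.carrier)} (hl : ∀ x ∈ l, x.2 ∈ A.gr x.1) :
    h.phiList l ∈ A.gr (susDeg l + 1) := by
  have := h.phi_mem l.length (p := fun j => (l.map Prod.fst).getD j 0) (v := wordOfList l) ?_
  · change h.phi _ _ ∈ _
    convert this using 2
    rw [← sum_range_wordOfList]
    ring
  · intro j hj
    simp only [wordOfList, List.getD_eq_getElem?_getD, List.getElem?_map,
      List.getElem?_eq_getElem hj, Option.map_some, Option.getD_some]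
    exact hl _ (List.getElem_mem hj)

/-- The product of `ε φ` and `φ` vanishes on shuffles if `φ` does so on shorter shuffles: only the
two cuts which separate the shuffled words contribute, and they cancel by graded commutativity. -/
lemma shuffleSum_wordConv_phiList {u v : List (ℤ × A.carrier)} (hu : u ≠ []) (hv : v ≠ [])
    (hu' : ∀ x ∈ u, x.2 ∈ A.gr x.1) (hv' : ∀ x ∈ v, x.2 ∈ A.gr x.1)
    (ih : ∀ u' v' : List (ℤ × A.carrier), u' ≠ [] → v' ≠ [] → (∀ x ∈ u', x.2 ∈ A.gr x.1) →
      (∀ x ∈ v', x.2 ∈ A.gr x.1) → u'.length + v'.length < u.length + v.length →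
      shuffleSum K h.phiList u' v' = 0) :
    shuffleSum K (wordConv (fun w => A.eps (h.phiList w)) h.phiList) u v = 0 := by
  have hul := List.length_pos_iff.2 hu
  have hvl := List.length_pos_iff.2 hv
  have hnil : h.phiList [] = 0 := by simp [phiList]
  rw [shuffleSum_wordConv]
  simp only [shuffleSum_map]
  have htake : ∀ (l : List (ℤ × A.carrier)) (i : ℕ), l ≠ [] → 1 ≤ i → l.take i ≠ [] := by
    intro l i hl hi e
    rw [List.take_eq_nil_iff] at e
    rcases e with e | e
    · omega
    · exact hl e
  have hdrop : ∀ (l : List (ℤ × A.carrier)) (i : ℕ), i < l.length → l.drop i ≠ [] := by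
    intro l i hi e
    rw [List.drop_eq_nil_iff] at e
    omega
  -- a cut contributes only if each of its two parts involves only one of the two words
  have key1 : ∀ i j, i ≤ u.length → j ≤ v.length → 1 ≤ i → 1 ≤ j →
      A.eps (shuffleSum K h.phiList (u.take i) (v.take j)) *
        shuffleSum K h.phiList (u.drop i) (v.drop j) = 0 := by
    intro i j hi hj hi1 hj1
    by_cases hij : i = u.length ∧ j = v.length
    · rw [hij.1, hij.2]; simp [hnil]
    · rw [ih _ _ (htake u i hu hi1) (htake v j hv hj1)
        (fun x hx => hu' x (List.mem_of_mem_take hx)) (fun x hx => hv' x (List.mem_of_mem_take hx))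
        (by rw [List.length_take, List.length_take]; omega)]
      simp
  have key2 : ∀ i j, i ≤ u.length → j ≤ v.length → i < u.length → j < v.length →
      A.eps (shuffleSum K h.phiList (u.take i) (v.take j)) *
        shuffleSum K h.phiList (u.drop i) (v.drop j) = 0 := by
    intro i j hi hj hi1 hj1
    by_cases hij : i = 0 ∧ j = 0
    · rw [hij.1, hij.2]; simp [hnil]
    · rw [ih _ _ (hdrop u i hi1) (hdrop v j hj1)
        (fun x hx => hu' x (List.mem_of_mem_drop hx)) (fun x hx => hv' x (List.mem_of_mem_drop hx))
        (by rw [List.length_drop, List.length_drop]; omega)]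
      simp
  rw [Finset.sum_eq_add_of_mem 0 u.length (by simp) (by simp) (by omega)]
  · rw [Finset.sum_eq_single_of_mem v.length (by simp), Finset.sum_eq_single_of_mem 0 (by simp)]
    · simp only [List.drop_zero, List.take_length, List.take_zero, List.drop_length,
        shuffleSum_nil_left, shuffleSum_nil_right, susDeg_nil, mul_zero, sgn_zero, one_smul]
      have m1 := h.phiList_mem hu'
      have m2 := h.phiList_mem hv'
      rw [A.eps_of_mem m1, A.eps_of_mem m2, smul_mul_assoc, smul_mul_assoc,
        A.mul_comm_of_mem m2 m1, smul_smul, smul_smul, ← sgn_add, ← sgn_add, ← add_smul]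
      convert zero_smul K _
      have : sgn K (susDeg u * susDeg v + (susDeg v + 1) + (susDeg v + 1) * (susDeg u + 1)) =
          sgn K (susDeg u) :=
        sgn_congr (susDeg u * susDeg v + susDeg v + 1) (by ring)
      rw [← add_assoc] at *
      rw [this, sgn_add]
      simp
    · intro j hj hj0
      rw [Finset.mem_range] at hj
      rw [key1 _ _ le_rfl (by omega) (by omega) (by omega), smul_zero]
    · intro j hj hj0
      rw [Finset.mem_range] at hj
      rw [key2 _ _ (by omega) (by omega) (by omega) (by omega), smul_zero]
  · rintro i hi ⟨hi0, hi1⟩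
    rw [Finset.mem_range] at hi
    refine Finset.sum_eq_zero fun j hj => ?_
    rw [Finset.mem_range] at hj
    by_cases hj0 : j = 0
    · rw [key2 i j (by omega) (by omega) (by omega) (by omega), smul_zero]
    · rw [key1 i j (by omega) (by omega) (by omega) (by omega), smul_zero]

/-- `φ` vanishes on shuffles. -/
lemma shuffleSum_phiList (N : ℕ) : ∀ (u v : List (ℤ × A.carrier)), u.length + v.length = N →
    u ≠ [] → v ≠ [] → (∀ x ∈ u, x.2 ∈ A.gr x.1) → (∀ x ∈ v, x.2 ∈ A.gr x.1) →
    shuffleSum K h.phiList u v = 0 := by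
  induction N using Nat.strong_induction_on with
  | _ N ih =>
    intro u v hN hu hv hu' hv'
    have hul := List.length_pos_iff.2 hu
    have hvl := List.length_pos_iff.2 hv
    rw [shuffleSum_congr _ _ _ (fun w => (-h.dm)
        (wordConv (fun w => A.eps (h.phiList w)) h.phiList w)), shuffleSum_map,
      h.shuffleSum_wordConv_phiList hu hv hu' hv', map_zero]
    · intro u' v' h1 h2 h3 h4 h5
      exact ih _ (hN ▸ h5) u' v' rfl h1 h2 h3 h4
    · intro w hw
      rw [← prodPhi_wordOfList, phiList, h.phi_of_two_le (by omega)]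
      rfl

/-- The product of `ε φ` and `φ` vanishes on shuffles. -/
lemma shuffleSum_prodPhi {u v : List (ℤ × A.carrier)} (hu : u ≠ []) (hv : v ≠ [])
    (hu' : ∀ x ∈ u, x.2 ∈ A.gr x.1) (hv' : ∀ x ∈ v, x.2 ∈ A.gr x.1) :
    shuffleSum K (fun l => h.prodPhi l.length (wordOfList l)) u v = 0 := by
  simp only [prodPhi_wordOfList]
  exact h.shuffleSum_wordConv_phiList hu hv hu' hv'
    fun u' v' h1 h2 h3 h4 _ => h.shuffleSum_phiList _ u' v' rfl h1 h2 h3 h4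

end HodgeHomotopy

end PoincareDGCA

/-! ### Permutations and shuffles of words -/

section Perm

variable {K : Type*} [Field K]

/-- The permutation which sends `i` to `0` and is given by `σ` on the other places. -/
def permCons {m : ℕ} (i : Fin (m + 1)) (σ : Equiv.Perm (Fin m)) : Equiv.Perm (Fin (m + 1)) :=
  i.cycleRange.trans (Equiv.Perm.decomposeFin.symm (0, σ))

@[simp] lemma permCons_self {m : ℕ} (i : Fin (m + 1)) (σ : Equiv.Perm (Fin m)) :
    permCons i σ i = 0 := by
  simp [permCons]

@[simp] lemma permCons_succAbove {m : ℕ} (i : Fin (m + 1)) (σ : Equiv.Perm (Fin m)) (j : Fin m) :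
    permCons i σ (i.succAbove j) = (σ j).succ := by
  simp [permCons, Fin.cycleRange_succAbove]

@[simp] lemma permCons_symm_zero {m : ℕ} (i : Fin (m + 1)) (σ : Equiv.Perm (Fin m)) :
    (permCons i σ).symm 0 = i := by
  rw [Equiv.symm_apply_eq, permCons_self]

@[simp] lemma permCons_symm_succ {m : ℕ} (i : Fin (m + 1)) (σ : Equiv.Perm (Fin m)) (j : Fin m) :
    (permCons i σ).symm j.succ = i.succAbove (σ.symm j) := by
  rw [Equiv.symm_apply_eq, permCons_succAbove, Equiv.apply_symm_apply]

lemma permCons_bijective (m : ℕ) :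
    Function.Bijective fun x : Fin (m + 1) × Equiv.Perm (Fin m) => permCons x.1 x.2 := by
  rw [Fintype.bijective_iff_injective_and_card]
  constructor
  · rintro ⟨i, σ⟩ ⟨j, τ⟩ hστ
    simp only at hστ
    have hij : i = j := by
      rw [← permCons_symm_zero i σ, hστ, permCons_symm_zero]
    subst hij
    refine Prod.ext rfl (Equiv.ext fun k => ?_)
    have := congrArg (fun ρ : Equiv.Perm (Fin (m + 1)) => ρ (i.succAbove k)) hστ
    simpa using this
  · simp [Fintype.card_perm, Nat.factorial_succ]

lemma sum_perm_succ {M : Type*} [AddCommMonoid M] {m : ℕ} (T : Equiv.Perm (Fin (m + 1)) → M) :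
    ∑ σ, T σ = ∑ i : Fin (m + 1), ∑ σ : Equiv.Perm (Fin m), T (permCons i σ) := by
  rw [← (permCons_bijective m).sum_comp, Fintype.sum_prod_type]

lemma sign_permCons {m : ℕ} (i : Fin (m + 1)) (σ : Equiv.Perm (Fin m)) :
    Equiv.Perm.sign (permCons i σ) = (-1) ^ (i : ℕ) * Equiv.Perm.sign σ := by
  have : permCons i σ = Equiv.Perm.decomposeFin.symm (0, σ) * i.cycleRange := rfl
  rw [this, map_mul, Equiv.Perm.decomposeFin.symm_sign, Fin.sign_cycleRange]
  simp [mul_comm]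

/-- The Koszul sign as a scalar. -/
lemma cast_koszulSign {m : ℕ} (σ : Equiv.Perm (Fin m)) (d : Fin m → ℤ) :
    (((koszulSign σ d : ℤˣ) : ℤ) : K) =
      ∏ i : Fin m, ∏ j : Fin m, if i < j ∧ σ j < σ i then sgn K (d i * d j) else 1 := by
  simp only [koszulSign, Units.coe_prod, Int.cast_prod]
  refine Finset.prod_congr rfl fun i _ => Finset.prod_congr rfl fun j _ => ?_
  split_ifs <;> simp [sgn]

lemma cast_koszulSign_permCons {m : ℕ} (i : Fin (m + 1)) (σ : Equiv.Perm (Fin m))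
    (d : Fin (m + 1) → ℤ) :
    (((koszulSign (permCons i σ) d : ℤˣ) : ℤ) : K) =
      sgn K (∑ j : Fin m, if j.castSucc < i then d (i.succAbove j) * d i else 0) *
        (((koszulSign σ fun j => d (i.succAbove j) : ℤˣ) : ℤ) : K) := by
  rw [cast_koszulSign, cast_koszulSign, Fin.prod_univ_succAbove _ i]
  have e1 : ∏ j, (if i < j ∧ permCons i σ j < permCons i σ i then sgn K (d i * d j) else 1) = 1 :=
    Finset.prod_eq_one fun j _ => if_neg (by simp)
  rw [e1, one_mul, sgn_sum, ← Finset.prod_mul_distrib]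
  refine Finset.prod_congr rfl fun j _ => ?_
  rw [Fin.prod_univ_succAbove _ i]
  congr 1
  · simp only [permCons_self, permCons_succAbove, Fin.succ_pos, and_true,
      Fin.succAbove_lt_iff_castSucc_lt]
    split_ifs <;> simp
  · refine Finset.prod_congr rfl fun k _ => ?_
    simp only [permCons_succAbove, Fin.succAbove_lt_succAbove_iff, Fin.succ_lt_succ_iff]

/-- The exponent of the suspension sign, on finite words of degrees. -/
def twistFin {m : ℕ} (d : Fin m → ℤ) : ℤ := ∑ i : Fin m, ((m : ℤ) - 1 - (i : ℕ)) * d i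

lemma card_castSucc_lt {m : ℕ} (i : Fin (m + 1)) :
    (∑ j : Fin m, if j.castSucc < i then (1 : ℤ) else 0) = (i : ℕ) := by
  have e1 : (∑ j : Fin m, if j.castSucc < i then (1 : ℤ) else 0) =
      ∑ j ∈ Finset.range m, if j < (i : ℕ) then (1 : ℤ) else 0 := by
    rw [Finset.sum_range]
    simp [Fin.lt_def]
  have e2 : (Finset.range m).filter (fun j => j < (i : ℕ)) = Finset.range i := by
    ext j
    simp only [Finset.mem_filter, Finset.mem_range]
    omega
  rw [e1, Finset.sum_boole, e2, Finset.card_range]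

lemma twistFin_succAbove {m : ℕ} (i : Fin (m + 1)) (d : Fin (m + 1) → ℤ) :
    twistFin d = ((m : ℤ) - (i : ℕ)) * d i + twistFin (fun j => d (i.succAbove j)) +
      ∑ j : Fin m, if j.castSucc < i then d (i.succAbove j) else 0 := by
  rw [twistFin, Fin.sum_univ_succAbove _ i, twistFin, add_assoc, ← Finset.sum_add_distrib]
  congr 1
  · push_cast; ring
  · refine Finset.sum_congr rfl fun j _ => ?_
    split_ifs with hj
    · rw [Fin.succAbove_of_castSucc_lt _ _ hj]
      push_cast [Fin.val_castSucc]; ring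
    · rw [Fin.succAbove_of_le_castSucc _ _ (not_lt.1 hj)]
      push_cast [Fin.val_succ]; ring

lemma twistFin_comp_permCons {m : ℕ} (i : Fin (m + 1)) (σ : Equiv.Perm (Fin m))
    (d : Fin (m + 1) → ℤ) :
    twistFin (fun j => d ((permCons i σ).symm j)) =
      m * d i + twistFin (fun j => d (i.succAbove (σ.symm j))) := by
  rw [twistFin, Fin.sum_univ_succ, twistFin]
  simp only [permCons_symm_zero, permCons_symm_succ]
  congr 1
  · simp
  · refine Finset.sum_congr rfl fun j _ => ?_
    push_cast [Fin.val_succ]; ring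

/-- Suspension turns the product of the sign of a permutation and its Koszul sign into the Koszul
sign of the suspended degrees. -/
lemma sign_mul_koszulSign {m : ℕ} : ∀ (σ : Equiv.Perm (Fin m)) (d : Fin m → ℤ),
    (((Equiv.Perm.sign σ * koszulSign σ d : ℤˣ) : ℤ) : K) *
        sgn K (twistFin fun j => d (σ.symm j)) =
      sgn K (twistFin d) * (((koszulSign σ fun j => d j - 1 : ℤˣ) : ℤ) : K) := by
  induction m with
  | zero =>
    intro σ d
    have : σ = 1 := Subsingleton.elim _ _
    subst this
    simp [koszulSign, twistFin]
  | succ m ih =>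
    intro σ d
    obtain ⟨⟨i, σ⟩, rfl⟩ := (permCons_bijective m).2 σ
    simp only
    have hs : (((Equiv.Perm.sign (permCons i σ) : ℤˣ) : ℤ) : K) =
        sgn K (i : ℕ) * (((Equiv.Perm.sign σ : ℤˣ) : ℤ) : K) := by
      rw [sign_permCons, sgn, Int.negOnePow_def]
      push_cast
      simp
    have h0 := ih σ fun j => d (i.succAbove j)
    rw [Units.val_mul, Int.cast_mul] at h0 ⊢
    rw [hs, cast_koszulSign_permCons, cast_koszulSign_permCons, twistFin_comp_permCons,
      twistFin_succAbove i d, sgn_add, sgn_add, sgn_add]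
    have hc : (∑ j : Fin m, if j.castSucc < i then (d (i.succAbove j) - 1) * (d i - 1) else 0) =
        (∑ j : Fin m, if j.castSucc < i then d (i.succAbove j) * d i else 0) -
          (∑ j : Fin m, if j.castSucc < i then d (i.succAbove j) else 0) -
            (i : ℕ) * d i + (i : ℕ) := by
      rw [← card_castSucc_lt i, Finset.sum_mul, ← Finset.sum_sub_distrib, ← Finset.sum_sub_distrib,
        ← Finset.sum_add_distrib]
      refine Finset.sum_congr rfl fun j _ => ?_
      split_ifs <;> ring
    rw [hc]
    set c := ∑ j : Fin m, if j.castSucc < i then d (i.succAbove j) * d i else 0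
    set e := ∑ j : Fin m, if j.castSucc < i then d (i.succAbove j) else 0
    have hsign : sgn K (i : ℕ) * sgn K c * sgn K (m * d i) =
        sgn K (((m : ℤ) - (i : ℕ)) * d i) * sgn K e * sgn K (c - e - (i : ℕ) * d i + (i : ℕ)) := by
      rw [← sgn_add, ← sgn_add, ← sgn_add, ← sgn_add]
      exact sgn_congr ((i : ℕ) * d i) (by ring)
    linear_combination (sgn K (i : ℕ) * sgn K c * sgn K (m * d i)) * h0 +
      sgn K (twistFin fun j => d (i.succAbove j)) *
        (((koszulSign σ fun j => d (i.succAbove j) - 1 : ℤˣ) : ℤ) : K) * hsign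

/-- `σ` is increasing on the first `p` places and on the remaining ones. -/
def IsShuffleAt {m : ℕ} (p : ℕ) (σ : Equiv.Perm (Fin m)) : Prop :=
  (∀ i j : Fin m, i < j → (j : ℕ) < p → σ i < σ j) ∧
    ∀ i j : Fin m, i < j → p ≤ (i : ℕ) → σ i < σ j

lemma isShuffleAt_permCons_zero {m : ℕ} (p : ℕ) (σ : Equiv.Perm (Fin m)) :
    IsShuffleAt p (permCons 0 σ) ↔ IsShuffleAt (p - 1) σ := by
  have e : ∀ j : Fin m, permCons 0 σ j.succ = (σ j).succ := fun j => permCons_succAbove 0 σ j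
  unfold IsShuffleAt
  refine and_congr ⟨fun H i j hij hj => ?_, fun H i j hij hj => ?_⟩
    ⟨fun H i j hij hi => ?_, fun H i j hij hi => ?_⟩
  · have := H i.succ j.succ (by simpa using hij) (by rw [Fin.val_succ]; omega)
    simpa [e] using this
  · induction j using Fin.cases with
    | zero => exact absurd hij (Fin.not_lt_zero _)
    | succ j =>
      induction i using Fin.cases with
      | zero => rw [permCons_self, e]; exact Fin.succ_pos _
      | succ i =>
        rw [e, e, Fin.succ_lt_succ_iff]
        exact H i j (by simpa using hij) (by rw [Fin.val_succ] at hj; omega)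
  · have := H i.succ j.succ (by simpa using hij) (by rw [Fin.val_succ]; omega)
    simpa [e] using this
  · induction j using Fin.cases with
    | zero => exact absurd hij (Fin.not_lt_zero _)
    | succ j =>
      induction i using Fin.cases with
      | zero => rw [permCons_self, e]; exact Fin.succ_pos _
      | succ i =>
        rw [e, e, Fin.succ_lt_succ_iff]
        exact H i j (by simpa using hij) (by rw [Fin.val_succ] at hi; omega)

lemma val_succAbove_eq {m : ℕ} (i : Fin (m + 1)) (j : Fin m) :
    ((i.succAbove j : Fin (m + 1)) : ℕ) = if (j : ℕ) < i then (j : ℕ) else j + 1 := by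
  by_cases hj : j.castSucc < i
  · rw [Fin.succAbove_of_castSucc_lt _ _ hj, if_pos (by simpa [Fin.lt_def] using hj)]; rfl
  · rw [Fin.succAbove_of_le_castSucc _ _ (not_lt.1 hj), if_neg (by simpa [Fin.lt_def] using hj)]
    rfl

lemma isShuffleAt_permCons_of_eq {m p : ℕ} {i : Fin (m + 1)} (hi : (i : ℕ) = p)
    (σ : Equiv.Perm (Fin m)) : IsShuffleAt p (permCons i σ) ↔ IsShuffleAt p σ := by
  unfold IsShuffleAt
  refine and_congr ⟨fun H j k hjk hk => ?_, fun H j k hjk hk => ?_⟩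
    ⟨fun H j k hjk hj => ?_, fun H j k hjk hj => ?_⟩
  · have := H (i.succAbove j) (i.succAbove k) (by simpa using hjk)
      (by rw [val_succAbove_eq]; split_ifs <;> omega)
    simpa using this
  · obtain rfl | ⟨j, rfl⟩ := Fin.eq_self_or_eq_succAbove i j
    · rw [Fin.lt_def] at hjk; omega
    obtain rfl | ⟨k, rfl⟩ := Fin.eq_self_or_eq_succAbove i k
    · omega
    rw [permCons_succAbove, permCons_succAbove, Fin.succ_lt_succ_iff]
    refine H j k (by simpa using hjk) ?_
    rw [val_succAbove_eq] at hk
    split_ifs at hk <;> omega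
  · have := H (i.succAbove j) (i.succAbove k) (by simpa using hjk)
      (by rw [val_succAbove_eq]; split_ifs <;> omega)
    simpa using this
  · obtain rfl | ⟨k, rfl⟩ := Fin.eq_self_or_eq_succAbove i k
    · rw [Fin.lt_def] at hjk; omega
    obtain rfl | ⟨j, rfl⟩ := Fin.eq_self_or_eq_succAbove i j
    · rw [permCons_self, permCons_succAbove]; exact Fin.succ_pos _
    rw [permCons_succAbove, permCons_succAbove, Fin.succ_lt_succ_iff]
    refine H j k (by simpa using hjk) ?_
    rw [val_succAbove_eq] at hj
    split_ifs at hj <;> omega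

lemma not_isShuffleAt_permCons {m p : ℕ} {i : Fin (m + 1)} (h0 : i ≠ 0) (hi : (i : ℕ) ≠ p)
    (σ : Equiv.Perm (Fin m)) : ¬ IsShuffleAt p (permCons i σ) := by
  rintro ⟨H1, H2⟩
  rcases lt_or_gt_of_ne hi with hi | hi
  · have := H1 0 i (Fin.pos_iff_ne_zero.2 h0) hi
    rw [permCons_self] at this
    exact Fin.not_lt_zero _ this
  · have := H2 ⟨p, by omega⟩ i hi le_rfl
    rw [permCons_self] at this
    exact Fin.not_lt_zero _ this

/-- The sum over the permutations which are shuffles, with Koszul signs, of the values of `F` is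
the recursively defined shuffle sum. -/
lemma sum_isShuffleAt {V W : Type*} [AddCommGroup W] [Module K W] {m : ℕ} :
    ∀ (p : ℕ) (F : List (ℤ × V) → W) (x : Fin m → ℤ × V), p ≤ m →
      (open Classical in ∑ σ : Equiv.Perm (Fin m) with IsShuffleAt p σ,
        (((koszulSign σ fun j => (x j).1 - 1 : ℤˣ) : ℤ) : K) •
          F (List.ofFn fun j => x (σ.symm j))) =
      shuffleSum K F ((List.ofFn x).take p) ((List.ofFn x).drop p) := by
  classical
  induction m with
  | zero =>
    intro p F x hp
    obtain rfl : p = 0 := by omega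
    have hS : ∀ σ : Equiv.Perm (Fin 0), IsShuffleAt 0 σ := fun σ => ⟨fun i => i.elim0,
      fun i => i.elim0⟩
    simp [hS, koszulSign]
  | succ m ih =>
    intro p F x hp
    have hterm : ∀ i : Fin (m + 1), (∑ σ : Equiv.Perm (Fin m), if IsShuffleAt p (permCons i σ) then
        (((koszulSign (permCons i σ) fun j => (x j).1 - 1 : ℤˣ) : ℤ) : K) •
          F (List.ofFn fun j => x ((permCons i σ).symm j)) else 0) =
        sgn K (∑ j : Fin m,
          if j.castSucc < i then ((x (i.succAbove j)).1 - 1) * ((x i).1 - 1) else 0) •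
        ∑ σ : Equiv.Perm (Fin m), if IsShuffleAt p (permCons i σ) then
          (((koszulSign σ fun j => (x (i.succAbove j)).1 - 1 : ℤˣ) : ℤ) : K) •
            (fun w => F (x i :: w)) (List.ofFn fun j => x (i.succAbove (σ.symm j))) else 0 := by
      intro i
      rw [Finset.smul_sum]
      refine Finset.sum_congr rfl fun σ _ => ?_
      rw [smul_ite, smul_zero, cast_koszulSign_permCons, smul_smul, List.ofFn_succ]
      simp only [permCons_symm_zero, permCons_symm_succ]
    have h0 : (∑ σ : Equiv.Perm (Fin m), if IsShuffleAt p (permCons 0 σ) then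
        (((koszulSign (permCons 0 σ) fun j => (x j).1 - 1 : ℤˣ) : ℤ) : K) •
          F (List.ofFn fun j => x ((permCons 0 σ).symm j)) else 0) =
        shuffleSum K (fun w => F (x 0 :: w)) ((List.ofFn fun j : Fin m => x j.succ).take (p - 1))
          ((List.ofFn fun j : Fin m => x j.succ).drop (p - 1)) := by
      rw [hterm, ← ih (p - 1) _ _ (by omega), Finset.sum_filter]
      simp only [isShuffleAt_permCons_zero, Fin.not_lt_zero, if_false, Finset.sum_const_zero,
        sgn_zero, one_smul, Fin.zero_succAbove]
    rw [Finset.sum_filter, sum_perm_succ, List.ofFn_succ]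
    rcases Nat.eq_zero_or_pos p with rfl | hp0
    · rw [Finset.sum_eq_single_of_mem 0 (Finset.mem_univ _), h0]
      · simp
      · intro i _ hi
        refine Finset.sum_eq_zero fun σ _ => if_neg ?_
        exact not_isShuffleAt_permCons hi (fun e => hi (Fin.ext e)) σ
    obtain ⟨p, rfl⟩ : ∃ q, p = q + 1 := ⟨p - 1, by omega⟩
    rw [Nat.add_sub_cancel] at h0
    rw [List.take_succ_cons, List.drop_succ_cons]
    rcases Nat.eq_or_lt_of_le hp with hpm | hpm
    · obtain rfl : p = m := by omega
      rw [Finset.sum_eq_single_of_mem 0 (Finset.mem_univ _), h0]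
      · rw [List.drop_eq_nil_of_le (by simp)]
        simp
      · intro i _ hi
        refine Finset.sum_eq_zero fun σ _ => if_neg ?_
        exact not_isShuffleAt_permCons hi (by have := i.2; omega) σ
    set i : Fin (m + 1) := ⟨p + 1, hpm⟩ with hi
    have hi0 : i ≠ 0 := by simp [hi, Fin.ext_iff]
    rw [Finset.sum_eq_add_of_mem 0 i (Finset.mem_univ _) (Finset.mem_univ _) hi0.symm, h0, hterm]
    · have hd : (List.ofFn fun j : Fin m => x j.succ).drop p =
          x i :: (List.ofFn fun j : Fin m => x j.succ).drop (p + 1) := by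
        rw [List.drop_eq_getElem_cons (by simp; omega)]
        simp [hi]
      have ht : (List.ofFn fun j => x (i.succAbove j)).take (p + 1) =
          x 0 :: (List.ofFn fun j : Fin m => x j.succ).take p := by
        have : x 0 :: (List.ofFn fun j : Fin m => x j.succ).take p =
            (List.ofFn x).take (p + 1) := by rw [List.ofFn_succ, List.take_succ_cons]
        rw [this]
        refine List.ext_getElem (by simp; omega) fun k h1 h2 => ?_
        simp only [List.length_take, List.length_ofFn] at h1 h2
        simp only [List.getElem_take, List.getElem_ofFn]
        congr 1
        rw [Fin.ext_iff, val_succAbove_eq, if_pos (by simp [hi]; omega)]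
      have hd' : (List.ofFn fun j => x (i.succAbove j)).drop (p + 1) =
          (List.ofFn fun j : Fin m => x j.succ).drop (p + 1) := by
        refine List.ext_getElem (by simp) fun k h1 h2 => ?_
        simp only [List.getElem_drop, List.getElem_ofFn]
        congr 1
        rw [Fin.ext_iff, val_succAbove_eq, if_neg (by simp [hi]; omega)]
        simp
      have hsig : (∑ j : Fin m,
          if j.castSucc < i then ((x (i.succAbove j)).1 - 1) * ((x i).1 - 1) else 0) =
          ((x i).1 - 1) * susDeg (x 0 :: (List.ofFn fun j : Fin m => x j.succ).take p) := by
        rw [← ht, susDeg, List.map_take, List.map_ofFn, List.sum_take_ofFn, Finset.mul_sum,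
          Finset.sum_filter]
        refine Finset.sum_congr rfl fun j _ => ?_
        have : (j.castSucc < i) = ((j : ℕ) < p + 1) := by simp [hi, Fin.lt_def]
        simp only [this, Function.comp]
        split_ifs <;> ring
      have key := ih (p + 1) (fun w => F (x i :: w)) (fun j => x (i.succAbove j)) (by omega)
      rw [ht, hd', Finset.sum_filter] at key
      rw [hd, shuffleSum_cons_cons, hsig, ← hd, ← key]
      have hiff : ∀ σ : Equiv.Perm (Fin m),
          IsShuffleAt (p + 1) (permCons i σ) ↔ IsShuffleAt (p + 1) σ :=
        isShuffleAt_permCons_of_eq (by simp [hi])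
      simp only [hiff]
    · rintro j _ ⟨hj0, hji⟩
      refine Finset.sum_eq_zero fun σ _ => if_neg ?_
      exact not_isShuffleAt_permCons hj0 (fun e => hji (Fin.ext e)) σ

end Perm

namespace PoincareDGCA

variable {K : Type u} [Field K] {n : ℕ} {A : PoincareDGCA K n}

namespace HodgeHomotopy

variable (h : A.HodgeHomotopy)

lemma unsuspend_apply_fin {k : ℕ} (G : MultilinearMap K (fun _ : Fin k => A.carrier) A.carrier)
    {d : Fin k → ℤ} {v : Fin k → h.harmonic} (hv : ∀ j, v j ∈ h.harmonicGr (d j)) :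
    h.unsuspend G v = sgn K (twistFin d) • G (fun i => (v i : A.carrier)) := by
  have h1 := h.unsuspend_apply G (p := extendWord d) (v := extendWord v) (by
    intro j hj
    simp only [extendWord, hj, dif_pos]
    exact hv _)
  simp only [extendWord_apply] at h1
  rw [h1, twist, Finset.sum_range, twistFin]
  simp only [extendWord_apply]

/-- Vanishing on shuffles, transferred to the unsuspended operations. -/
lemma vanishesOnShuffles_of {G : ∀ k : ℕ, MultilinearMap K (fun _ : Fin k => A.carrier) A.carrier}
    (F : List (ℤ × A.carrier) → A.carrier)
    (hGF : ∀ (k : ℕ) (x : Fin k → ℤ × A.carrier), G k (fun i => (x i).2) = F (List.ofFn x))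
    (hF : ∀ u v : List (ℤ × A.carrier), u ≠ [] → v ≠ [] → (∀ x ∈ u, x.2 ∈ A.gr x.1) →
      (∀ x ∈ v, x.2 ∈ A.gr x.1) → shuffleSum K F u v = 0) :
    VanishesOnShuffles h.harmonicGr fun k => h.unsuspend (G k) := by
  classical
  intro p q hp hq d v hv
  set x : Fin (p + q) → ℤ × A.carrier := fun j => (d j, v j) with hx
  have key := sum_isShuffleAt (K := K) p F x (by omega)
  have hmem : ∀ y ∈ List.ofFn x, y.2 ∈ A.gr y.1 := by
    intro y hy
    obtain ⟨j, rfl⟩ := (List.mem_ofFn' _ _).1 hy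
    exact hv j
  rw [hF] at key
  · have := congrArg (fun a => sgn K (twistFin d) • a) key
    simp only [smul_zero, Finset.smul_sum] at this
    rw [← this]
    refine Finset.sum_congr (Finset.ext fun σ => by
      simp only [Finset.mem_filter]; rfl) fun σ _ => ?_
    rw [h.unsuspend_apply_fin (G (p + q)) (d := fun i => d (σ.symm i)) (fun i => hv _)]
    rw [Units.smul_def, ← Int.cast_smul_eq_zsmul K, smul_smul, sign_mul_koszulSign, smul_smul,
      ← hGF]
  · intro e
    have := congrArg List.length e
    simp at this
    omega
  · intro e
    have := congrArg List.length e
    simp at this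
    omega
  · exact fun y hy => hmem y (List.mem_of_mem_take hy)
  · exact fun y hy => hmem y (List.mem_of_mem_drop hy)

lemma wordOfList_ofFn {k : ℕ} (x : Fin k → ℤ × A.carrier) {j : ℕ} (hj : j < k) :
    extendWord (fun i => (x i).2) j = wordOfList (List.ofFn x) j := by
  simp [extendWord, wordOfList, hj, List.getD_eq_getElem?_getD]

lemma transferMor_shuffle : VanishesOnShuffles h.harmonicGr h.transferMor := by
  refine h.vanishesOnShuffles_of h.phiList ?_ ?_
  · intro k x
    rw [phiList, List.length_ofFn]
    exact h.phi_congr k fun j hj => wordOfList_ofFn x hj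
  · intro u v hu hv hu' hv'
    exact h.shuffleSum_phiList _ u v rfl hu hv hu' hv'

lemma transferOp_shuffle : VanishesOnShuffles h.harmonicGr h.transferOp := by
  intro p q hp hq d v hv
  have key := h.vanishesOnShuffles_of (G := h.prodPhiMulti)
    (fun l => h.prodPhi l.length (wordOfList l)) ?_ ?_ p q hp hq d v hv
  · have := congrArg h.toHarmonic key
    rw [map_sum, map_zero] at this
    rw [← this]
    refine Finset.sum_congr rfl fun σ _ => ?_
    rw [Units.smul_def, Units.smul_def, map_zsmul]
    rfl
  · intro k x
    simp only [List.length_ofFn]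
    exact h.prodPhi_congr k fun j hj => wordOfList_ofFn x hj
  · intro u v hu hv hu' hv'
    exact h.shuffleSum_prodPhi hu hv hu' hv'

end HodgeHomotopy

end PoincareDGCA

/-! ### The transferred structure and morphism -/

/-- The composition `i + l` of length two. -/
def pairComposition (i l : ℕ) (hi : 0 < i) (hl : 0 < l) : Composition (i + l) where
  blocks := [i, l]
  blocks_pos := by
    intro j hj
    simp only [List.mem_cons, List.not_mem_nil, or_false] at hj
    rcases hj with rfl | rfl <;> assumption
  blocks_sum := by simp

/-- The composition of `N > 0` with one block. -/
def oneComposition (N : ℕ) (hN : 0 < N) : Composition N where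
  blocks := [N]
  blocks_pos := by
    intro j hj
    simp only [List.mem_cons, List.not_mem_nil, or_false] at hj
    rwa [hj]
  blocks_sum := by simp

/-- A sum over compositions whose terms vanish on the compositions with at least three blocks. -/
lemma sum_composition {M : Type*} [AddCommMonoid M] {N : ℕ} (hN : 0 < N) (T : Composition N → M)
    (hT : ∀ c : Composition N, 3 ≤ c.length → T c = 0) (Q : ℕ → M) (h0 : Q 0 = 0) (h1 : Q N = 0)
    (hQ : ∀ (i l : ℕ) (hi : 0 < i) (hl : 0 < l) (e : i + l = N),
      T (e ▸ pairComposition i l hi hl) = Q i) :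
    ∑ c, T c = T (oneComposition N hN) + ∑ i ∈ Finset.range (N + 1), Q i := by
  classical
  have hone : ∀ c : Composition N, c.length = 1 → c = oneComposition N hN := by
    intro c hc
    apply Composition.ext
    obtain ⟨a, ha⟩ := List.length_eq_one_iff.1 hc
    have := c.blocks_sum
    rw [ha] at this ⊢
    simp only [List.sum_cons, List.sum_nil, add_zero] at this
    rw [this]
    rfl
  have hblocks : ∀ (i l : ℕ) (hi : 0 < i) (hl : 0 < l) (e : i + l = N),
      (e ▸ pairComposition i l hi hl : Composition N).blocks = [i, l] := by
    rintro i l hi hl rfl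
    rfl
  rw [← Finset.sum_filter_add_sum_filter_not Finset.univ (fun c : Composition N => c.length = 2),
    add_comm]
  congr 1
  · refine Finset.sum_eq_single_of_mem _ ?_ ?_
    · simp [oneComposition, Composition.length]
    · intro c hc hne
      rw [Finset.mem_filter] at hc
      have h2 : c.length ≠ 1 := fun e => hne (hone c e)
      have h3 := c.length_pos_of_pos hN
      exact hT c (by omega)
  · have hsub : ∑ i ∈ Finset.Ico 1 N, Q i = ∑ i ∈ Finset.range (N + 1), Q i := by
      refine Finset.sum_subset (fun i hi => ?_) (fun i hi hi' => ?_)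
      · simp only [Finset.mem_Ico, Finset.mem_range] at hi ⊢; omega
      · simp only [Finset.mem_Ico, Finset.mem_range] at hi hi'
        rcases (by omega : i = 0 ∨ i = N) with rfl | rfl
        · exact h0
        · exact h1
    rw [← hsub]
    symm
    refine Finset.sum_bij (fun i hi => ((by rw [Finset.mem_Ico] at hi; omega : i + (N - i) = N) ▸
      pairComposition i (N - i) (by rw [Finset.mem_Ico] at hi; omega)
        (by rw [Finset.mem_Ico] at hi; omega) : Composition N)) ?_ ?_ ?_ ?_
    · intro i hi
      simp [Composition.length, hblocks]
    · intro i hi j hj hij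
      have := congrArg Composition.blocks hij
      rw [hblocks, hblocks] at this
      exact (List.cons.inj this).1
    · intro c hc
      rw [Finset.mem_filter] at hc
      obtain ⟨a, b, hab⟩ := List.length_eq_two.1 hc.2
      have hs := c.blocks_sum
      rw [hab] at hs
      simp only [List.sum_cons, List.sum_nil, add_zero] at hs
      have ha := c.blocks_pos (i := a) (by simp [hab])
      have hb := c.blocks_pos (i := b) (by simp [hab])
      refine ⟨a, by rw [Finset.mem_Ico]; omega, ?_⟩
      apply Composition.ext
      rw [hblocks, hab]
      congr
      omega
    · intro i hi
      exact (hQ _ _ _ _ _).symm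

namespace PoincareDGCA

variable {K : Type u} [Field K] {n : ℕ} {A : PoincareDGCA K n}

namespace HodgeHomotopy

variable (h : A.HodgeHomotopy)

lemma sum_extendWord {k : ℕ} (d : Fin k → ℤ) :
    ∑ j ∈ Finset.range k, extendWord d j = ∑ i, d i := by
  rw [Finset.sum_range]
  simp [extendWord_apply]

lemma extendWord_mem {k : ℕ} {d : Fin k → ℤ} {v : Fin k → h.harmonic}
    (hv : ∀ i, v i ∈ h.harmonicGr (d i)) (j : ℕ) :
    extendWord v j ∈ h.harmonicGr (extendWord d j) := by
  unfold extendWord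
  split_ifs with hj
  · exact hv _
  · exact Submodule.zero_mem _

/-- The `C∞`-structure on the harmonic subspace obtained by homotopy transfer. -/
def transferStructure : CInftyStructure h.harmonicGr where
  isInternal := h.harmonicGr_isInternal
  m := h.transferOp
  m_zero := h.transferOp_zero
  m_mem k d v hv := by
    have := h.transferOp_mem (k := k) (p := extendWord d) (v := extendWord v)
      fun j _ => h.extendWord_mem hv j
    rw [sum_extendWord] at this
    simpa only [extendWord_apply] using this
  relation N _ p v hv := h.transferOp_relation N p v hv
  shuffle := h.transferOp_shuffle

lemma transferMor_mem {k : ℕ} {d : Fin k → ℤ} {v : Fin k → h.harmonic}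
    (hv : ∀ i, v i ∈ h.harmonicGr (d i)) :
    h.transferMor k v ∈ A.gr (∑ i, d i + 1 - k) := by
  have h1 := h.transferMor_apply (k := k) (p := extendWord d) (v := extendWord v)
    fun j _ => h.extendWord_mem hv j
  simp only [extendWord_apply] at h1
  rw [h1, ← sum_extendWord]
  refine Submodule.smul_mem _ _ (h.phi_mem k fun j _ => ?_)
  exact h.extendWord_mem hv j

lemma transferMor_relation {N : ℕ} (hN : 1 ≤ N) (p : ℕ → ℤ) (v : ℕ → h.harmonic)
    (hv : ∀ j, v j ∈ h.harmonicGr (p j)) :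
    insertionSum h.transferMor h.transferOp N p v =
      ∑ c : Composition N,
        (∑ j : Fin c.length,
          (((c.length : ℤ) - 1 - (j : ℕ)) * ((c.blocksFun j : ℤ) - 1) +
            (1 - (c.blocksFun j : ℤ)) * ∑ i ∈ Finset.range (c.sizeUpTo j), p i)).negOnePow •
          A.ops c.length
            (fun j => h.transferMor (c.blocksFun j) (fun i => v (c.sizeUpTo j + i))) := by
  rw [h.insertionSum_transferOp h.transferMor h.phi h.phi_smul
      (fun k p v hv => h.transferMor_apply hv) N p v hv,
    sum_composition hN _ (Q := fun i => sgn K (twist N p) •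
      (A.eps (h.phi i fun j => v j) * h.phi (N - i) (shiftWord i fun j => (v j : A.carrier))))]
  · have h1 := h.d_phi N (fun j => (v j : A.carrier)) fun j => (v j).2
    rw [eq_add_of_sub_eq h1.symm, smul_add, ← Finset.smul_sum]
    congr 1
    have e : (∑ j : Fin (oneComposition N hN).length,
          ((((oneComposition N hN).length : ℤ) - 1 - (j : ℕ)) *
            (((oneComposition N hN).blocksFun j : ℤ) - 1) +
            (1 - ((oneComposition N hN).blocksFun j : ℤ)) *
              ∑ i ∈ Finset.range ((oneComposition N hN).sizeUpTo j), p i)) = 0 := by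
      refine Fintype.sum_eq_zero _ fun j => ?_
      have hj : (j : ℕ) = 0 := by
        have := j.2
        simp only [oneComposition, Composition.length, List.length_singleton] at this
        omega
      rw [hj]
      simp [oneComposition, Composition.length]
    rw [e, Int.negOnePow_zero, one_smul]
    change _ = A.d (h.transferMor N fun i => v (0 + i))
    simp only [zero_add]
    rw [h.transferMor_apply fun j _ => hv j, map_smul]
  · intro c hc
    rw [A.ops_ge hc]
    simp
  · simp
  · simp
  · rintro i l hi hl rfl
    have e : (∑ j : Fin (pairComposition i l hi hl).length,
          ((((pairComposition i l hi hl).length : ℤ) - 1 - (j : ℕ)) *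
            (((pairComposition i l hi hl).blocksFun j : ℤ) - 1) +
            (1 - ((pairComposition i l hi hl).blocksFun j : ℤ)) *
              ∑ i ∈ Finset.range ((pairComposition i l hi hl).sizeUpTo j), p i)) =
        ((i : ℤ) - 1) + (1 - (l : ℤ)) * ∑ j ∈ Finset.range i, p j := by
      change (∑ j : Fin 2, ((((2 : ℕ) : ℤ) - 1 - (j : ℕ)) *
          (((pairComposition i l hi hl).blocksFun j : ℤ) - 1) +
            (1 - ((pairComposition i l hi hl).blocksFun j : ℤ)) *
              ∑ i ∈ Finset.range ((pairComposition i l hi hl).sizeUpTo j), p i)) = _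
      rw [Fin.sum_univ_two]
      change (((2 : ℕ) : ℤ) - 1 - (0 : ℕ)) * ((i : ℤ) - 1) + (1 - (i : ℤ)) *
          ∑ j ∈ Finset.range 0, p j +
        ((((2 : ℕ) : ℤ) - 1 - (1 : ℕ)) * ((l : ℤ) - 1) + (1 - (l : ℤ)) *
          ∑ j ∈ Finset.range i, p j) = _
      simp
    simp only
    rw [e]
    change _ • A.ops 2 _ = _
    refine (congrArg (_ • ·) (A.ops_two _)).trans ?_
    change _ • ((h.transferMor i fun j => v (0 + j)) * (h.transferMor l fun j => v (i + j))) = _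
    have e2 : (fun j : Fin l => v (i + j)) = fun j : Fin l => shiftWord i v j := by
      funext j
      rw [shiftWord_apply, add_comm]
    simp only [zero_add]
    have hp : (h.phi i fun j => (v j : A.carrier)) ∈ A.gr (∑ j ∈ Finset.range i, p j + 1 - i) :=
      h.phi_mem i fun j _ => hv j
    rw [e2, h.transferMor_apply fun j _ => hv j,
      h.transferMor_apply (p := shiftWord i p) (v := shiftWord i v) fun j _ => hv _,
      Nat.add_sub_cancel_left, smul_mul_smul_comm, negOnePow_smul_eq (K := K), smul_smul,
      A.eps_of_mem hp, smul_mul_assoc, smul_smul, ← sgn_add,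
      ← sgn_add, ← sgn_add, twist_add]
    congr 1
    refine sgn_congr (i - 1 - l * ∑ j ∈ Finset.range i, p j) ?_
    ring

/-- The transferred `C∞`-morphism from the harmonic subspace to the algebra. -/
def transferMorphism : CInftyStructure.Morphism h.transferStructure A.toCInfty where
  f := h.transferMor
  f_zero := by
    ext w
    simp [transferMor, unsuspend, phiMulti, multilinearOfWord]
  f_mem k d v hv := h.transferMor_mem hv
  relation N hN p v hv := h.transferMor_relation hN p v hv
  shuffle := h.transferMor_shuffle

lemma transferMor_one (α : h.harmonic) : h.transferMor 1 ![α] = (α : A.carrier) := by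
  simp [transferMor, unsuspend, phiMulti, multilinearOfWord, extendWord]

lemma transferOp_two (α β : h.harmonic) :
    h.transferOp 2 ![α, β] = h.toHarmonic ((α : A.carrier) * (β : A.carrier)) := by
  have : (fun i : Fin 2 => ((A.eps ^ (2 - 1 - (i : ℕ))) ∘ₗ h.harmonic.subtype)
      ((![α, β] : Fin 2 → h.harmonic) i)) = ![A.eps α, (β : A.carrier)] := by
    funext i
    fin_cases i <;> simp
  rw [transferOp, LinearMap.compMultilinearMap_apply, unsuspend,
    MultilinearMap.compLinearMap_apply, this]
  congr 1
  change h.prodPhi 2 _ = _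
  rw [prodPhi_two]
  simp [extendWord]

lemma transferOp_eq_mhat (k : ℕ) (p : ℕ → ℤ) (α : ℕ → h.harmonic)
    (hα : ∀ j, α j ∈ h.harmonicGr (p j)) :
    h.transferOp k (fun j => α j) = h.toHarmonic (h.mhat k p fun j => (α j : A.carrier)) := by
  ext
  rw [h.coe_transferOp_apply fun j _ => hα j,
    h.mhat_eq k p (fun j => (α j : A.carrier)) fun j => hα j, map_smul, Submodule.coe_smul, coe_toHarmonic, mu]

/-- A multilinear operation vanishes if it vanishes on homogeneous words. -/
lemma multilinear_eq_zero_of_homogeneous {W : Type*} [AddCommGroup W] [Module K W] {k : ℕ}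
    (f : MultilinearMap K (fun _ : Fin k => h.harmonic) W)
    (hf : ∀ (d : Fin k → ℤ) (v : Fin k → h.harmonic), (∀ i, v i ∈ h.harmonicGr (d i)) →
      f v = 0) (v : Fin k → h.harmonic) : f v = 0 := by
  classical
  have hdec : ∀ x : h.harmonic, ∃ s : Finset ℤ, ∃ y : ℤ → h.harmonic,
      (∀ k, y k ∈ h.harmonicGr k) ∧ x = ∑ k ∈ s, y k := by
    intro x
    obtain ⟨s, hs⟩ := A.sum_proj (x : A.carrier)
    refine ⟨s, fun k => ⟨A.proj k x, h.proj_mem_harmonic k x.2⟩, fun k => A.proj_mem k _, ?_⟩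
    ext
    rw [AddSubmonoidClass.coe_finsetSum]
    exact hs
  choose s y hy hx using hdec
  have : v = fun i => ∑ k ∈ s (v i), y (v i) k := funext fun i => hx (v i)
  rw [this, MultilinearMap.map_sum_finset]
  exact Finset.sum_eq_zero fun d _ => hf d _ fun i => hy _ _

end HodgeHomotopy

end PoincareDGCA

namespace PoincareDGCA

variable {K : Type u} [Field K] {n : ℕ} {A : PoincareDGCA K n}

namespace HodgeHomotopy

variable (h : A.HodgeHomotopy)

/-! ### Unitality and the quasi-isomorphism property -/

lemma eps_pow_mem_harmonic (m : ℕ) {a : A.carrier} (ha : a ∈ h.harmonic) :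
    (A.eps ^ m) a ∈ h.harmonic := by
  induction m with
  | zero => simpa
  | succ m ih =>
    rw [pow_succ', Module.End.mul_apply, h.mem_harmonic_iff, piH_eps, h.mem_harmonic_iff.1 ih]

lemma eps_pow_one (m : ℕ) : (A.eps ^ m) (1 : A.carrier) = 1 := by
  induction m with
  | zero => simp
  | succ m ih => rw [pow_succ', Module.End.mul_apply, ih, A.eps_one]

/-- The letters of the word to which `φ_k` and `μ_k` are applied in `f_k(v)` and `m_k(v)` are
harmonic. -/
lemma extendWord_eps_pow_mem {k : ℕ} (v : Fin k → h.harmonic) (j : ℕ) :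
    extendWord (fun i => (A.eps ^ (k - 1 - (i : ℕ))) (v i : A.carrier)) j ∈ h.harmonic := by
  unfold extendWord
  split_ifs
  · exact h.eps_pow_mem_harmonic _ (Subtype.prop _)
  · exact Submodule.zero_mem _

/-- `m_1 = 0`, since the product `M_1` is empty. -/
lemma transferStructure_isMinimal : h.transferStructure.IsMinimal := h.transferOp_one

lemma transferStructure_isUnital : h.transferStructure.IsUnital h.one := by
  refine ⟨A.one_mem, ?_, fun a => ⟨?_, ?_⟩, fun k hk v i hi => ?_⟩
  · change h.transferOp 1 _ = 0
    rw [h.transferOp_one]; rfl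
  · change h.transferOp 2 _ = a
    ext
    rw [h.transferOp_two, coe_toHarmonic, one, one_mul, h.piH_coe]
  · change h.transferOp 2 _ = a
    ext
    rw [h.transferOp_two, coe_toHarmonic, one, mul_one, h.piH_coe]
  · ext
    refine h.mu_of_eq_one hk _ (h.extendWord_eps_pow_mem v) i.2 ?_
    rw [extendWord_apply, hi]
    exact eps_pow_one _

lemma transferMorphism_isUnital : h.transferMorphism.IsUnital h.one 1 := by
  refine ⟨h.transferMor_one _, fun k hk v i hi => ?_⟩
  refine h.phi_of_eq_one k hk _ (h.extendWord_eps_pow_mem v) i i.2 ?_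
  rw [extendWord_apply, hi]
  exact eps_pow_one _

lemma transferMorphism_isQuasiIso : h.transferMorphism.IsQuasiIso := by
  have e0 : ∀ x, CInftyStructure.linearPart (h.transferStructure.m 1) x = 0 := by
    intro x
    rw [CInftyStructure.linearPart_apply]
    change h.transferOp 1 _ = 0
    rw [h.transferOp_one]; rfl
  have e1 : ∀ x, CInftyStructure.linearPart (h.transferMorphism.f 1) x = (x : A.carrier) := by
    intro x
    rw [CInftyStructure.linearPart_apply]
    exact h.transferMor_one x
  have e2 : ∀ x, CInftyStructure.linearPart (A.toCInfty.m 1) x = A.d x := by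
    intro x
    rw [CInftyStructure.linearPart_apply]
    exact A.ops_one _
  refine ⟨fun x _ hx => ⟨0, ?_⟩, fun y hy => ⟨h.toHarmonic y, e0 _, h.dm y, ?_⟩⟩
  · obtain ⟨y, hy⟩ := hx
    rw [e1, e2] at hy
    rw [map_zero]
    ext
    rw [← h.piH_coe x, ← hy, piH_d]
    rfl
  · rw [e2] at hy
    rw [e1, e2, coe_toHarmonic]
    conv_lhs => rw [h.hodge y, hy, map_zero, add_zero]

/-! ### Cyclicity -/

/-- The products `M_k` are cyclic for the pairing. By associativity
`∑ ε M_i · φ_{k+1-i} = ∑ φ_i · M_{k+1-i}`, and the inner terms cancel under the integral because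
`d⁻` is self-adjoint up to sign. -/
lemma integralA_prodPhi_cyclic {k : ℕ} (hk : 2 ≤ k) (v : ℕ → A.carrier) :
    A.integralA (A.eps (h.prodPhi k v) * v k) =
      A.integralA (v 0 * h.prodPhi k (shiftWord 1 v)) := by
  have key := congrArg A.integralA (h.sum_eps_prodPhi_mul_phi (k + 1) v)
  rw [map_sum, map_sum, ← sub_eq_zero, ← Finset.sum_sub_distrib] at key
  rw [← sub_eq_zero]
  have hsub : ({1, k} : Finset ℕ) ⊆ Finset.range (k + 1 + 1) := by
    intro i hi
    simp only [Finset.mem_insert, Finset.mem_singleton, Finset.mem_range] at hi ⊢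
    omega
  rw [← Finset.sum_subset hsub, Finset.sum_pair (by omega)] at key
  · have e1 : k + 1 - k = 1 := by omega
    rw [e1, prodPhi_one, phi_one, phi_one, prodPhi_one, Nat.add_sub_cancel, shiftWord_apply,
      zero_add] at key
    simp only [map_zero, zero_mul, mul_zero, zero_sub, sub_zero] at key
    linear_combination key
  · intro i hi hi'
    simp only [Finset.mem_insert, Finset.mem_singleton, Finset.mem_range] at hi hi'
    rcases (by omega : i = 0 ∨ i = k + 1 ∨ (2 ≤ i ∧ 2 ≤ k + 1 - i)) with rfl | rfl | ⟨h1, h2⟩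
    · simp
    · simp
    · rw [h.phi_of_two_le h1, h.phi_of_two_le h2, mul_neg, neg_mul, map_neg, map_neg,
        h.integralA_dm_mul, sub_self]

lemma integralA_prodPhi_rotate_one {k : ℕ} (hk : 2 ≤ k) {p : ℕ → ℤ} {v : ℕ → A.carrier}
    (hv : ∀ j, v j ∈ A.gr (p j))
    (h0 : A.integralA (h.prodPhi k (shiftWord 1 v) * v 0) = 0) :
    A.integralA (h.prodPhi k v * v k) = 0 := by
  have h1 := h.integralA_prodPhi_cyclic hk v
  rw [A.eps_of_mem (h.prodPhi_mem k fun j _ => hv j), smul_mul_assoc, map_smul, smul_eq_mul,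
    A.integralA_mul_comm (hv 0)
      (h.prodPhi_mem k (p := shiftWord 1 p) (v := shiftWord 1 v) fun j _ => hv (j + 1)),
    h0, mul_zero] at h1
  exact (mul_eq_zero.1 h1).resolve_left (sgn_ne_zero _)

lemma integralA_prodPhi_rotate {k : ℕ} (hk : 2 ≤ k) (m : ℕ) : ∀ {p : ℕ → ℤ} {v : ℕ → A.carrier},
    (∀ j, v j ∈ A.gr (p j)) → (∀ j, v (j + (k + 1)) = v j) →
    A.integralA (h.prodPhi k (shiftWord m v) * shiftWord m v k) = 0 →
    A.integralA (h.prodPhi k v * v k) = 0 := by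
  induction m with
  | zero => intro p v _ _ h0; simpa using h0
  | succ m ih =>
    intro p v hv hper h0
    refine h.integralA_prodPhi_rotate_one hk hv ?_
    have := ih (p := shiftWord 1 p) (v := shiftWord 1 v) (fun j => hv (j + 1))
      (fun j => by rw [shiftWord_apply, shiftWord_apply, ← hper (j + 1)]; congr 1; omega)
      (by rwa [shiftWord_shiftWord])
    rwa [shiftWord_apply, ← zero_add (k + 1), hper] at this

/-! ### Words in a single letter -/

/-- All products `M_k`, `k ≥ 3`, of a single homogeneous element vanish: only `φ_1` and `φ_2` are
nonzero, the two terms of `M_3` cancel and `M_4` is the square of the odd element `φ_2`. -/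
lemma prodPhi_const [CharZero K] {m : ℤ} {x : A.carrier} (hx : x ∈ A.gr m) {k : ℕ} (hk : 3 ≤ k) :
    h.prodPhi k (fun _ => x) = 0 := by
  induction k using Nat.strong_induction_on with
  | _ k ih =>
    have hphi : ∀ i, 3 ≤ i → i < k → h.phi i (fun _ => x) = 0 := by
      intro i hi hik
      rw [h.phi_of_two_le (by omega), ih i hik hi, map_zero, neg_zero]
    have h2 : h.phi 2 (fun _ => x) ∈ A.gr (2 * m - 1) := by
      have := h.phi_mem 2 (p := fun _ => m) (v := fun _ => x) fun _ _ => hx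
      convert this using 2
      simp; ring
    have hs : ∀ i, shiftWord i (fun _ : ℕ => x) = fun _ => x := fun i => rfl
    rcases (by omega : k = 3 ∨ k = 4 ∨ 5 ≤ k) with rfl | rfl | h5
    · simp only [prodPhi, Finset.sum_range_succ, Finset.sum_range_zero, hs]
      simp only [phi_zero, phi_one, map_zero, zero_mul, mul_zero, zero_add, add_zero, Nat.sub_self,
        (by omega : 3 - 1 = 2), (by omega : 3 - 2 = 1)]
      rw [A.eps_of_mem hx, A.eps_of_mem h2, smul_mul_assoc, smul_mul_assoc,
        A.mul_comm_of_mem h2 hx, smul_smul, ← sgn_add, ← add_smul,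
        sgn_congr (a := 2 * m - 1 + (2 * m - 1) * m) (b := 1 + m) (m * m - 1) (by ring), sgn_add]
      simp
    · have hsq : h.phi 2 (fun _ => x) * h.phi 2 (fun _ => x) = 0 := by
        have := A.mul_comm_of_mem h2 h2
        rw [sgn_odd (by exact ⟨2 * m * m - 2 * m, by ring⟩)] at this
        exact eq_zero_of_eq_neg (K := K) (by simpa using this)
      simp only [prodPhi, Finset.sum_range_succ, Finset.sum_range_zero, hs]
      rw [hphi 3 (by omega) (by omega)]
      simp [A.eps_of_mem h2, hsq]
    · refine Finset.sum_eq_zero fun i hi => ?_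
      rw [Finset.mem_range] at hi
      rw [hs]
      rcases (by omega : i = 0 ∨ i = k ∨ (3 ≤ i ∧ i < k) ∨ (3 ≤ k - i ∧ k - i < k)) with
        rfl | rfl | h1 | h1
      · simp
      · simp
      · rw [hphi i h1.1 h1.2]; simp
      · rw [hphi _ h1.1 h1.2]; simp

end HodgeHomotopy

end PoincareDGCA

/-! ### Harmonic representatives and Poincaré duality -/

namespace DGCA

variable {K : Type u} [Field K] (A : DGCA K)

lemma cohComponent_coe (k : ℤ) (x : A.Coh) :
    (A.cohComponent k x : A.Coh) = GradedAlgebra.proj A.cohGr k x := rfl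

lemma exists_cls_eq (x : A.Coh) : ∃ z, A.cls z = x := Ideal.Quotient.mk_surjective x

lemma cohProj_cls (k : ℤ) (z : A.cocycles) :
    GradedAlgebra.proj A.cohGr k (A.cls z) = A.cls (A.projZ k z) := by
  classical
  have hz : z = ∑ i ∈ (decompose A.gr (z : A.carrier)).support, A.projZ i z := by
    ext
    rw [AddSubmonoidClass.coe_finsetSum]
    exact (DirectSum.sum_support_decompose A.gr (z : A.carrier)).symm
  have hcls : ∀ i, A.cls (A.projZ i z) ∈ A.cohGr i := fun i => A.cls_mem (A.proj_mem i z)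
  conv_lhs => rw [hz]
  rw [map_sum, map_sum, Finset.sum_eq_single k]
  · rw [GradedAlgebra.proj_apply, DirectSum.decompose_of_mem_same A.cohGr (hcls k)]
  · intro i _ hik
    rw [GradedAlgebra.proj_apply, DirectSum.decompose_of_mem_ne A.cohGr (hcls i) hik]
  · intro hk
    rw [GradedAlgebra.proj_apply, DirectSum.decompose_of_mem_same A.cohGr (hcls k)]
    have : A.projZ k z = 0 := by
      ext
      exact DFinsupp.notMem_support_iff.1 hk |> fun e => by
        simpa [projZ, proj, GradedAlgebra.proj_apply] using e
    rw [this, map_zero]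

end DGCA

namespace PoincareDGCA

variable {K : Type u} [Field K] {n : ℕ} {A : PoincareDGCA K n}

lemma cohPairing_cls (z w : A.cocycles) :
    A.cohPairing n A.integral (A.cls z) (A.cls w) = A.integralA (z * w) := by
  rw [DGCA.cohPairing, integralA, LinearMap.comp_apply, ← A.cls_mul]
  congr 1
  apply Subtype.ext
  rw [A.cohComponent_coe, A.cohProj_cls]
  rfl

namespace HodgeHomotopy

variable (h : A.HodgeHomotopy)

/-- The class of a harmonic element. -/
def harmonicCls : h.harmonic →ₗ[K] A.Coh :=
  A.cls ∘ₗ h.harmonic.subtype.codRestrict (Subalgebra.toSubmodule A.cocycles)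
    fun x => h.d_of_mem x.2

lemma harmonicCls_eq_cls {x : h.harmonic} : h.harmonicCls x = A.cls ⟨x, h.d_of_mem x.2⟩ := rfl

lemma harmonicCls_injective : Function.Injective h.harmonicCls := by
  rw [injective_iff_map_eq_zero]
  intro x hx
  rw [harmonicCls_eq_cls, A.cls_eq_zero] at hx
  obtain ⟨b, hb⟩ := hx
  ext
  rw [← h.piH_coe x]
  change h.piH (x : A.carrier) = 0
  rw [← (show A.d b = x from hb), piH_d]

/-- The class of a cocycle is the class of its harmonic part. -/
lemma harmonicCls_toHarmonic (z : A.cocycles) : h.harmonicCls (h.toHarmonic z) = A.cls z := by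
  rw [harmonicCls_eq_cls, ← sub_eq_zero, ← map_sub, A.cls_eq_zero]
  refine ⟨- h.dm z, ?_⟩
  have := h.hodge (z : A.carrier)
  rw [A.mem_cocycles.1 z.2, map_zero, add_zero] at this
  change _ = h.piH z - (z : A.carrier)
  nth_rewrite 3 [this]
  simp

lemma harmonicCls_mem {k : ℤ} {x : h.harmonic} (hx : x ∈ h.harmonicGr k) :
    h.harmonicCls x ∈ A.cohGr k := A.cls_mem hx

/-- Every class of degree `k` has a unique harmonic representative. -/
lemma exists_harmonic_of_mem_cohGr {k : ℤ} {y : A.Coh} (hy : y ∈ A.cohGr k) :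
    ∃ x ∈ h.harmonicGr k, h.harmonicCls x = y := by
  obtain ⟨z, hz, rfl⟩ := A.mem_cohGr.1 hy
  exact ⟨h.toHarmonic z, h.piH_mem hz, h.harmonicCls_toHarmonic z⟩

lemma harmonic_eq_zero_of_cohGr {k : ℤ} (hk : A.cohGr k = ⊥) {x : A.carrier} (hx : x ∈ h.harmonic)
    (hxk : x ∈ A.gr k) : x = 0 := by
  have h1 := h.harmonicCls_mem (x := ⟨x, hx⟩) hxk
  rw [hk, Submodule.mem_bot] at h1
  exact congrArg Subtype.val (h.harmonicCls_injective (h1.trans (map_zero _).symm))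

lemma harmonic_degree_zero (h0 : A.cohGr 0 = LinearMap.range (Algebra.linearMap K A.Coh))
    {x : A.carrier} (hx : x ∈ h.harmonic) (hx0 : x ∈ A.gr 0) : ∃ c : K, x = c • 1 := by
  have h1 := h.harmonicCls_mem (x := ⟨x, hx⟩) hx0
  rw [h0] at h1
  obtain ⟨c, hc⟩ := h1
  refine ⟨c, ?_⟩
  have e : h.harmonicCls (c • h.one) = h.harmonicCls ⟨x, hx⟩ := by
    rw [← hc, map_smul, Algebra.linearMap_apply, Algebra.algebraMap_eq_smul_one]
    rfl
  exact (congrArg Subtype.val (h.harmonicCls_injective e)).symm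

lemma exists_harmonic_generator {k : ℤ} (hb : A.betti k = 1) :
    ∃ x ∈ h.harmonic, x ∈ A.gr k ∧ x ≠ 0 ∧
      ∀ y ∈ h.harmonic, y ∈ A.gr k → ∃ c : K, y = c • x := by
  have : Module.Free K (A.cohGr k) := Module.Free.of_divisionRing K _
  obtain ⟨g, hg0, hg⟩ := finrank_eq_one_iff'.1 hb
  obtain ⟨x, hx, hxg⟩ := h.exists_harmonic_of_mem_cohGr g.2
  refine ⟨x, x.2, hx, ?_, fun y hy hyk => ?_⟩
  · intro e
    rw [show x = 0 from Subtype.ext e, map_zero] at hxg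
    exact hg0 (Subtype.ext hxg.symm)
  · obtain ⟨c, hc⟩ := hg ⟨_, h.harmonicCls_mem (x := ⟨y, hy⟩) hyk⟩
    refine ⟨c, ?_⟩
    have e : h.harmonicCls ⟨y, hy⟩ = h.harmonicCls (c • x) := by
      rw [map_smul, hxg]
      exact (congrArg Subtype.val hc).symm
    exact congrArg Subtype.val (h.harmonicCls_injective e)

/-- Poincaré duality on harmonic elements. -/
lemma exists_integralA_mul_ne_zero {k : ℤ} {x : A.carrier} (hx : x ∈ h.harmonic) (hxk : x ∈ A.gr k)
    (hx0 : x ≠ 0) : ∃ y ∈ h.harmonic, y ∈ A.gr (n - k) ∧ A.integralA (x * y) ≠ 0 := by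
  have hc : A.cls ⟨x, h.d_of_mem hx⟩ ≠ 0 := by
    intro e
    exact hx0 (congrArg Subtype.val
      (h.harmonicCls_injective (a₁ := ⟨x, hx⟩) (e.trans (map_zero h.harmonicCls).symm)))
  obtain ⟨β, hβ⟩ : ∃ β, A.cohPairing n A.integral (A.cls ⟨x, h.d_of_mem hx⟩) β ≠ 0 := by
    by_contra! hcon
    exact hc (A.nondegenerate _ hcon)
  obtain ⟨z, rfl⟩ := A.exists_cls_eq β
  rw [cohPairing_cls] at hβ
  refine ⟨h.piH (A.proj (n - k) z), h.piH_mem_harmonic _, h.piH_mem (A.proj_mem _ _), ?_⟩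
  rw [h.integralA_mul_piH hx]
  intro e
  apply hβ
  change A.integralA (x * (z : A.carrier)) = 0
  obtain ⟨s, hs⟩ := A.sum_proj (z : A.carrier)
  rw [hs, Finset.mul_sum, map_sum]
  refine Finset.sum_eq_zero fun i _ => ?_
  by_cases hi : i = n - k
  · rw [hi, e]
  · exact A.integralA_of_ne (A.mul_mem hxk (A.proj_mem i _)) (by omega)

/-- A harmonic element which pairs to zero with the harmonic elements of complementary degree
vanishes. -/
lemma piH_eq_zero_of {k : ℤ} {a : A.carrier} (ha : a ∈ A.gr k)
    (h0 : ∀ y ∈ h.harmonic, y ∈ A.gr (n - k) → A.integralA (a * y) = 0) : h.piH a = 0 := by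
  by_contra hne
  obtain ⟨y, hy, hyk, hy0⟩ :=
    h.exists_integralA_mul_ne_zero (h.piH_mem_harmonic a) (h.piH_mem ha) hne
  rw [h.integralA_piH_mul hy] at hy0
  exact hy0 (h0 y hy hyk)

/-! ### Vanishing of the higher operations -/

/-- In an `(r-1)`-connected algebra, a homogeneous harmonic element is a multiple of the unit, zero,
or of degree at least `r`. -/
lemma harmonic_cases {r : ℕ} (hconn : A.IsConnectedUpTo r) {k : ℤ} {x : A.carrier}
    (hx : x ∈ h.harmonic) (hxk : x ∈ A.gr k) : (∃ c : K, x = c • 1) ∨ (r : ℤ) ≤ k := by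
  rcases (by omega : k < 0 ∨ k = 0 ∨ (1 ≤ k ∧ k ≤ (r : ℤ) - 1) ∨ (r : ℤ) ≤ k) with h1 | h1 | h1 | h1
  · left
    rw [A.gr_neg k h1, Submodule.mem_bot] at hxk
    exact ⟨0, by rw [hxk, zero_smul]⟩
  · subst h1
    exact Or.inl (h.harmonic_degree_zero hconn.2.1 hx hxk)
  · left
    exact ⟨0, by rw [h.harmonic_eq_zero_of_cohGr (hconn.2.2 k h1.1 h1.2) hx hxk, zero_smul]⟩
  · exact Or.inr h1

/-- `μ_k`, `k ≥ 3`, vanishes on a word of harmonic elements containing a multiple of the unit. -/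
lemma mu_of_eq_smul_one {k : ℕ} (hk : 3 ≤ k) (v : ℕ → A.carrier) (hv : ∀ j, v j ∈ h.harmonic)
    {i : ℕ} (hi : i < k) {c : K} (h1 : v i = c • 1) : h.mu k v = 0 := by
  have e : v = Function.update v i (c • 1 + (0 : K) • 1) := by
    rw [zero_smul, add_zero, ← h1, Function.update_eq_self]
  rw [e, mu, h.prodPhi_update k v i hi, zero_smul, add_zero, map_smul]
  change c • h.mu k _ = 0
  rw [h.mu_of_eq_one hk _ (fun j => ?_) hi (Function.update_self ..), smul_zero]
  by_cases hj : j = i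
  · subst hj
    rw [Function.update_self]
    exact h.one_mem_harmonic
  · rw [Function.update_of_ne hj]
    exact hv j

/-- The `k + 1` letters of a cyclic word with nonzero integral have total degree `n + k - 2`. By
cyclicity and unitality they have degree at least `r`, so that for `n ≤ (k + 1)(r - 1) + 4` at most
one of them is not of degree `r`. Rotating the word so that this letter comes last, one is left with
a product of multiples of a single element. -/
lemma mu_eq_zero [CharZero K] {r : ℕ} (hconn : A.IsConnectedUpTo r) (hb : A.betti r = 1) {k : ℕ}
    (hk : 3 ≤ k) (hn : (n : ℤ) ≤ (k + 1) * (r - 1) + 4) {p : ℕ → ℤ} {v : ℕ → A.carrier}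
    (hv : ∀ j, v j ∈ h.harmonic) (hvp : ∀ j, v j ∈ A.gr (p j)) : h.mu k v = 0 := by
  refine h.piH_eq_zero_of (h.prodPhi_mem k fun j _ => hvp j) fun y hy hyk => ?_
  -- the periodic word `(v_0, …, v_{k-1}, y, v_0, …)` and its degrees
  set w : ℕ → A.carrier := fun j => if j % (k + 1) < k then v (j % (k + 1)) else y with hw
  set q : ℕ → ℤ := fun j => if j % (k + 1) < k then p (j % (k + 1)) else
    n - (∑ j ∈ Finset.range k, p j + 2 - k) with hq
  have hwh : ∀ j, w j ∈ h.harmonic := by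
    intro j; simp only [hw]; split_ifs; exacts [hv _, hy]
  have hwq : ∀ j, w j ∈ A.gr (q j) := by
    intro j; simp only [hw, hq]; split_ifs; exacts [hvp _, hyk]
  have hmod : ∀ j, j < k + 1 → j % (k + 1) = j := fun j => Nat.mod_eq_of_lt
  have hper : ∀ j, w (j + (k + 1)) = w j := by
    intro j; simp only [hw, Nat.add_mod_right]
  have hqper : ∀ j, q (j % (k + 1)) = q j := by
    intro j; simp only [hq, Nat.mod_mod]
  have hwv : ∀ j < k, w j = v j := by
    intro j hj; simp only [hw, hmod j (by omega), hj, if_true]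
  have hwk : w k = y := by
    simp only [hw, hmod k (by omega), lt_irrefl, if_false]
  rw [← h.prodPhi_congr k hwv, ← hwk]
  have hrot : ∀ m, h.mu k (shiftWord m w) = 0 → A.integralA (h.prodPhi k w * w k) = 0 := by
    intro m hm
    refine h.integralA_prodPhi_rotate (by omega) m hwq hper ?_
    rw [← h.integralA_piH_mul (b := shiftWord m w k) (hwh _), show h.piH _ = 0 from hm,
      zero_mul, map_zero]
  by_cases hunit : ∃ m, ∃ c : K, w m = c • 1
  · obtain ⟨m, c, hm⟩ := hunit
    exact hrot m (h.mu_of_eq_smul_one hk _ (fun j => hwh _) (i := 0) (by omega) (c := c)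
      (by rw [shiftWord_apply, zero_add, hm]))
  · have hge : ∀ j, (r : ℤ) ≤ q j := fun j =>
      (h.harmonic_cases hconn (hwh j) (hwq j)).resolve_left fun hc => hunit ⟨j, hc⟩
    have hsum : ∑ j ∈ Finset.range (k + 1), q j = n + k - 2 := by
      rw [Finset.sum_range_succ, Finset.sum_congr rfl (g := p) fun j hj => ?_]
      · simp only [hq, hmod k (by omega), lt_irrefl, if_false]
        ring
      · rw [Finset.mem_range] at hj
        simp only [hq, hmod j (by omega), hj, if_true]
    have hle : ∑ j ∈ Finset.range (k + 1), (q j - r) ≤ 1 := by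
      rw [Finset.sum_sub_distrib, hsum, Finset.sum_const, Finset.card_range, nsmul_eq_mul]
      push_cast
      linarith
    obtain ⟨j₀, hj₀⟩ : ∃ j₀, ∀ j < k + 1, j ≠ j₀ → q j = r := by
      by_cases hex : ∃ j₀ < k + 1, q j₀ ≠ r
      · obtain ⟨j₀, hj₀, hne⟩ := hex
        refine ⟨j₀, fun j hj hjj => ?_⟩
        have hsub : ({j₀, j} : Finset ℕ) ⊆ Finset.range (k + 1) := by
          intro i hi
          simp only [Finset.mem_insert, Finset.mem_singleton, Finset.mem_range] at hi ⊢
          omega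
        have := Finset.sum_le_sum_of_subset_of_nonneg hsub (f := fun j => q j - r)
          fun i _ _ => sub_nonneg.2 (hge i)
        rw [Finset.sum_pair (Ne.symm hjj)] at this
        have h1 := hge j₀
        have h2 := hge j
        omega
      · push Not at hex
        exact ⟨0, fun j hj _ => hex j hj⟩
    obtain ⟨x, hxh, hxr, -, hx⟩ := h.exists_harmonic_generator hb
    refine hrot (j₀ + 1) ?_
    have hc : ∀ j < k, ∃ c : K, shiftWord (j₀ + 1) w j = c • x := by
      intro j hj
      refine hx _ (hwh _) ?_
      have e : q (j + (j₀ + 1)) = r := by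
        rw [← hqper]
        refine hj₀ _ (Nat.mod_lt _ (by omega)) fun e => ?_
        have e2 : (j + (j₀ + 1)) % (k + 1) = j₀ % (k + 1) := by
          rw [e, ← e, Nat.mod_mod]
        have e3 : j + 1 ≡ 0 [MOD k + 1] := by
          refine Nat.ModEq.add_right_cancel' j₀ ?_
          rw [zero_add]
          unfold Nat.ModEq
          rw [← e2]
          congr 1
          omega
        have := Nat.le_of_dvd (by omega) ((Nat.modEq_zero_iff_dvd).1 e3)
        omega
      rw [← e]
      exact hwq _
    choose! c hc using hc
    rw [mu, h.prodPhi_congr k (w := fun j => c j • x) hc, h.prodPhi_smul k c fun _ => x,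
      h.prodPhi_const hxr hk, smul_zero, map_zero]

/-- For `n ≤ 4 r` the triple product, which is `m_3` up to sign, vanishes on harmonic elements. -/
lemma piH_triple_eq_zero [CharZero K] {r : ℕ} (hconn : A.IsConnectedUpTo r) (hb : A.betti r = 1)
    (hn : n ≤ 4 * r) {i j k : ℤ} {a b c : A.carrier} (ha : a ∈ h.harmonic) (hb' : b ∈ h.harmonic)
    (hc : c ∈ h.harmonic) (hi : a ∈ A.gr i) (hj : b ∈ A.gr j) (hk : c ∈ A.gr k) :
    h.piH (h.dm (a * b) * c - A.eps a * h.dm (b * c)) = 0 := by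
  set v : ℕ → A.carrier := fun l => if l = 0 then a else if l = 1 then A.eps b else c with hv
  set p : ℕ → ℤ := fun l => if l = 0 then i else if l = 1 then j else k with hp
  have hvh : ∀ l, v l ∈ h.harmonic := by
    intro l
    simp only [hv]
    split_ifs
    · exact ha
    · rw [h.mem_harmonic_iff, piH_eps, h.mem_harmonic_iff.1 hb']
    · exact hc
  have hvp : ∀ l, v l ∈ A.gr (p l) := by
    intro l
    simp only [hv, hp]
    split_ifs
    exacts [hi, A.eps_mem hj, hk]
  have key := h.mu_eq_zero hconn hb (k := 3) le_rfl (by push_cast; omega) hvh hvp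
  have e : h.prodPhi 3 v = h.dm (a * b) * c - A.eps a * h.dm (b * c) := by
    simp only [prodPhi, Finset.sum_range_succ, Finset.sum_range_zero]
    simp only [phi_zero, phi_one, map_zero, zero_mul, mul_zero, zero_add, add_zero, Nat.sub_self,
      (by omega : 3 - 1 = 2), (by omega : 3 - 2 = 1), h.phi_of_two_le le_rfl, prodPhi_two,
      shiftWord_apply, map_neg, ← h.dm_eps, A.eps_mul, A.eps_eps]
    rw [one_add_one_eq_two, show v 0 = a from rfl, show v 1 = A.eps b from rfl,
      show v 2 = c from rfl, A.eps_eps]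
    noncomm_ring
  rw [← e]
  exact key

lemma transferOp_eq_zero [CharZero K] {r : ℕ} (hconn : A.IsConnectedUpTo r) (hb : A.betti r = 1)
    {k : ℕ} (hk : 3 ≤ k) (hn : (n : ℤ) ≤ (k + 1) * (r - 1) + 4) : h.transferOp k = 0 := by
  ext v : 1
  refine h.multilinear_eq_zero_of_homogeneous _ (fun d v hv => ?_) v
  ext
  have := h.coe_transferOp_apply (k := k) (p := extendWord d) (v := extendWord v)
    fun j _ => h.extendWord_mem hv j
  simp only [extendWord_apply] at this
  rw [this, h.mu_eq_zero hconn hb hk hn (fun j => Subtype.prop _)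
    (fun j => h.extendWord_mem hv j), smul_zero]
  rfl

end HodgeHomotopy

end PoincareDGCA

/-! ### Strictification of a morphism with two components -/

namespace DGCA

variable {K : Type u} [Field K]

lemma exists_sum_proj_of_subset (A : DGCA K) (a : A.carrier) :
    ∃ s : Finset ℤ, ∀ t, s ⊆ t → a = ∑ k ∈ t, A.proj k a := by
  classical
  refine ⟨(decompose A.gr a).support, fun t ht =>
    (DirectSum.sum_support_decompose A.gr a).symm.trans ?_⟩
  refine Finset.sum_subset ht fun i _ hi => ?_
  rw [DFinsupp.notMem_support_iff.1 hi]
  rfl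

/-- A `C∞`-morphism `(P, c)` with two components, defined on a graded subalgebra `S` of `A` and with
values in an algebra `C` with zero differential: `P` is a chain map, `c` is a homotopy between
`P (a b)` and `P a · P b` which is unital, graded commutative and satisfies the associativity
relation with vanishing third component. The homotopy `c` and the defect `P (a b) - P a · P b` have
values in an ideal `E` of square zero. -/
structure TwoStepMorphism (A C : DGCA K) where
  S : Submodule K A.carrier
  E : Submodule K C.carrier
  P : A.carrier →ₗ[K] C.carrier
  c : A.carrier →ₗ[K] A.carrier →ₗ[K] C.carrier
  d_eq_zero : ∀ x, C.d x = 0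
  one_mem : 1 ∈ S
  mul_mem : ∀ {a b}, a ∈ S → b ∈ S → a * b ∈ S
  d_mem : ∀ {a}, a ∈ S → A.d a ∈ S
  proj_mem : ∀ k {a}, a ∈ S → A.proj k a ∈ S
  proj_mem_E : ∀ k {e}, e ∈ E → C.proj k e ∈ E
  mul_mem_left : ∀ x {e}, e ∈ E → x * e ∈ E
  mul_mem_right : ∀ x {e}, e ∈ E → e * x ∈ E
  mul_eq_zero : ∀ {e e'}, e ∈ E → e' ∈ E → e * e' = 0
  P_mem : ∀ {k a}, a ∈ A.gr k → P a ∈ C.gr k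
  P_d : ∀ a, P (A.d a) = 0
  P_one : P 1 = 1
  P_mul_mem : ∀ {a b}, a ∈ S → b ∈ S → P (a * b) - P a * P b ∈ E
  c_mem_gr : ∀ {i j a b}, a ∈ A.gr i → b ∈ A.gr j → c a b ∈ C.gr (i + j - 1)
  c_mem : ∀ {a b}, a ∈ S → b ∈ S → c a b ∈ E
  c_one_left : ∀ a, c 1 a = 0
  c_one_right : ∀ a, c a 1 = 0
  c_d : ∀ {a b}, a ∈ S → b ∈ S → P (a * b) - P a * P b = c (A.d a) b + c (A.eps a) (A.d b)
  c_comm : ∀ {i j a b}, a ∈ S → b ∈ S → a ∈ A.gr i → b ∈ A.gr j →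
    c a b = sgn K (i * j) • c b a
  c_assoc : ∀ {a b a'}, a ∈ S → b ∈ S → a' ∈ S →
    c (a * b) a' + c a b * P a' = c a (b * a') + C.eps (P a) * c b a'

namespace TwoStepMorphism

variable {A C : DGCA K} (T : TwoStepMorphism A C)

lemma P_proj (k : ℤ) (a : A.carrier) : T.P (A.proj k a) = C.proj k (T.P a) := by
  induction a using A.homogeneous_induction with
  | h0 => simp
  | hadd a b ha hb => simp [ha, hb]
  | hh j a ha =>
    by_cases hj : j = k
    · subst hj; rw [A.proj_same ha, C.proj_same (T.P_mem ha)]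
    · rw [A.proj_ne ha hj, C.proj_ne (T.P_mem ha) hj, map_zero]

lemma eps_mem_E {e : C.carrier} (he : e ∈ T.E) : C.eps e ∈ T.E := by
  obtain ⟨s, hs⟩ := C.sum_proj e
  rw [hs, map_sum]
  refine Submodule.sum_mem _ fun k _ => ?_
  rw [C.eps_of_mem (C.proj_mem k e)]
  exact Submodule.smul_mem _ _ (T.proj_mem_E k he)

/-- The triples `(h, a, e)` with `a ∈ S`, `e ∈ E` and `h ≡ P a` modulo `E`. -/
def triples : Submodule K (C.carrier × A.carrier × C.carrier) where
  carrier := {x | x.2.1 ∈ T.S ∧ x.2.2 ∈ T.E ∧ x.1 - T.P x.2.1 ∈ T.E}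
  zero_mem' := ⟨T.S.zero_mem, T.E.zero_mem, by simp⟩
  add_mem' := by
    rintro x y ⟨h1, h2, h3⟩ ⟨h1', h2', h3'⟩
    refine ⟨T.S.add_mem h1 h1', T.E.add_mem h2 h2', ?_⟩
    have := T.E.add_mem h3 h3'
    simp only [Prod.fst_add, Prod.snd_add, map_add]
    convert this using 1
    abel
  smul_mem' := by
    rintro k x ⟨h1, h2, h3⟩
    refine ⟨T.S.smul_mem k h1, T.E.smul_mem k h2, ?_⟩
    simpa [smul_sub] using T.E.smul_mem k h3

/-- The product `(h, a, e) (h', a', e') = (h h', a a', c(a, a') + e h' + ε(h) e')`. -/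
def mulFun (x y : C.carrier × A.carrier × C.carrier) : C.carrier × A.carrier × C.carrier :=
  (x.1 * y.1, x.2.1 * y.2.1, T.c x.2.1 y.2.1 + x.2.2 * y.1 + C.eps x.1 * y.2.2)

lemma mulFun_mem {x y : C.carrier × A.carrier × C.carrier} (hx : x ∈ T.triples)
    (hy : y ∈ T.triples) : T.mulFun x y ∈ T.triples := by
  obtain ⟨h1, h2, h3⟩ := hx
  obtain ⟨h1', h2', h3'⟩ := hy
  refine ⟨T.mul_mem h1 h1', ?_, ?_⟩
  · exact T.E.add_mem (T.E.add_mem (T.c_mem h1 h1') (T.mul_mem_right _ h2)) (T.mul_mem_left _ h2')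
  · have e : x.1 * y.1 - T.P (x.2.1 * y.2.1) =
        (x.1 - T.P x.2.1) * y.1 + T.P x.2.1 * (y.1 - T.P y.2.1) -
          (T.P (x.2.1 * y.2.1) - T.P x.2.1 * T.P y.2.1) := by
      noncomm_ring
    change x.1 * y.1 - T.P (x.2.1 * y.2.1) ∈ T.E
    rw [e]
    exact T.E.sub_mem (T.E.add_mem (T.mul_mem_right _ h3) (T.mul_mem_left _ h3'))
      (T.P_mul_mem h1 h1')

/-- The underlying space of the strictification. -/
def Carrier : Type u := T.triples

/-- The ring of triples; associativity is the relation `c_assoc`. -/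
instance : Ring T.Carrier :=
  { (inferInstance : AddCommGroup T.triples) with
    mul := fun x y => ⟨T.mulFun x.1 y.1, T.mulFun_mem x.2 y.2⟩
    one := ⟨(1, 1, 0), T.one_mem, T.E.zero_mem, by simp [T.P_one]⟩
    zero_mul := fun x => Subtype.ext (by
      change T.mulFun 0 x.1 = 0
      simp [mulFun])
    mul_zero := fun x => Subtype.ext (by
      change T.mulFun x.1 0 = 0
      simp [mulFun])
    one_mul := fun x => Subtype.ext (by
      change T.mulFun (1, 1, 0) x.1 = x.1
      simp [mulFun, T.c_one_left])
    mul_one := fun x => Subtype.ext (by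
      change T.mulFun x.1 (1, 1, 0) = x.1
      simp [mulFun, T.c_one_right])
    left_distrib := fun x y z => Subtype.ext (by
      change T.mulFun x.1 (y.1 + z.1) = T.mulFun x.1 y.1 + T.mulFun x.1 z.1
      simp only [mulFun, Prod.fst_add, Prod.snd_add, Prod.mk_add_mk, map_add, mul_add]
      congr 2
      abel)
    right_distrib := fun x y z => Subtype.ext (by
      change T.mulFun (x.1 + y.1) z.1 = T.mulFun x.1 z.1 + T.mulFun y.1 z.1
      simp only [mulFun, Prod.fst_add, Prod.snd_add, Prod.mk_add_mk, map_add, add_mul,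
        LinearMap.add_apply]
      congr 2
      abel)
    mul_assoc := fun x y z => Subtype.ext (by
      change T.mulFun (T.mulFun x.1 y.1) z.1 = T.mulFun x.1 (T.mulFun y.1 z.1)
      obtain ⟨⟨h1, a1, e1⟩, ha1, he1, hh1⟩ := x
      obtain ⟨⟨h2, a2, e2⟩, ha2, he2, hh2⟩ := y
      obtain ⟨⟨h3, a3, e3⟩, ha3, he3, hh3⟩ := z
      simp only [mulFun, mul_assoc]
      congr 2
      -- elements of `E` only see the classes of `h` modulo `E`
      have k1 : T.c a1 a2 * h3 = T.c a1 a2 * T.P a3 := by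
        rw [← sub_eq_zero, ← mul_sub]
        exact T.mul_eq_zero (T.c_mem ha1 ha2) hh3
      have k2 : C.eps h1 * T.c a2 a3 = C.eps (T.P a1) * T.c a2 a3 := by
        rw [← sub_eq_zero, ← sub_mul, ← map_sub]
        exact T.mul_eq_zero (T.eps_mem_E hh1) (T.c_mem ha2 ha3)
      have k3 := T.c_assoc ha1 ha2 ha3
      rw [add_mul, add_mul, mul_add, mul_add, k1, k2, C.eps_mul]
      simp only [← add_assoc, mul_assoc]
      rw [k3]
      abel) }

instance : Module K T.Carrier := inferInstanceAs (Module K T.triples)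

/-- The inclusion into the space of all triples. -/
def incl : T.Carrier →ₗ[K] C.carrier × A.carrier × C.carrier := T.triples.subtype

lemma incl_injective : Function.Injective T.incl := Subtype.val_injective

lemma incl_mul (x y : T.Carrier) : T.incl (x * y) = T.mulFun (T.incl x) (T.incl y) := rfl

lemma incl_mem (x : T.Carrier) : T.incl x ∈ T.triples := x.2

instance : Algebra K T.Carrier :=
  Algebra.ofModule
    (fun k x y => T.incl_injective (by
      rw [map_smul, incl_mul, incl_mul, map_smul]
      simp [mulFun, smul_add]))
    (fun k x y => T.incl_injective (by
      rw [map_smul, incl_mul, incl_mul, map_smul]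
      simp [mulFun, smul_add]))

/-- The degree of `(h, a, e)` is `k` if `h` and `a` have degree `k` and `e` has degree `k - 1`. -/
def gr (k : ℤ) : Submodule K T.Carrier :=
  ((C.gr k).prod ((A.gr k).prod (C.gr (k - 1)))).comap T.incl

lemma mem_gr {k : ℤ} {x : T.Carrier} : x ∈ T.gr k ↔ (T.incl x).1 ∈ C.gr k ∧
    (T.incl x).2.1 ∈ A.gr k ∧ (T.incl x).2.2 ∈ C.gr (k - 1) := Iff.rfl

/-- The projection of triples onto the component of degree `k`. -/
def projTriple (k : ℤ) :
    C.carrier × A.carrier × C.carrier →ₗ[K] C.carrier × A.carrier × C.carrier :=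
  (C.proj k).prodMap ((A.proj k).prodMap (C.proj (k - 1)))

lemma projTriple_mem (k : ℤ) {x : C.carrier × A.carrier × C.carrier} (hx : x ∈ T.triples) :
    projTriple k x ∈ T.triples := by
  refine ⟨T.proj_mem k hx.1, T.proj_mem_E _ hx.2.1, ?_⟩
  change C.proj k x.1 - T.P (A.proj k x.2.1) ∈ T.E
  rw [P_proj, ← map_sub]
  exact T.proj_mem_E k hx.2.2

lemma gr_isInternal : DirectSum.IsInternal T.gr := by
  classical
  refine isInternal_of_proj T.gr
    (fun k =>
      ((projTriple k).restrict fun _ hx => T.projTriple_mem k hx : T.triples →ₗ[K] T.triples))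
    ?_ ?_ ?_ ?_
  · intro k x
    exact ⟨C.proj_mem _ _, A.proj_mem _ _, C.proj_mem _ _⟩
  · intro k x hx
    exact T.incl_injective (Prod.ext (C.proj_same hx.1)
      (Prod.ext (A.proj_same hx.2.1) (C.proj_same hx.2.2)))
  · intro j k hjk x hx
    exact T.incl_injective (Prod.ext (C.proj_ne hx.1 hjk.symm)
      (Prod.ext (A.proj_ne hx.2.1 hjk.symm) (C.proj_ne hx.2.2 (by omega))))
  · intro x
    obtain ⟨s, hs⟩ := C.exists_sum_proj_of_subset (T.incl x).1
    obtain ⟨t, ht⟩ := A.exists_sum_proj_of_subset (T.incl x).2.1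
    obtain ⟨w, hw⟩ := C.exists_sum_proj_of_subset (T.incl x).2.2
    refine ⟨s ∪ t ∪ w.image (· + 1), T.incl_injective ?_⟩
    rw [map_sum]
    refine Prod.ext ?_ (Prod.ext ?_ ?_)
    · rw [Prod.fst_sum]
      exact hs _ (by intro i hi; simp [hi])
    · rw [Prod.snd_sum, Prod.fst_sum]
      exact ht _ (by intro i hi; simp [hi])
    · rw [Prod.snd_sum, Prod.snd_sum]
      refine (hw ((s ∪ t ∪ w.image (· + 1)).image (· - 1)) fun i hi => ?_).trans ?_
      · rw [Finset.mem_image]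
        exact ⟨i + 1, by simp [hi], by ring⟩
      · rw [Finset.sum_image fun i _ j _ hij => by simpa using hij]
        rfl

instance : GradedAlgebra T.gr where
  one_mem := ⟨C.one_mem, A.one_mem, Submodule.zero_mem _⟩
  mul_mem := by
    intro i j x y hx hy
    refine ⟨C.mul_mem hx.1 hy.1, A.mul_mem hx.2.1 hy.2.1, ?_⟩
    refine Submodule.add_mem _ (Submodule.add_mem _ (T.c_mem_gr hx.2.1 hy.2.1) ?_) ?_
    · have := C.mul_mem hx.2.2 hy.1
      rwa [sub_add_eq_add_sub] at this
    · have := C.mul_mem (C.eps_mem hx.1) hy.2.2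
      rwa [← add_sub_assoc] at this
  toDecomposition := T.gr_isInternal.chooseDecomposition

/-- The differential `d (h, a, e) = (0, d a, P a - h)`. -/
def dTriple : C.carrier × A.carrier × C.carrier →ₗ[K] C.carrier × A.carrier × C.carrier :=
  LinearMap.prod 0 (LinearMap.prod (A.d ∘ₗ LinearMap.fst K _ _ ∘ₗ LinearMap.snd K _ _)
    (T.P ∘ₗ LinearMap.fst K _ _ ∘ₗ LinearMap.snd K _ _ - LinearMap.fst K _ _))

lemma dTriple_apply (x : C.carrier × A.carrier × C.carrier) :
    T.dTriple x = (0, A.d x.2.1, T.P x.2.1 - x.1) := rfl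

lemma dTriple_mem {x : C.carrier × A.carrier × C.carrier} (hx : x ∈ T.triples) :
    T.dTriple x ∈ T.triples := by
  refine ⟨T.d_mem hx.1, ?_, ?_⟩
  · have := T.E.neg_mem hx.2.2
    rwa [neg_sub] at this
  · change 0 - T.P (A.d x.2.1) ∈ T.E
    rw [T.P_d, sub_zero]
    exact T.E.zero_mem

/-- The differential of the strictification. -/
def diff : T.Carrier →ₗ[K] T.Carrier :=
  (T.dTriple.restrict fun _ hx => T.dTriple_mem hx : T.triples →ₗ[K] T.triples)

lemma incl_diff (x : T.Carrier) : T.incl (T.diff x) = T.dTriple (T.incl x) := rfl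

/-- The strictification of a two-step morphism from `S` to `C`: the mapping cocylinder of `P`, whose
product is deformed by the homotopy `c`. -/
def strictification : DGCA K where
  carrier := T.Carrier
  gr := T.gr
  gr_neg k hk := by
    rw [eq_bot_iff]
    intro x hx
    rw [mem_gr, C.gr_neg k hk, A.gr_neg k hk, C.gr_neg (k - 1) (by omega), Submodule.mem_bot,
      Submodule.mem_bot, Submodule.mem_bot] at hx
    exact T.incl_injective (Prod.ext hx.1 (Prod.ext hx.2.1 hx.2.2))
  d := T.diff
  d_mem {k x} hx := by
    refine ⟨Submodule.zero_mem _, A.d_mem hx.2.1, ?_⟩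
    rw [add_sub_cancel_right]
    exact Submodule.sub_mem _ (T.P_mem hx.2.1) hx.1
  d_d x := T.incl_injective (by
    simp only [incl_diff, dTriple_apply, A.d_d, T.P_d, sub_zero, map_zero]
    rfl)
  leibniz {i x} y hx := T.incl_injective (by
    rw [negOnePow_smul_eq (K := K), map_add, map_smul]
    simp only [incl_diff, incl_mul, dTriple_apply, mulFun]
    have hcd := T.c_d (T.incl_mem x).1 (T.incl_mem y).1
    have hE := T.mul_eq_zero (T.incl_mem x).2.2 (T.incl_mem y).2.2
    rw [A.eps_of_mem hx.2.1, map_smul, LinearMap.smul_apply] at hcd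
    refine Prod.ext (by simp) (Prod.ext ?_ ?_)
    · change _ = _ + _
      rw [A.leibniz _ hx.2.1, negOnePow_smul_eq (K := K)]
      rfl
    · change T.P _ - _ = (T.c _ _ + _ + _) + sgn K i • (T.c _ _ + _ + _)
      rw [eq_add_of_sub_eq hcd, C.eps_of_mem hx.1, smul_add, smul_add, smul_mul_assoc, smul_smul,
        sgn_mul_self, one_smul, map_zero, zero_mul, mul_zero, smul_zero]
      rw [sub_mul, mul_sub, mul_sub] at hE
      rw [sub_mul, mul_sub]
      linear_combination (norm := abel) hE)
  graded_comm {i j x y} hx hy := T.incl_injective (by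
    rw [negOnePow_smul_eq (K := K), map_smul]
    simp only [incl_mul, mulFun]
    refine Prod.ext (C.mul_comm_of_mem hx.1 hy.1) (Prod.ext (A.mul_comm_of_mem hx.2.1 hy.2.1) ?_)
    change T.c _ _ + _ + _ = sgn K (i * j) • (T.c _ _ + _ + _)
    rw [T.c_comm (T.incl_mem x).1 (T.incl_mem y).1 hx.2.1 hy.2.1, smul_add, smul_add,
      C.eps_of_mem hx.1, C.eps_of_mem hy.1, C.mul_comm_of_mem hx.2.2 hy.1, smul_mul_assoc,
      C.mul_comm_of_mem hx.1 hy.2.2, smul_mul_assoc, smul_smul, smul_smul, ← sgn_add, ← sgn_add,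
      sgn_congr (a := i * j + j) (b := (i - 1) * j) j (by ring),
      sgn_congr (a := i + i * (j - 1)) (b := i * j) 0 (by ring)]
    abel)

/-- The projection of the strictification to `C`. -/
def toTarget : T.Carrier →ₐ[K] C.carrier :=
  AlgHom.ofLinearMap (LinearMap.fst K _ _ ∘ₗ T.incl) rfl fun _ _ => rfl

/-- The projection of the strictification to `A`. -/
def toSource : T.Carrier →ₐ[K] A.carrier :=
  AlgHom.ofLinearMap (LinearMap.fst K _ _ ∘ₗ LinearMap.snd K _ _ ∘ₗ T.incl) rfl fun _ _ => rfl

/-- The projection to `A` is a quasi-isomorphism if the inclusion of `S` is one. -/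
lemma quasiIsoTo_source (hinj : ∀ a ∈ T.S, A.d a = 0 → (∃ z, A.d z = a) → ∃ z ∈ T.S, A.d z = a)
    (hsurj : ∀ b, A.d b = 0 → ∃ a ∈ T.S, A.d a = 0 ∧ ∃ z, b = a + A.d z) :
    QuasiIsoTo T.strictification A := by
  refine ⟨T.toSource, fun k x hx => hx.2.1, fun x => rfl, ?_, ?_⟩
  · intro (x : T.Carrier) (hx : T.diff x = 0) ⟨y, hy⟩
    have hx1 : T.dTriple (T.incl x) = 0 := congrArg T.incl hx
    rw [dTriple_apply] at hx1
    have hd : A.d (T.incl x).2.1 = 0 := congrArg (fun z => z.2.1) hx1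
    have hP : T.P (T.incl x).2.1 - (T.incl x).1 = 0 := congrArg (fun z => z.2.2) hx1
    obtain ⟨z, hz, hza⟩ := hinj _ (T.incl_mem x).1 hd ⟨y, hy⟩
    refine ⟨(⟨(T.P z - (T.incl x).2.2, z, 0), hz, T.E.zero_mem, ?_⟩ : T.triples), ?_⟩
    · have := T.E.neg_mem (T.incl_mem x).2.1
      simpa using this
    · refine T.incl_injective (Prod.ext ?_ (Prod.ext hza ?_))
      · change 0 = (T.incl x).1
        rw [← sub_eq_zero.1 hP, ← hza, T.P_d]
      · change T.P z - (T.P z - (T.incl x).2.2) = _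
        abel
  · intro b hb
    obtain ⟨a, ha, hda, z, hz⟩ := hsurj b hb
    refine ⟨(⟨(T.P a, a, 0), ha, T.E.zero_mem, by simp⟩ : T.triples), ?_, z, hz⟩
    refine T.incl_injective (Prod.ext rfl (Prod.ext hda ?_))
    change T.P a - T.P a = 0
    exact sub_self _

/-- The projection to `C` is a quasi-isomorphism if `P` is one. -/
lemma quasiIsoTo_target (hinj : ∀ a ∈ T.S, A.d a = 0 → T.P a = 0 → ∃ z ∈ T.S, A.d z = a)
    (hsurj : ∀ b, ∃ a ∈ T.S, A.d a = 0 ∧ T.P a = b) : QuasiIsoTo T.strictification C := by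
  refine ⟨T.toTarget, fun k x hx => hx.1, fun x => (T.d_eq_zero _).symm, ?_, ?_⟩
  · intro (x : T.Carrier) (hx : T.diff x = 0) ⟨y, hy⟩
    rw [T.d_eq_zero] at hy
    have hy' : (T.incl x).1 = 0 := hy.symm
    have hx1 : T.dTriple (T.incl x) = 0 := congrArg T.incl hx
    rw [dTriple_apply] at hx1
    have hd : A.d (T.incl x).2.1 = 0 := congrArg (fun z => z.2.1) hx1
    have hP : T.P (T.incl x).2.1 - (T.incl x).1 = 0 := congrArg (fun z => z.2.2) hx1
    rw [hy', sub_zero] at hP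
    obtain ⟨z, hz, hza⟩ := hinj _ (T.incl_mem x).1 hd hP
    refine ⟨(⟨(T.P z - (T.incl x).2.2, z, 0), hz, T.E.zero_mem, ?_⟩ : T.triples), ?_⟩
    · have := T.E.neg_mem (T.incl_mem x).2.1
      simpa using this
    · refine T.incl_injective (Prod.ext hy'.symm (Prod.ext hza ?_))
      change T.P z - (T.P z - (T.incl x).2.2) = _
      abel
  · intro b _
    obtain ⟨a, ha, hda, hPa⟩ := hsurj b
    refine ⟨(⟨(T.P a, a, 0), ha, T.E.zero_mem, by simp⟩ : T.triples), ?_, 0, ?_⟩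
    · refine T.incl_injective (Prod.ext rfl (Prod.ext hda ?_))
      change T.P a - T.P a = 0
      exact sub_self _
    · rw [map_zero, add_zero]
      exact hPa.symm

end TwoStepMorphism

end DGCA

/-! ### The small model and the homotopy of the product -/

namespace DGCA

variable {K : Type u} [Field K] (C : DGCA K)

/-- The elements all of whose components have degree at least `m`. -/
def geSub (m : ℤ) : Submodule K C.carrier where
  carrier := {e | ∀ k < m, C.proj k e = 0}
  zero_mem' := fun k _ => map_zero _
  add_mem' := fun ha hb k hk => by rw [map_add, ha k hk, hb k hk, add_zero]
  smul_mem' := fun c a ha k hk => by rw [map_smul, ha k hk, smul_zero]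

variable {C}

lemma mem_geSub_of_mem {m k : ℤ} (hk : m ≤ k) {e : C.carrier} (he : e ∈ C.gr k) :
    e ∈ C.geSub m := fun _ hj => C.proj_ne he (by omega)

lemma mem_geSub_zero (e : C.carrier) : e ∈ C.geSub 0 := fun k hk => by
  have := C.proj_mem k e
  rwa [C.gr_neg k hk, Submodule.mem_bot] at this

lemma proj_mem_geSub {m : ℤ} (k : ℤ) {e : C.carrier} (he : e ∈ C.geSub m) :
    C.proj k e ∈ C.geSub m := by
  by_cases hk : k < m
  · rw [he k hk]; exact Submodule.zero_mem _
  · exact mem_geSub_of_mem (by omega) (C.proj_mem k e)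

lemma mul_mem_geSub {m m' : ℤ} {e e' : C.carrier} (he : e ∈ C.geSub m) (he' : e' ∈ C.geSub m') :
    e * e' ∈ C.geSub (m + m') := by
  obtain ⟨s, hs⟩ := C.sum_proj e
  obtain ⟨t, ht⟩ := C.sum_proj e'
  rw [hs, ht, Finset.sum_mul_sum]
  refine Submodule.sum_mem _ fun i _ => Submodule.sum_mem _ fun j _ => ?_
  by_cases hi : i < m
  · rw [he i hi, zero_mul]; exact Submodule.zero_mem _
  by_cases hj : j < m'
  · rw [he' j hj, mul_zero]; exact Submodule.zero_mem _
  exact mem_geSub_of_mem (by omega) (C.mul_mem (C.proj_mem i e) (C.proj_mem j e'))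

lemma eq_zero_of_mem_geSub {m : ℤ} (hm : ∀ k, m ≤ k → C.gr k = ⊥) {e : C.carrier}
    (he : e ∈ C.geSub m) : e = 0 := by
  obtain ⟨s, hs⟩ := C.sum_proj e
  rw [hs]
  refine Finset.sum_eq_zero fun k _ => ?_
  by_cases hk : k < m
  · exact he k hk
  · have := C.proj_mem k e
    rwa [hm k (by omega), Submodule.mem_bot] at this

end DGCA

namespace PoincareDGCA

variable {K : Type u} [Field K] {n : ℕ} {A : PoincareDGCA K n}

/-- Integration by parts. -/
lemma integralA_mul_d (w v : A.carrier) :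
    A.integralA (w * A.d v) = A.integralA (A.eps (A.d w) * v) := by
  have := A.integralA_d (A.eps w * v)
  rw [A.d_mul, A.d_eps, A.eps_eps, map_add, neg_mul, map_neg] at this
  linear_combination this

namespace HodgeHomotopy

variable (h : A.HodgeHomotopy)

/-- The class of the harmonic part. -/
def harmonicClass : A.carrier →ₗ[K] A.cohomology.carrier := h.harmonicCls ∘ₗ h.toHarmonic

lemma harmonicClass_eq_zero {a : A.carrier} : h.harmonicClass a = 0 ↔ h.piH a = 0 := by
  rw [← h.coe_toHarmonic, Submodule.coe_eq_zero]
  exact map_eq_zero_iff _ h.harmonicCls_injective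

lemma harmonicClass_piH (a : A.carrier) : h.harmonicClass (h.piH a) = h.harmonicClass a := by
  rw [← sub_eq_zero, ← map_sub, harmonicClass_eq_zero, map_sub, piH_piH, sub_self]

lemma harmonicClass_mem {k : ℤ} {a : A.carrier} (ha : a ∈ A.gr k) :
    h.harmonicClass a ∈ A.cohomology.gr k := h.harmonicCls_mem (x := h.toHarmonic a) (h.piH_mem ha)

lemma harmonicClass_of_closed {z : A.carrier} (hz : A.d z = 0) :
    h.harmonicClass z = A.cls ⟨z, hz⟩ := h.harmonicCls_toHarmonic ⟨z, hz⟩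

/-- The class of a product of harmonic parts is the product of the classes. -/
lemma harmonicClass_mul (a b : A.carrier) :
    h.harmonicClass a * h.harmonicClass b = h.harmonicClass (h.piH a * h.piH b) := by
  have hd : A.d (h.piH a * h.piH b) = 0 := by rw [A.d_mul]; simp
  rw [← h.harmonicClass_piH a, ← h.harmonicClass_piH b, h.harmonicClass_of_closed hd,
    h.harmonicClass_of_closed (h.d_piH a), h.harmonicClass_of_closed (h.d_piH b)]
  rfl

lemma harmonicClass_one : h.harmonicClass 1 = 1 := by
  rw [h.harmonicClass_of_closed A.d_one]
  rfl

/-- `d⁻ a · b + ε(π a) · d⁻ b`, whose harmonic class is the homotopy `c` between `P (a b)` and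
`P a · P b`, where `P` is the harmonic class. -/
def productHomotopy : A.carrier →ₗ[K] A.carrier →ₗ[K] A.carrier :=
  (LinearMap.mul K A.carrier).compl₁₂ h.dm LinearMap.id +
    (LinearMap.mul K A.carrier).compl₁₂ (A.eps ∘ₗ h.piH) h.dm

lemma productHomotopy_apply (a b : A.carrier) :
    h.productHomotopy a b = h.dm a * b + A.eps (h.piH a) * h.dm b := rfl

lemma productHomotopy_mem {i j : ℤ} {a b : A.carrier} (ha : a ∈ A.gr i) (hb : b ∈ A.gr j) :
    h.productHomotopy a b ∈ A.gr (i + j - 1) := by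
  refine Submodule.add_mem _ ?_ ?_
  · have := A.mul_mem (h.dm_mem ha) hb
    rwa [sub_add_eq_add_sub] at this
  · have := A.mul_mem (A.eps_mem (h.piH_mem ha)) (h.dm_mem hb)
    rwa [← add_sub_assoc] at this

/-- `P (a b) - P a · P b` is the boundary of the homotopy `c`. -/
lemma harmonicClass_mul_sub (a b : A.carrier) :
    h.harmonicClass (a * b) - h.harmonicClass a * h.harmonicClass b =
      h.harmonicClass (h.productHomotopy (A.d a) b) +
        h.harmonicClass (h.productHomotopy (A.eps a) (A.d b)) := by
  rw [harmonicClass_mul, ← map_sub, ← map_add, ← sub_eq_zero, ← map_sub, harmonicClass_eq_zero]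
  have e : a * b - h.piH a * h.piH b - (h.productHomotopy (A.d a) b +
      h.productHomotopy (A.eps a) (A.d b)) =
      A.d (h.dm a * b) + A.d (A.eps (h.piH a) * h.dm b) := by
    have h1 : a * b = h.piH a * b + A.d (h.dm a) * b + h.dm (A.d a) * b := by
      nth_rewrite 1 [h.hodge a]
      rw [add_mul, add_mul]
    have h2 : h.piH a * b = h.piH a * h.piH b + h.piH a * A.d (h.dm b) +
        h.piH a * h.dm (A.d b) := by
      nth_rewrite 1 [h.hodge b]
      rw [mul_add, mul_add]
    rw [h1, h2, productHomotopy_apply, productHomotopy_apply, A.d_mul, A.d_mul, piH_d, map_zero,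
      zero_mul, h.dm_eps, h.piH_eps, A.eps_eps, A.d_eps, d_piH, map_zero]
    simp only [neg_mul, neg_zero, zero_mul]
    abel
  rw [e, map_add, piH_d, piH_d, add_zero]

/-- The hypotheses under which formality is proved: `x` spans the harmonic space of degree `r`, the
degree is at most `4 r`, and the operation `m_3` vanishes. -/
structure FormalRange (r : ℕ) (x : A.carrier) : Prop where
  two_le : 2 ≤ r
  conn : A.IsConnectedUpTo r
  le : n ≤ 4 * r
  mem_harmonic : x ∈ h.harmonic
  mem_gr : x ∈ A.gr r
  exists_smul : ∀ y ∈ h.harmonic, y ∈ A.gr r → ∃ c : K, y = c • x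
  mu_three : ∀ {i j k : ℤ} {a b c : A.carrier}, a ∈ h.harmonic → b ∈ h.harmonic → c ∈ h.harmonic →
    a ∈ A.gr i → b ∈ A.gr j → c ∈ A.gr k →
      h.piH (h.dm (a * b) * c - A.eps a * h.dm (b * c)) = 0

/-- The elements of degree at least `2 r - 1` whose component of degree `2 r - 1` is a multiple of
`d⁻ (x²)`. -/
def tail (r : ℕ) (x : A.carrier) : Submodule K A.carrier :=
  A.geSub (2 * r - 1) ⊓ (K ∙ h.dm (x * x)).comap (A.proj (2 * r - 1))

/-- The subspace of the `a ∈ A` for which `d⁻ a` and `d⁻ d a` lie in the tail; below degree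
`2 r - 1` it consists of harmonic elements. -/
def smallModel (r : ℕ) (x : A.carrier) : Submodule K A.carrier :=
  (h.tail r x).comap h.dm ⊓ (h.tail r x).comap (h.dm ∘ₗ A.d)

variable {h} {r : ℕ} {x : A.carrier}

lemma mem_tail {a : A.carrier} : a ∈ h.tail r x ↔
    a ∈ A.geSub (2 * r - 1) ∧ A.proj (2 * r - 1) a ∈ K ∙ h.dm (x * x) := Iff.rfl

lemma mem_smallModel {a : A.carrier} : a ∈ h.smallModel r x ↔
    h.dm a ∈ h.tail r x ∧ h.dm (A.d a) ∈ h.tail r x := Iff.rfl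

lemma proj_mem_tail (k : ℤ) {a : A.carrier} (ha : a ∈ h.tail r x) : A.proj k a ∈ h.tail r x := by
  refine mem_tail.2 ⟨DGCA.proj_mem_geSub k ha.1, ?_⟩
  by_cases hk : k = 2 * r - 1
  · subst hk
    rw [A.proj_same (A.proj_mem _ _)]
    exact ha.2
  · rw [A.proj_ne (A.proj_mem k a) hk]
    exact Submodule.zero_mem _

lemma mem_tail_of_mem {k : ℤ} (hk : 2 * (r : ℤ) ≤ k) {a : A.carrier} (ha : a ∈ A.gr k) :
    a ∈ h.tail r x := by
  refine mem_tail.2 ⟨DGCA.mem_geSub_of_mem (by omega) ha, ?_⟩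
  rw [A.proj_ne ha (by omega)]
  exact Submodule.zero_mem _

lemma eq_zero_of_mem_tail {a : A.carrier} (ha : a ∈ h.tail r x) {k : ℤ} (hk : a ∈ A.gr k)
    (hkr : k < 2 * r - 1) : a = 0 := by
  rw [← A.proj_same hk]
  exact ha.1 k hkr

lemma exists_smul_of_mem_tail {a : A.carrier} (ha : a ∈ h.tail r x) {k : ℤ} (hk : a ∈ A.gr k)
    (hkr : k ≤ 2 * r - 1) : ∃ c : K, a = c • h.dm (x * x) := by
  rcases hkr.lt_or_eq with hlt | rfl
  · exact ⟨0, by rw [eq_zero_of_mem_tail ha hk hlt, zero_smul]⟩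
  · have := (mem_tail.1 ha).2
    rw [A.proj_same hk] at this
    obtain ⟨c, hc⟩ := Submodule.mem_span_singleton.1 this
    exact ⟨c, hc.symm⟩

lemma eps_mem_of_proj_mem {S : Submodule K A.carrier} (hS : ∀ k a, a ∈ S → A.proj k a ∈ S)
    {a : A.carrier} (ha : a ∈ S) : A.eps a ∈ S := by
  obtain ⟨s, hs⟩ := A.sum_proj a
  rw [hs, map_sum]
  refine Submodule.sum_mem _ fun k _ => ?_
  rw [A.eps_of_mem (A.proj_mem k a)]
  exact Submodule.smul_mem _ _ (hS k a ha)

lemma eps_mem_tail {a : A.carrier} (ha : a ∈ h.tail r x) : A.eps a ∈ h.tail r x :=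
  eps_mem_of_proj_mem (fun k _ => proj_mem_tail k) ha

lemma harmonic_le_smallModel {a : A.carrier} (ha : a ∈ h.harmonic) : a ∈ h.smallModel r x := by
  refine mem_smallModel.2 ⟨?_, ?_⟩
  · rw [h.dm_of_mem ha]; exact Submodule.zero_mem _
  · rw [h.d_of_mem ha, map_zero]
    exact Submodule.zero_mem _

lemma d_mem_smallModel {a : A.carrier} (ha : a ∈ h.smallModel r x) : A.d a ∈ h.smallModel r x := by
  refine mem_smallModel.2 ⟨ha.2, ?_⟩
  rw [A.d_d, map_zero]
  exact Submodule.zero_mem _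

lemma dm_mem_smallModel {a : A.carrier} (ha : a ∈ h.smallModel r x) :
    h.dm a ∈ h.smallModel r x := by
  refine mem_smallModel.2 ⟨?_, ?_⟩
  · rw [h.dm_dm]
    exact Submodule.zero_mem _
  · rw [h.dm_d_dm]
    exact ha.1

lemma proj_mem_smallModel (k : ℤ) {a : A.carrier} (ha : a ∈ h.smallModel r x) :
    A.proj k a ∈ h.smallModel r x := by
  refine ⟨?_, ?_⟩
  · have := proj_mem_tail (k - 1) ha.1
    rwa [h.proj_dm, sub_add_cancel] at this
  · have := proj_mem_tail k ha.2
    rwa [LinearMap.comp_apply, h.proj_dm, A.proj_d] at this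

lemma eps_mem_smallModel {a : A.carrier} (ha : a ∈ h.smallModel r x) :
    A.eps a ∈ h.smallModel r x := eps_mem_of_proj_mem (fun k _ => proj_mem_smallModel k) ha

lemma smallModel_induction {p : A.carrier → Prop} (h0 : p 0)
    (hadd : ∀ a b, p a → p b → p (a + b))
    (hh : ∀ k a, a ∈ h.smallModel r x → a ∈ A.gr k → p a) {a : A.carrier}
    (ha : a ∈ h.smallModel r x) : p a := by
  obtain ⟨s, hs⟩ := A.sum_proj a
  rw [hs]
  exact Finset.sum_induction _ p hadd h0 fun k _ => hh k _ (proj_mem_smallModel k ha)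
    (A.proj_mem k a)

/-- Below degree `2 r - 1` the elements of the small model are harmonic. -/
lemma mem_harmonic_of_lt {a : A.carrier} (ha : a ∈ h.smallModel r x) {k : ℤ} (hk : a ∈ A.gr k)
    (hkr : k < 2 * r - 1) : a ∈ h.harmonic := by
  have h1 : h.dm a = 0 := eq_zero_of_mem_tail ha.1 (h.dm_mem hk) (by omega)
  have h2 : h.dm (A.d a) = 0 :=
    eq_zero_of_mem_tail ha.2 (k := k) (by simpa using h.dm_mem (A.d_mem hk)) hkr
  rw [h.mem_harmonic_iff]
  conv_rhs => rw [h.hodge a, h1, h2, map_zero, add_zero, add_zero]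

namespace FormalRange


lemma tail_gen_mem (H : h.FormalRange r x) : h.dm (x * x) ∈ A.gr (2 * r - 1) := by
  have := h.dm_mem (A.mul_mem H.mem_gr H.mem_gr)
  rwa [← two_mul] at this

/-- `d⁻ (x²)` has odd degree. -/
lemma tail_gen_sq [CharZero K] (H : h.FormalRange r x) : h.dm (x * x) * h.dm (x * x) = 0 := by
  have := A.mul_comm_of_mem H.tail_gen_mem H.tail_gen_mem
  rw [sgn_odd (by exact ⟨2 * r * r - 2 * r, by ring⟩)] at this
  exact eq_zero_of_eq_neg (K := K) (by simpa using this)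

lemma tail_gen_mem_tail (H : h.FormalRange r x) : h.dm (x * x) ∈ h.tail r x := by
  refine mem_tail.2 ⟨DGCA.mem_geSub_of_mem le_rfl H.tail_gen_mem, ?_⟩
  rw [A.proj_same H.tail_gen_mem]
  exact Submodule.mem_span_singleton_self _

/-- Homogeneous elements of the small model are multiples of the unit or of degree at least `r`. -/
lemma eq_smul_one_or_le (H : h.FormalRange r x) {a : A.carrier} (ha : a ∈ h.smallModel r x)
    {k : ℤ} (hk : a ∈ A.gr k) :
    (∃ c : K, a = c • 1) ∨ (r : ℤ) ≤ k := by
  have := H.two_le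
  by_cases hkr : k < 2 * r - 1
  · exact h.harmonic_cases H.conn (mem_harmonic_of_lt ha hk hkr) hk
  · exact Or.inr (by omega)

/-- The small model is closed under products: by degree reasons, only the product of two multiples
of `x` has to be considered, and `d⁻ (x²)` is in the tail by definition. -/
lemma mul_mem_smallModel (H : h.FormalRange r x) {a b : A.carrier} (ha : a ∈ h.smallModel r x)
    (hb : b ∈ h.smallModel r x) : a * b ∈ h.smallModel r x := by
  have hr := H.two_le
  refine smallModel_induction (p := fun a => a * b ∈ h.smallModel r x) (by simp)
    (fun a c ha hc => by rw [add_mul]; exact Submodule.add_mem _ ha hc) (fun i a ha hi => ?_) ha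
  refine smallModel_induction (p := fun b => a * b ∈ h.smallModel r x) (by simp)
    (fun b c hb hc => by rw [mul_add]; exact Submodule.add_mem _ hb hc) (fun j b hb hj => ?_) hb
  rcases H.eq_smul_one_or_le ha hi with ⟨c, rfl⟩ | hi'
  · rw [smul_one_mul]; exact Submodule.smul_mem _ _ hb
  rcases H.eq_smul_one_or_le hb hj with ⟨c, rfl⟩ | hj'
  · rw [mul_smul_one]; exact Submodule.smul_mem _ _ ha
  have hab := A.mul_mem hi hj
  by_cases hlt : 2 * (r : ℤ) < i + j
  · refine ⟨mem_tail_of_mem (by omega) (h.dm_mem hab),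
      mem_tail_of_mem (k := i + j) (by omega) ?_⟩
    simpa using h.dm_mem (A.d_mem hab)
  · obtain rfl : i = r := by omega
    obtain rfl : j = r := by omega
    have ha' := mem_harmonic_of_lt ha hi (by omega)
    have hb' := mem_harmonic_of_lt hb hj (by omega)
    obtain ⟨α, rfl⟩ := H.exists_smul a ha' hi
    obtain ⟨β, rfl⟩ := H.exists_smul b hb' hj
    rw [smul_mul_smul_comm]
    refine Submodule.smul_mem _ _ (mem_smallModel.2 ⟨H.tail_gen_mem_tail, ?_⟩)
    rw [A.d_mul, h.d_of_mem H.mem_harmonic]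
    simp

/-- Products of two elements of `im d⁻` in the tail have no harmonic part. -/
lemma piH_dm_mul_dm [CharZero K] (H : h.FormalRange r x) {i j : ℤ} {a b : A.carrier}
    (ha : h.dm a ∈ h.tail r x) (hb : h.dm b ∈ h.tail r x) (hi : h.dm a ∈ A.gr i) (hj : h.dm b ∈ A.gr j) :
    h.piH (h.dm a * h.dm b) = 0 := by
  have hr := H.two_le
  have hn := H.le
  refine h.piH_eq_zero_of (A.mul_mem hi hj) fun u hu hud => ?_
  rcases h.harmonic_cases H.conn hu hud with ⟨c, rfl⟩ | hd
  · rw [mul_smul_one, map_smul, h.integralA_dm_mul_dm, smul_zero]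
  · by_cases hi' : i < 2 * r - 1
    · rw [eq_zero_of_mem_tail ha hi hi', zero_mul, zero_mul, map_zero]
    by_cases hj' : j < 2 * r - 1
    · rw [eq_zero_of_mem_tail hb hj hj', mul_zero, zero_mul, map_zero]
    obtain ⟨α, hα⟩ := exists_smul_of_mem_tail ha hi (by omega)
    obtain ⟨β, hβ⟩ := exists_smul_of_mem_tail hb hj (by omega)
    rw [hα, hβ, smul_mul_smul_comm, H.tail_gen_sq, smul_zero, zero_mul, map_zero]

/-- Two elements of the tail and an element of degree at least `r` have too large a degree for a
nonzero integral, unless `r = 2` and both are multiples of `d⁻ (x²)`, whose square is zero. -/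
lemma integralA_mul_tail_mul_tail [CharZero K] (H : h.FormalRange r x) {i j l : ℤ} {p q a : A.carrier}
    (hp : p ∈ h.tail r x) (hq : q ∈ h.tail r x) (hi : p ∈ A.gr i) (hj : q ∈ A.gr j)
    (hl : a ∈ A.gr l) (hlr : (r : ℤ) ≤ l) : A.integralA (a * p * q) = 0 := by
  have hr := H.two_le
  have hn := H.le
  by_cases hd : l + i + j = n
  · by_cases hi' : i < 2 * r - 1
    · rw [eq_zero_of_mem_tail hp hi hi', mul_zero, zero_mul, map_zero]
    by_cases hj' : j < 2 * r - 1
    · rw [eq_zero_of_mem_tail hq hj hj', mul_zero, map_zero]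
    obtain ⟨α, rfl⟩ := exists_smul_of_mem_tail hp hi (by omega)
    obtain ⟨β, rfl⟩ := exists_smul_of_mem_tail hq hj (by omega)
    rw [mul_assoc, smul_mul_smul_comm, H.tail_gen_sq, smul_zero, mul_zero, map_zero]
  · exact A.integralA_of_ne (A.mul_mem (A.mul_mem hl hi) hj) hd

lemma integralA_tail_mul_mul_tail [CharZero K] (H : h.FormalRange r x) {i j l : ℤ} {p q a : A.carrier}
    (hp : p ∈ h.tail r x) (hq : q ∈ h.tail r x) (hi : p ∈ A.gr i) (hj : q ∈ A.gr j)
    (hl : a ∈ A.gr l) (hlr : (r : ℤ) ≤ l) : A.integralA (p * a * q) = 0 := by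
  rw [A.mul_comm_of_mem hi hl, smul_mul_assoc, map_smul,
    H.integralA_mul_tail_mul_tail hp hq hi hj hl hlr, smul_zero]

/-- The homotopy `c` has values in degrees at least `3 r - 1`. -/
lemma productHomotopy_mem_geSub (H : h.FormalRange r x) {a b : A.carrier} (ha : a ∈ h.smallModel r x)
    (hb : b ∈ h.smallModel r x) :
    h.harmonicClass (h.productHomotopy a b) ∈ A.cohomology.geSub (3 * r - 1) := by
  have hr := H.two_le
  refine smallModel_induction
    (p := fun a => h.harmonicClass (h.productHomotopy a b) ∈ A.cohomology.geSub (3 * r - 1))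
    (by simp) (fun a c ha hc => by
      rw [map_add, LinearMap.add_apply, map_add]; exact Submodule.add_mem _ ha hc)
    (fun i a ha hi => ?_) ha
  refine smallModel_induction
    (p := fun b => h.harmonicClass (h.productHomotopy a b) ∈ A.cohomology.geSub (3 * r - 1))
    (by simp) (fun b c hb hc => by
      rw [map_add, map_add]; exact Submodule.add_mem _ hb hc)
    (fun j b hb hj => ?_) hb
  have h0 : h.dm 1 = 0 := h.dm_of_mem h.one_mem_harmonic
  rcases H.eq_smul_one_or_le ha hi with ⟨c, rfl⟩ | hi'
  · have : h.harmonicClass (h.productHomotopy (c • 1) b) = 0 := by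
      rw [harmonicClass_eq_zero, productHomotopy_apply]
      simp [h0, h.piH_one]
    rw [this]; exact Submodule.zero_mem _
  rcases H.eq_smul_one_or_le hb hj with ⟨c, rfl⟩ | hj'
  · have : h.harmonicClass (h.productHomotopy a (c • 1)) = 0 := by
      rw [harmonicClass_eq_zero, productHomotopy_apply]
      simp [h0]
    rw [this]; exact Submodule.zero_mem _
  by_cases hd : 3 * (r : ℤ) ≤ i + j
  · exact DGCA.mem_geSub_of_mem (k := i + j - 1) (by omega)
      (h.harmonicClass_mem (h.productHomotopy_mem hi hj))
  · have h1 : h.dm a = 0 := eq_zero_of_mem_tail ha.1 (h.dm_mem hi) (by omega)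
    have h2 : h.dm b = 0 := eq_zero_of_mem_tail hb.1 (h.dm_mem hj) (by omega)
    rw [productHomotopy_apply, h1, h2, zero_mul, mul_zero, add_zero, map_zero]
    exact Submodule.zero_mem _

/-- The homotopy `c` is graded commutative: up to a coboundary, the commutator of
`d⁻ a · b + ε(π a) · d⁻ b` is a sum of products of two elements of `im d⁻` in the tail. -/
lemma productHomotopy_comm [CharZero K] (H : h.FormalRange r x) {i j : ℤ} {a b : A.carrier}
    (ha : a ∈ h.smallModel r x) (hb : b ∈ h.smallModel r x) (hi : a ∈ A.gr i) (hj : b ∈ A.gr j) :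
    h.harmonicClass (h.productHomotopy a b) =
      sgn K (i * j) • h.harmonicClass (h.productHomotopy b a) := by
  rw [← map_smul, ← sub_eq_zero, ← map_sub, harmonicClass_eq_zero]
  have e1 : sgn K (i * j) • h.productHomotopy b a =
      A.eps a * h.dm b + h.dm a * h.piH b := by
    rw [productHomotopy_apply, smul_add, A.eps_of_mem hi, A.eps_of_mem (h.piH_mem hj),
      A.mul_comm_of_mem (h.dm_mem hj) hi, smul_mul_assoc,
      A.mul_comm_of_mem (h.piH_mem hj) (h.dm_mem hi), smul_smul, smul_smul, smul_smul, ← sgn_add,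
      ← sgn_add, ← sgn_add, sgn_congr (a := i * j + (j - 1) * i) (b := i) (i * j - i) (by ring),
      sgn_congr (a := i * j + j + j * (i - 1)) (b := 0) (i * j) (by ring), sgn_zero, one_smul,
      smul_mul_assoc]
  have e2 : h.productHomotopy a b - sgn K (i * j) • h.productHomotopy b a =
      A.d (A.eps (h.dm a) * h.dm b) + h.dm a * h.dm (A.d b) - A.eps (h.dm (A.d a)) * h.dm b := by
    have h1 : h.dm a * b = h.dm a * h.piH b + h.dm a * A.d (h.dm b) + h.dm a * h.dm (A.d b) := by
      rw [← mul_add, ← mul_add, ← h.hodge]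
    have h2 : A.eps a * h.dm b = A.eps (h.piH a) * h.dm b + A.eps (A.d (h.dm a)) * h.dm b +
        A.eps (h.dm (A.d a)) * h.dm b := by
      rw [← add_mul, ← add_mul, ← map_add, ← map_add, ← h.hodge]
    rw [e1, productHomotopy_apply, A.d_mul, A.d_eps, A.eps_eps, h1, h2, neg_mul]
    abel
  have hdi : h.dm (A.d a) ∈ A.gr i := by simpa using h.dm_mem (A.d_mem hi)
  have hdj : h.dm (A.d b) ∈ A.gr j := by simpa using h.dm_mem (A.d_mem hj)
  rw [e2, map_sub, map_add, piH_d, H.piH_dm_mul_dm ha.1 hb.2 (h.dm_mem hi) hdj, A.eps_of_mem hdi,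
    smul_mul_assoc, map_smul, H.piH_dm_mul_dm ha.2 hb.1 hdi (h.dm_mem hj)]
  simp

end FormalRange

end HodgeHomotopy

end PoincareDGCA

/-! ### The associativity relation and formality -/

namespace PoincareDGCA

variable {K : Type u} [Field K] {n : ℕ} {A : PoincareDGCA K n}

namespace HodgeHomotopy

variable {h : A.HodgeHomotopy} {r : ℕ} {x : A.carrier}

/-- The defect of the associativity relation between the product and its homotopy `c`. -/
def assocDefect (h : A.HodgeHomotopy) (a b c : A.carrier) : A.carrier :=
  h.productHomotopy (a * b) c + h.piH (h.productHomotopy a b) * h.piH c -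
    (h.productHomotopy a (b * c) + A.eps (h.piH a) * h.piH (h.productHomotopy b c))

lemma harmonicClass_eps (h : A.HodgeHomotopy) (a : A.carrier) :
    h.harmonicClass (A.eps a) = A.cohomology.eps (h.harmonicClass a) := by
  induction a using A.homogeneous_induction with
  | h0 => simp
  | hadd a b ha hb => simp [ha, hb]
  | hh k a ha =>
    rw [A.eps_of_mem ha, A.cohomology.eps_of_mem (h.harmonicClass_mem ha), map_smul]

lemma cohomology_gr_eq_bot {k : ℤ} (hk : (n : ℤ) < k) : A.cohomology.gr k = ⊥ := by
  rw [eq_bot_iff]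
  rintro _ ⟨z, hz, rfl⟩
  have hz' : (z : A.carrier) ∈ A.gr k := hz
  rw [A.gr_top k hk, Submodule.mem_bot] at hz'
  exact A.cls_eq_zero.2 ⟨0, by rw [hz', map_zero]⟩

lemma piH_mem_smallModel (a : A.carrier) : h.piH a ∈ h.smallModel r x :=
  harmonic_le_smallModel (h.piH_mem_harmonic a)

namespace FormalRange

/-- The integral of the associativity defect vanishes: after integration by parts, every remaining
term contains two elements of the tail. -/
lemma integralA_assocDefect [CharZero K] (H : h.FormalRange r x) {i j k : ℤ} {a b c : A.carrier}
    (ha : a ∈ h.smallModel r x) (hb : b ∈ h.smallModel r x) (hc : c ∈ h.smallModel r x)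
    (hi : a ∈ A.gr i) (hj : b ∈ A.gr j) (hk : c ∈ A.gr k) (hir : (r : ℤ) ≤ i) (hjr : (r : ℤ) ≤ j) :
    A.integralA (h.assocDefect a b c) = 0 := by
  have hdi := A.d_mem hi
  have hdj := A.d_mem hj
  have hdk := A.d_mem hk
  have hπi : A.eps (h.piH a) ∈ A.gr i := A.eps_mem (h.piH_mem hi)
  have hπh : ∀ v, A.eps (h.piH v) ∈ h.harmonic := fun v => by
    rw [← h.piH_eps]; exact h.piH_mem_harmonic _
  have s1 : A.integralA (h.dm (a * b) * c) = A.integralA (A.eps a * A.eps b * h.dm c) := by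
    rw [h.integralA_dm_mul, A.eps_mul]
  have s6 : A.integralA (h.dm a * b * h.dm (A.d c)) = 0 :=
    H.integralA_tail_mul_mul_tail ha.1 hc.2 (h.dm_mem hi) (h.dm_mem hdk) hj hjr
  have s6' : A.integralA (A.eps (h.piH a) * h.dm b * h.dm (A.d c)) = 0 :=
    H.integralA_mul_tail_mul_tail hb.1 hc.2 (h.dm_mem hj) (h.dm_mem hdk) hπi hir
  have s7 : A.integralA (h.dm a * b * A.d (h.dm c)) =
      A.integralA (A.eps (A.d (h.dm a)) * A.eps b * h.dm c) := by
    have e : A.integralA (h.dm a * A.eps (A.d b) * h.dm c) = 0 :=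
      H.integralA_tail_mul_mul_tail ha.1 hc.1 (h.dm_mem hi) (h.dm_mem hk) (A.eps_mem hdj)
        (by omega)
    rw [integralA_mul_d, A.d_mul, map_add, A.eps_mul, A.eps_mul, A.eps_eps, add_mul, map_add, e,
      add_zero]
  have s8 : A.integralA (A.eps (h.piH a) * h.dm b * A.d (h.dm c)) =
      A.integralA (A.eps (h.piH a) * A.eps (A.d (h.dm b)) * h.dm c) := by
    rw [integralA_mul_d, A.d_mul, h.d_of_mem (hπh a), zero_mul, zero_add, A.eps_eps, A.eps_mul]
  have s9 : A.integralA (A.eps (h.dm (A.d a)) * A.eps b * h.dm c) = 0 :=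
    H.integralA_tail_mul_mul_tail (eps_mem_tail ha.2) hc.1 (A.eps_mem (h.dm_mem hdi)) (h.dm_mem hk)
      (A.eps_mem hj) hjr
  have s10 : A.integralA (A.eps (h.piH a) * A.eps (h.dm (A.d b)) * h.dm c) = 0 :=
    H.integralA_mul_tail_mul_tail (eps_mem_tail hb.2) hc.1 (A.eps_mem (h.dm_mem hdj)) (h.dm_mem hk)
      hπi hir
  -- Hodge decompositions of the three letters
  have hc1 : h.dm a * b * c = h.dm a * b * h.piH c + h.dm a * b * A.d (h.dm c) +
      h.dm a * b * h.dm (A.d c) := by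
    rw [← mul_add, ← mul_add, ← h.hodge]
  have hc2 : A.eps (h.piH a) * h.dm b * c = A.eps (h.piH a) * h.dm b * h.piH c +
      A.eps (h.piH a) * h.dm b * A.d (h.dm c) + A.eps (h.piH a) * h.dm b * h.dm (A.d c) := by
    rw [← mul_add, ← mul_add, ← h.hodge]
  have ha1 : A.eps a * A.eps b * h.dm c = A.eps (h.piH a) * A.eps b * h.dm c +
      A.eps (A.d (h.dm a)) * A.eps b * h.dm c + A.eps (h.dm (A.d a)) * A.eps b * h.dm c := by
    rw [← add_mul, ← add_mul, ← add_mul, ← add_mul, ← map_add, ← map_add, ← h.hodge]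
  have hb1 : A.eps (h.piH a) * A.eps b * h.dm c =
      A.eps (h.piH a) * A.eps (h.piH b) * h.dm c +
      A.eps (h.piH a) * A.eps (A.d (h.dm b)) * h.dm c +
      A.eps (h.piH a) * A.eps (h.dm (A.d b)) * h.dm c := by
    rw [← add_mul, ← add_mul, ← mul_add, ← mul_add, ← map_add, ← map_add, ← h.hodge]
  rw [assocDefect, map_sub, map_add, map_add, h.integralA_piH_mul (h.piH_mem_harmonic c),
    h.integralA_mul_piH (hπh a)]
  simp only [productHomotopy_apply, map_add, add_mul, mul_add]
  rw [h.integralA_harmonic_mul_dm (hπh _), h.integralA_harmonic_mul_dm (hπh _), s1, ha1, hb1,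
    ← mul_assoc, hc1, ← mul_assoc, hc2, ← mul_assoc]
  simp only [map_add, s6, s6', s7, s8, s9, s10]
  ring

/-- `∫ d⁻(x d⁻(x²)) x² = 0`, by adjointness of `d⁻`. -/
lemma integralA_dm_mul_gen [CharZero K] (H : h.FormalRange r x) :
    A.integralA (h.dm (x * h.dm (x * x)) * (x * x)) = 0 := by
  rw [h.integralA_dm_mul, A.eps_mul, A.eps_of_mem H.tail_gen_mem, mul_smul_comm, smul_mul_assoc,
    mul_assoc, H.tail_gen_sq, mul_zero, smul_zero, map_zero]

/-- In low degrees the associativity defect reduces to the operation `m_3`, up to terms which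
involve one letter `d⁻ (x²)` and three letters `x`. -/
lemma integralA_assocDefect_mul [CharZero K] (H : h.FormalRange r x) {i j k : ℤ}
    {a b c u : A.carrier}
    (ha : a ∈ h.smallModel r x) (hb : b ∈ h.smallModel r x) (hc : c ∈ h.smallModel r x)
    (hi : a ∈ A.gr i) (hj : b ∈ A.gr j) (hk : c ∈ A.gr k) (hir : (r : ℤ) ≤ i) (hjr : (r : ℤ) ≤ j)
    (hkr : (r : ℤ) ≤ k) (hu : u ∈ h.harmonic) (hud : u ∈ A.gr (n - (i + j + k - 1)))
    (hur : (r : ℤ) ≤ n - (i + j + k - 1)) :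
    A.integralA (h.assocDefect a b c * u) = 0 := by
  have hr := H.two_le
  have hn := H.le
  have ha0 : h.dm a = 0 := eq_zero_of_mem_tail ha.1 (h.dm_mem hi) (by omega)
  have hb0 : h.dm b = 0 := eq_zero_of_mem_tail hb.1 (h.dm_mem hj) (by omega)
  have hc0 : h.dm c = 0 := eq_zero_of_mem_tail hc.1 (h.dm_mem hk) (by omega)
  have hZ : h.assocDefect a b c = h.dm (a * b) * c - A.eps (h.piH a) * h.dm (b * c) := by
    simp [assocDefect, productHomotopy_apply, ha0, hb0, hc0]
  have hdec : ∀ {l : ℤ} {v : A.carrier}, v ∈ h.smallModel r x → v ∈ A.gr l → h.dm v = 0 →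
      l < 2 * r → ∃ α : K, v = h.piH v + α • h.dm (x * x) := by
    intro l v hv hl hv0 hlr
    obtain ⟨α, hα⟩ := exists_smul_of_mem_tail hv.2 (k := l) (by simpa using h.dm_mem (A.d_mem hl))
      (by omega)
    refine ⟨α, ?_⟩
    rw [LinearMap.comp_apply] at hα
    rw [← hα]
    conv_lhs => rw [h.hodge v, hv0, map_zero, add_zero]
  obtain ⟨α, hα⟩ := hdec ha hi ha0 (by omega)
  obtain ⟨β, hβ⟩ := hdec hb hj hb0 (by omega)
  obtain ⟨γ, hγ⟩ := hdec hc hk hc0 (by omega)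
  have hmu : A.integralA ((h.dm (h.piH a * h.piH b) * h.piH c -
      A.eps (h.piH a) * h.dm (h.piH b * h.piH c)) * u) = 0 := by
    rw [← h.integralA_piH_mul hu, H.mu_three (h.piH_mem_harmonic _) (h.piH_mem_harmonic _)
      (h.piH_mem_harmonic _) (h.piH_mem hi) (h.piH_mem hj) (h.piH_mem hk), zero_mul, map_zero]
  have hπ : ∀ {l : ℤ} {v : A.carrier}, v ∈ h.smallModel r x → v ∈ A.gr l → l < 2 * r - 1 →
      h.piH v = v := fun hv hl hlr => h.mem_harmonic_iff.1 (mem_harmonic_of_lt hv hl hlr)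
  by_cases hall : i < 2 * r - 1 ∧ j < 2 * r - 1 ∧ k < 2 * r - 1
  · rw [hπ ha hi hall.1, hπ hb hj hall.2.1, hπ hc hk hall.2.2] at hmu
    rw [hZ, hπ ha hi hall.1, hmu]
  -- a letter of degree `2 r - 1` forces `r = 2`, and the other letters have degree `2`
  obtain rfl : r = 2 := by omega
  push_cast at *
  have hmul : ∀ {l : ℤ} {v : A.carrier}, v ∈ h.smallModel 2 x → v ∈ A.gr l → l = 2 →
      ∃ α : K, v = α • x := by
    rintro l v hv hl rfl
    exact H.exists_smul _ (mem_harmonic_of_lt hv hl (by norm_num)) hl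
  have hx2 : x ∈ A.gr 2 := H.mem_gr
  have hxe : A.eps x = x := by rw [A.eps_of_mem hx2, sgn_even even_two, one_smul]
  have hcomm : ∀ {l : ℤ} {v : A.carrier}, v ∈ A.gr l → v * x = x * v := by
    intro l v hv
    rw [A.mul_comm_of_mem hv hx2, sgn_even (even_two.mul_left l), one_smul]
  have hxx := A.mul_mem hx2 hx2
  have hy := h.dm_mem hxx
  have hxy := h.dm_mem (A.mul_mem hx2 hy)
  have hgen := H.integralA_dm_mul_gen
  have hsq := H.tail_gen_sq
  obtain ⟨δ, rfl⟩ := H.exists_smul u hu (by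
    convert hud using 2
    push_cast
    omega)
  set y := h.dm (x * x) with hydef
  rcases (by omega :
    (i = 3 ∧ j = 2 ∧ k = 2) ∨ (i = 2 ∧ j = 3 ∧ k = 2) ∨ (i = 2 ∧ j = 2 ∧ k = 3)) with
    ⟨-, hj2, hk2⟩ | ⟨hi2, -, hk2⟩ | ⟨hi2, hj2, -⟩
  · obtain ⟨β', rfl⟩ := hmul hb hj hj2
    obtain ⟨γ', rfl⟩ := hmul hc hk hk2
    have hbπ := hπ hb hj (by omega)
    have hcπ := hπ hc hk (by omega)
    rw [hbπ, hcπ] at hmu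
    have e : h.assocDefect a (β' • x) (γ' • x) =
        h.dm (h.piH a * β' • x) * γ' • x - A.eps (h.piH a) * h.dm (β' • x * γ' • x) +
          (α * β' * γ') • (h.dm (x * y) * x) := by
      rw [hZ]
      nth_rewrite 1 [hα]
      rw [add_mul, map_add, add_mul, smul_mul_smul_comm, hcomm hy, map_smul, smul_mul_smul_comm]
      abel
    rw [e, add_mul, map_add, hmu, zero_add, smul_mul_smul_comm, map_smul, mul_assoc (h.dm (x * y)),
      hgen, smul_zero]
  · obtain ⟨α', rfl⟩ := hmul ha hi hi2
    obtain ⟨γ', rfl⟩ := hmul hc hk hk2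
    have haπ := hπ ha hi (by omega)
    have hcπ := hπ hc hk (by omega)
    rw [haπ, hcπ] at hmu
    have e : h.assocDefect (α' • x) b (γ' • x) =
        h.dm (α' • x * h.piH b) * γ' • x - A.eps (α' • x) * h.dm (h.piH b * γ' • x) := by
      have e0 : h.dm (x * y) * x = x * h.dm (y * x) := by rw [hcomm hxy, hcomm hy]
      rw [hZ, haπ]
      nth_rewrite 1 2 [hβ]
      rw [mul_add, add_mul, map_add, map_add, add_mul, mul_add, smul_mul_smul_comm α' x β,
        smul_mul_smul_comm β y, map_smul, map_smul, map_smul, hxe, smul_mul_smul_comm,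
        smul_mul_smul_comm α' x (β * γ'), e0, mul_assoc]
      abel
    rw [e, hmu]
  · obtain ⟨α', rfl⟩ := hmul ha hi hi2
    obtain ⟨β', rfl⟩ := hmul hb hj hj2
    have haπ := hπ ha hi (by omega)
    have hbπ := hπ hb hj (by omega)
    rw [haπ, hbπ] at hmu
    have e : h.assocDefect (α' • x) (β' • x) c =
        h.dm (α' • x * β' • x) * h.piH c - A.eps (α' • x) * h.dm (β' • x * h.piH c) -
          (α' * β' * γ) • (h.dm (x * y) * x) := by
      rw [hZ, haπ]
      nth_rewrite 1 2 [hγ]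
      rw [mul_add, mul_add, map_add, mul_add, smul_mul_smul_comm α' x β', map_smul, map_smul,
        ← hydef, smul_mul_smul_comm (α' * β') y γ y, hsq, smul_zero, smul_mul_smul_comm β' x γ y,
        map_smul, hxe, smul_mul_smul_comm α' x (β' * γ), hcomm hxy, mul_assoc]
      abel
    rw [e, sub_mul, map_sub, hmu, zero_sub, smul_mul_smul_comm, map_smul, mul_assoc (h.dm (x * y)),
      hgen, smul_zero, neg_zero]

/-- The associativity relation holds without a third component. -/
lemma piH_assocDefect [CharZero K] (H : h.FormalRange r x) {a b c : A.carrier}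
    (ha : a ∈ h.smallModel r x) (hb : b ∈ h.smallModel r x) (hc : c ∈ h.smallModel r x) :
    h.piH (h.assocDefect a b c) = 0 := by
  refine smallModel_induction (p := fun a => h.piH (h.assocDefect a b c) = 0)
    (by simp [assocDefect]) (fun a a' h1 h2 => ?_) (fun i a ha hi => ?_) ha
  · have e : h.assocDefect (a + a') b c = h.assocDefect a b c + h.assocDefect a' b c := by
      simp only [assocDefect, add_mul, map_add, LinearMap.add_apply]
      abel
    rw [e, map_add, h1, h2, add_zero]
  refine smallModel_induction (p := fun b => h.piH (h.assocDefect a b c) = 0)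
    (by simp [assocDefect]) (fun b b' h1 h2 => ?_) (fun j b hb hj => ?_) hb
  · have e : h.assocDefect a (b + b') c = h.assocDefect a b c + h.assocDefect a b' c := by
      simp only [assocDefect, add_mul, mul_add, map_add, LinearMap.add_apply]
      abel
    rw [e, map_add, h1, h2, add_zero]
  refine smallModel_induction (p := fun c => h.piH (h.assocDefect a b c) = 0)
    (by simp [assocDefect]) (fun c c' h1 h2 => ?_) (fun k c hc hk => ?_) hc
  · have e : h.assocDefect a b (c + c') = h.assocDefect a b c + h.assocDefect a b c' := by
      simp only [assocDefect, mul_add, map_add]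
      abel
    rw [e, map_add, h1, h2, add_zero]
  have h0 : h.dm 1 = 0 := h.dm_of_mem h.one_mem_harmonic
  rcases H.eq_smul_one_or_le ha hi with ⟨t, rfl⟩ | hi'
  · simp [assocDefect, productHomotopy_apply, h0, h.piH_one]
  rcases H.eq_smul_one_or_le hb hj with ⟨t, rfl⟩ | hj'
  · simp [assocDefect, productHomotopy_apply, h0, h.piH_one]
  rcases H.eq_smul_one_or_le hc hk with ⟨t, rfl⟩ | hk'
  · simp [assocDefect, productHomotopy_apply, h0, h.piH_one]
  have hmem : h.assocDefect a b c ∈ A.gr (i + j + k - 1) := by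
    refine Submodule.sub_mem _ (Submodule.add_mem _ (h.productHomotopy_mem (A.mul_mem hi hj) hk) ?_)
      (Submodule.add_mem _ ?_ ?_)
    · convert A.mul_mem (h.piH_mem (h.productHomotopy_mem hi hj)) (h.piH_mem hk) using 2
      ring
    · convert h.productHomotopy_mem hi (A.mul_mem hj hk) using 2
      ring
    · convert A.mul_mem (A.eps_mem (h.piH_mem hi)) (h.piH_mem (h.productHomotopy_mem hj hk)) using 2
      ring
  refine h.piH_eq_zero_of hmem fun u hu hud => ?_
  rcases h.harmonic_cases H.conn hu hud with ⟨t, rfl⟩ | hur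
  · rw [mul_smul_one, map_smul, H.integralA_assocDefect ha hb hc hi hj hk hi' hj', smul_zero]
  · exact H.integralA_assocDefect_mul ha hb hc hi hj hk hi' hj' hk' hu hud hur

/-- The harmonic class and the homotopy `c` as a morphism with two components from the small model
to the cohomology. -/
def twoStepMorphism [CharZero K] (H : h.FormalRange r x) :
    DGCA.TwoStepMorphism A.toDGCA A.cohomology where
  S := h.smallModel r x
  E := A.cohomology.geSub (3 * r - 1)
  P := h.harmonicClass
  c := h.productHomotopy.compr₂ h.harmonicClass
  d_eq_zero _ := rfl
  one_mem := harmonic_le_smallModel h.one_mem_harmonic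
  mul_mem ha hb := H.mul_mem_smallModel ha hb
  d_mem ha := d_mem_smallModel ha
  proj_mem k _ ha := proj_mem_smallModel k ha
  proj_mem_E k _ he := DGCA.proj_mem_geSub k he
  mul_mem_left y e he := by
    have := DGCA.mul_mem_geSub (DGCA.mem_geSub_zero y) he
    rwa [zero_add] at this
  mul_mem_right y e he := by
    have := DGCA.mul_mem_geSub he (DGCA.mem_geSub_zero y)
    rwa [add_zero] at this
  mul_eq_zero he he' := by
    have hr := H.two_le
    have hn := H.le
    exact DGCA.eq_zero_of_mem_geSub (fun k hk => cohomology_gr_eq_bot (by omega))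
      (DGCA.mul_mem_geSub he he')
  P_mem ha := h.harmonicClass_mem ha
  P_d a := h.harmonicClass_eq_zero.2 (h.piH_d a)
  P_one := h.harmonicClass_one
  P_mul_mem {a b} ha hb := by
    rw [h.harmonicClass_mul_sub]
    exact Submodule.add_mem _ (H.productHomotopy_mem_geSub (d_mem_smallModel ha) hb)
      (H.productHomotopy_mem_geSub (eps_mem_smallModel ha) (d_mem_smallModel hb))
  c_mem_gr ha hb := h.harmonicClass_mem (h.productHomotopy_mem ha hb)
  c_mem ha hb := H.productHomotopy_mem_geSub ha hb
  c_one_left a := by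
    rw [LinearMap.compr₂_apply, harmonicClass_eq_zero, productHomotopy_apply,
      h.dm_of_mem h.one_mem_harmonic, h.piH_one]
    simp
  c_one_right a := by
    rw [LinearMap.compr₂_apply, harmonicClass_eq_zero, productHomotopy_apply,
      h.dm_of_mem h.one_mem_harmonic]
    simp
  c_d _ _ := h.harmonicClass_mul_sub _ _
  c_comm ha hb hi hj := H.productHomotopy_comm ha hb hi hj
  c_assoc {a b c} ha hb hc := by
    have key := H.piH_assocDefect ha hb hc
    rw [← harmonicClass_eq_zero, assocDefect, map_sub, sub_eq_zero, map_add, map_add] at key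
    simp only [LinearMap.compr₂_apply]
    rw [h.harmonicClass_mul, ← harmonicClass_eps, h.harmonicClass_mul, h.piH_eps]
    exact key

/-- The strictification connects `A` with its cohomology. -/
theorem isFormal [CharZero K] (H : h.FormalRange r x) : A.IsFormal := by
  refine (Relation.EqvGen.symm _ _ (Relation.EqvGen.rel _ _
    (H.twoStepMorphism.quasiIsoTo_source ?_ ?_))).trans _ _ _ (Relation.EqvGen.rel _ _
    (H.twoStepMorphism.quasiIsoTo_target ?_ ?_))
  · rintro a ha - ⟨z, rfl⟩
    exact ⟨h.dm (A.d z), dm_mem_smallModel ha, h.d_dm_d z⟩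
  · intro b hb
    refine ⟨h.piH b, piH_mem_smallModel b, h.d_piH b, h.dm b, ?_⟩
    conv_lhs => rw [h.hodge b, hb, map_zero, add_zero]
  · intro a ha hda hPa
    refine ⟨h.dm a, dm_mem_smallModel ha, ?_⟩
    conv_rhs => rw [h.hodge a, hda, h.harmonicClass_eq_zero.1 hPa, map_zero, add_zero, zero_add]
  · intro b
    obtain ⟨z, rfl⟩ := A.exists_cls_eq b
    refine ⟨h.piH z, piH_mem_smallModel _, h.d_piH _, ?_⟩
    change h.harmonicClass (h.piH z) = _
    rw [h.harmonicClass_piH]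
    exact h.harmonicCls_toHarmonic z

end FormalRange

end HodgeHomotopy

end PoincareDGCA

end

theorem mainTheorem2 {K : Type u} [Field K] [CharZero K] {n r : ℕ} (hr : 2 ≤ r)
    (A : PoincareDGCA K n) (h : A.HodgeHomotopy) (hconn : A.IsConnectedUpTo r)
    (hb : A.betti r = 1) :
    ∃ S : CInftyStructure h.harmonicGr,
      S.IsMinimal ∧ S.IsUnital h.one ∧
      (∃ F : CInftyStructure.Morphism S A.toCInfty,
        F.IsQuasiIso ∧ F.IsUnital h.one 1 ∧ ∀ α : h.harmonic, F.f 1 ![α] = (α : A.carrier)) ∧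
      (∀ α β : h.harmonic, S.m 2 ![α, β] = h.toHarmonic ((α : A.carrier) * (β : A.carrier))) ∧
      (∀ k : ℕ, 2 ≤ k → ∀ (p : ℕ → ℤ) (α : ℕ → h.harmonic), (∀ j, α j ∈ h.harmonicGr (p j)) →
        S.m k (fun j => α j) = h.toHarmonic (h.mhat k p (fun j => (α j : A.carrier)))) ∧
      (∀ ℓ : ℕ, 4 ≤ ℓ → n ≤ ℓ * (r - 1) + 4 → ∀ k : ℕ, ℓ - 1 ≤ k → S.m k = 0) ∧
      (n ≤ 6 * r - 2 → ∀ k : ℕ, 5 ≤ k → S.m k = 0) ∧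
      (n ≤ 5 * r - 1 → ∀ k : ℕ, 4 ≤ k → S.m k = 0) ∧
      (n ≤ 4 * r → (∀ k : ℕ, 3 ≤ k → S.m k = 0) ∧ A.IsFormal) := by
  have hvan : ∀ ℓ : ℕ, 4 ≤ ℓ → n ≤ ℓ * (r - 1) + 4 → ∀ k : ℕ, ℓ - 1 ≤ k →
      h.transferOp k = 0 := by
    intro ℓ hℓ hn k hk
    refine h.transferOp_eq_zero hconn hb (by omega) ?_
    have h1 : n ≤ (k + 1) * (r - 1) + 4 :=
      hn.trans (Nat.add_le_add_right (Nat.mul_le_mul_right _ (by omega)) _)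
    have h2 : (n : ℤ) ≤ (((k + 1) * (r - 1) + 4 : ℕ) : ℤ) := by exact_mod_cast h1
    push_cast [(by omega : 1 ≤ r)] at h2
    exact h2
  refine ⟨h.transferStructure, h.transferStructure_isMinimal, h.transferStructure_isUnital,
    ⟨h.transferMorphism, h.transferMorphism_isQuasiIso, h.transferMorphism_isUnital,
      h.transferMor_one⟩, h.transferOp_two, fun k _ p α hα => h.transferOp_eq_mhat k p α hα, hvan,
    fun hn k hk => hvan 6 (by norm_num) (by omega) k (by omega),
    fun hn k hk => hvan 5 (by norm_num) (by omega) k (by omega),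
    fun hn => ⟨fun k hk => hvan 4 le_rfl (by omega) k (by omega), ?_⟩⟩
  obtain ⟨x, hx, hxr, -, hgen⟩ := h.exists_harmonic_generator hb
  refine PoincareDGCA.HodgeHomotopy.FormalRange.isFormal (h := h) (r := r) (x := x)
    ⟨hr, hconn, hn, hx, hxr, hgen, ?_⟩
  exact fun ha hb' hc hi hj hk => h.piH_triple_eq_zero hconn hb hn ha hb' hc hi hj hk
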